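/- **Setting.** We work in ordinary set theory. (The paper works in $\mathsf{CZF}$, and in $\mathsf{CZF}+\mathsf{REA}$ when $\mathrm{W}$-types are involved; $\mathsf{REA}$, "every set is a subset of a regular set", is a theorem of ordinary set theory.) *Pcas.* A pca (over $\omega$) is a set $A$ with at least two elements and a partial binary application $(a,b)\mapsto ab$ (associating to the left), with elements $\mathbf k,\mathbf s,\mathbf p,\mathbf p_0,\mathbf p_1,\mathbf{succ},\mathbf{pred},\mathbf d$ and a map $n\mapsto\bar n$, $\omega\to A$, such that for all $a,b,c\in A$, $n,m\in\omega$: $\mathbf kab\simeq a$; $\mathbf sab\downarrow$ and $\mathbf sabc\simeq ac(bc)$; $\mathbf pab\downarrow$, $\mathbf pabc\simeq cab$, $\mathbf p_0a\simeq a\mathbf k$, $\mathbf p_1a\simeq a\bar{\mathbf k}$ with $\bar{\mathbf k}=\mathbf k(\mathbf s\mathbf k\mathbf k)$ (so $\mathbf p=\lambda xyz.zxy$, $\mathbf p_0=\lambda x.x\mathbf k$, $\mathbf p_1=\lambda x.x(\lambda xy.y)$, and $\mathbf p_i(\mathbf pa_0a_1)\simeq a_i$); $\mathbf{succ}\,\bar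 n\simeq\overline{n+1}$, $\mathbf{pred}\,\overline{n+1}\simeq\bar n$; $\mathbf d\bar n\bar mab\simeq a$ if $n=m$ and $\simeq b$ otherwise. Put $\mathbf 0=\bar 0$, $\mathbf 1=\bar 1$, and $a_i=(a)_i=\mathbf p_ia$. A *closed term* is an application term built from $\mathbf k,\mathbf s,\mathbf p,\mathbf p_0,\mathbf p_1,\mathbf 0,\mathbf 1,\mathbf{succ},\mathbf{pred},\mathbf d$; it has a partial value in every pca. A statement about partial terms asserts in particular that they are defined. *Realizability.* $\mathrm V_{\rm ext}(A)$ is the smallest class containing every set $x\subseteq A\times A\times \mathrm V_{\rm ext}(A)$. For $a,b\in A$ and a formula $\varphi$ of set theory with parameters in $\mathrm V_{\rm ext}(A)$, the relation $a=b\Vdash\varphi$ is defined by recursion: - $a=b\Vdash x\in y$ iff $\exists z\,(\langle (a)_0,(b)_0,z\rangle\in y$ and $(a)_1=(b)_1\Vdash x=z)$; - $a=b\Vdash x=y$ iff $(ac)_0=(bd)_0\Vdash z\in y$ for all $\langle c,d,z\rangle\in x$, and $(ac)_1=(bd)_1\Vdash z\in x$ for all $\langle c,d,z\rangle\in y$;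 - $a=b\Vdash\varphi\wedge\psi$ iff $(a)_0=(b)_0\Vdash\varphi$ and $(a)_1=(b)_1\Vdash\psi$; - $a=b\Vdash\varphi\vee\psi$ iff either $(a)_0=(b)_0=\mathbf 0$ and $(a)_1=(b)_1\Vdash\varphi$, or $(a)_0=(b)_0=\mathbf 1$ and $(a)_1=(b)_1\Vdash\psi$; - $a=b\Vdash\neg\varphi$ iff there are no $c,d$ with $c=d\Vdash\varphi$; $a=b\Vdash\varphi\to\psi$ iff $c=d\Vdash\varphi$ implies $ac=bd\Vdash\psi$ for all $c,d$; - $a=b\Vdash\forall x\in y\,\varphi$ iff $ac=bd\Vdash\varphi$ for all $\langle c,d,x\rangle\in y$; $a=b\Vdash\exists x\in y\,\varphi$ iff there is $x$ with $\langle (a)_0,(b)_0,x\rangle\in y$ and $(a)_1=(b)_1\Vdash\varphi$; - $a=b\Vdash\forall x\,\varphi$ (resp. $\exists x\,\varphi$) iff $a=b\Vdash\varphi$ for all (resp. some) $x\in\mathrm V_{\rm ext}(A)$. For a closed term $\mathbf t$, $\mathbf t\Vdash\varphi$ means that $\mathbf t$ has a value $a$ in $A$ with $a=a\Vdash\varphi$.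 Let $\langle x,y\rangle_A=\{\langle\mathbf 0,\mathbf 0,\{\langle\mathbf 0,\mathbf 0,x\rangle\}\rangle,\langle\mathbf 1,\mathbf 1,\{\langle\mathbf 0,\mathbf 0,x\rangle,\langle\mathbf 1,\mathbf 1,y\rangle\}\rangle\}$ and $\dot n=\{\langle\bar m,\bar m,\dot m\rangle\mid m<n\}$. *Types.* Put $\mathsf N_n=\mathbf p\bar 0\bar n$, $\mathsf N=\mathbf p\bar 1\mathbf 0$, $\Pi_\sigma i=\mathbf p\bar 2(\mathbf p\sigma i)$, $\Sigma_\sigma i=\mathbf p\bar 3(\mathbf p\sigma i)$, $\mathrm I_\sigma(a,b)=\mathbf p\bar 4(\mathbf p\sigma(\mathbf pab))$, $\mathrm W_\sigma i=\mathbf p\bar 5(\mathbf p\sigma i)$. The relations $\sigma\sim\tau$ and $a\sim_\sigma b$ are defined inductively: - $\mathsf N_n\sim\mathsf N_n$, with $a\sim_{\mathsf N_n}b$ iff $a=b=\bar m$ for some $m<n$; $\mathsf N\sim\mathsf N$, with $a\sim_{\mathsf N}b$ iff $a=b=\bar m$ for some $m\in\omega$; - if $\sigma\sim\tau$ and $a\sim_\sigma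 b$ always implies $ia\sim jb$, then: $\alpha=\Pi_\sigma i\sim\Pi_\tau j$, with $f\sim_\alpha g$ iff $fa\sim_{ia}gb$ whenever $a\sim_\sigma b$; $\beta=\Sigma_\sigma i\sim\Sigma_\tau j$, with $a\sim_\beta b$ iff $a_0\sim_\sigma b_0$ and $a_1\sim_{ia_0}b_1$; and $\delta=\mathrm W_\sigma i\sim\mathrm W_\tau j$, with $\sim_\delta$ the smallest relation such that $c\sim_\delta d$ if $c_0\sim_\sigma d_0$ and $c_1p\sim_\delta d_1q$ whenever $p\sim_{ic_0}q$; - if $\sigma\sim\tau$, $a\sim_\sigma a'$ and $b\sim_\sigma b'$, then $\gamma=\mathrm I_\sigma(a,b)\sim\mathrm I_\tau(a',b')$, with $c\sim_\gamma d$ iff $c=d=\mathbf 0$ and $a\sim_\sigma b$. All clauses together give the $\Pi\Sigma\mathrm{WI}$ structure; omitting the $\mathrm W$-clause gives the $\Pi\Sigma\mathrm I$ structure; omitting the $\mathrm W$- and $\mathrm I$-clauses gives the $\Pi\Sigma$ structure. $\sigma$ is a *type* if $\sigma\sim\sigma$; $a$ *has type* $\sigma$ if $a\sim_\sigma a$;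 $i\in A$ is a *family of types over* $\sigma$ if $ia\sim ib$ whenever $a\sim_\sigma b$. *Names.* For $a$ of type $\sigma$ define $a^\sigma\in\mathrm V_{\rm ext}(A)$ by: $\bar m^{\mathsf N_n}=\bar m^{\mathsf N}=\dot m$; $f^{\Pi_\sigma i}=\{\langle a,b,\langle a^\sigma,(fa)^{ia}\rangle_A\rangle\mid a\sim_\sigma b\}$; $a^{\Sigma_\sigma i}=\langle (a_0)^\sigma,(a_1)^{ia_0}\rangle_A$; $c^{\mathrm I_\sigma(a,b)}=\emptyset$; and, for $\delta=\mathrm W_\sigma i$, $c^\delta=\langle (c_0)^\sigma,\{\langle p,q,\langle p^{ic_0},(c_1p)^\delta\rangle_A\rangle\mid p\sim_{ic_0}q\}\rangle_A$. Let $$X_\sigma=\{\langle a,b,a^\sigma\rangle\mid a\sim_\sigma b\},\qquad F_{\sigma,i}=\{\langle a,b,\langle a^\sigma,X_{ia}\rangle_A\rangle\mid a\sim_\sigma b\}.$$ *Set constructions.* For a function $F$ with domain $X$: $\Pi(X,F)$ is the set of functions $f$ with domain $X$ and $f(x)\in F(x)$ for all $x\in X$; $\Sigma(X,F)=\{\langle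 x,y\rangle\mid x\in X,\ y\in F(x)\}$; $\mathrm I(x,y)=\{z\in\{\emptyset\}\mid x=y\}$; $\mathrm W(X,F)$ is the smallest class $W$ with $\langle x,f\rangle\in W$ whenever $x\in X$ and $f\colon F(x)\to W$, expressed, as for any inductively defined class, by: $y\in \mathrm W(X,F)$ iff $\langle u,y\rangle\in Z$ for some set $u$ and some set $Z$ of ordered pairs such that for each $\langle u',y'\rangle\in Z$ there are $x\in X$ and a function $f$ with domain $F(x)$ with $y'=\langle x,f\rangle$ and $\operatorname{ran}(f)\subseteq\bigcup_{v\in u'}\{w\mid\langle v,w\rangle\in Z\}$. **Theorem.** There are closed terms $\mathbf o,\mathbf{fun},\mathbf{prod},\mathbf{sum},\mathbf{id},\mathbf w$ such that for every pca $A$ the following hold in each of the $\Pi\Sigma$, $\Pi\Sigma\mathrm I$ and $\Pi\Sigma\mathrm{WI}$ type structures on $A$ (the same terms for all pcas and structures; (v) only for structures with $\mathrm I$-types, (vi) only for the structure with $\mathrm W$-types), for all types $\sigma$, all families $i$ of types over $\sigma$, and all $a,b$ of type $\sigma$: 1. (i) $\mathbf o\Vdash X_{\mathsf N}=\omega$;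 2. (ii) $\mathbf{fun}\Vdash F_{\sigma,i}\text{ is a function}\wedge\operatorname{dom}(F_{\sigma,i})=X_\sigma$; 3. (iii) $\mathbf{prod}\Vdash X_{\Pi_\sigma i}=\Pi(X_\sigma,F_{\sigma,i})$; 4. (iv) $\mathbf{sum}\Vdash X_{\Sigma_\sigma i}=\Sigma(X_\sigma,F_{\sigma,i})$; 5. (v) $\mathbf{id}\Vdash X_{\mathrm I_\sigma(a,b)}=\mathrm I(a^\sigma,b^\sigma)$; 6. (vi) $\mathbf w\Vdash X_{\mathrm W_\sigma i}=\mathrm W(X_\sigma,F_{\sigma,i})$. -/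

import Mathlib

universe u v

namespace ExtRealizability

/-! ## Partial combinatory algebras over the natural numbers -/

/-- A partial combinatory algebra over `ω`: a partial binary operation on a set with at least two
elements, with combinators `k`, `s`, the pairing combinators `p = λxyz. z x y`, `p0 = λx. x k`,
`p1 = λx. x k'`, where `k' = λxy. y = k (s k k)` (the projections need not be total), and numerals
with successor, predecessor and definition by cases.
Equations between elements of `Part A` are Kleene equalities. -/
class PCA (A : Type u) where
  app : A → A → Part A
  exists_ne : ∃ a b : A, a ≠ b
  k : A
  s : A
  p : A
  p0 : A
  p1 : A
  succ : A
  pred : A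
  d : A
  num : ℕ → A
  k_spec : ∀ a b : A, ((app k a).bind fun u => app u b) = Part.some a
  s_dom : ∀ a b : A, ((app s a).bind fun u => app u b).Dom
  s_spec : ∀ a b c : A, (((app s a).bind fun u => app u b).bind fun u => app u c) =
    (app a c).bind fun u => (app b c).bind fun w => app u w
  p_dom : ∀ a b : A, ((app p a).bind fun u => app u b).Dom
  p_spec : ∀ a b c : A, (((app p a).bind fun u => app u b).bind fun u => app u c) =
    (app c a).bind fun u => app u b
  p0_spec : ∀ a : A, app p0 a = app a k
  p1_spec : ∀ a : A, app p1 a =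
    (((app s k).bind fun u => app u k).bind fun u => app k u).bind fun k' => app a k'
  succ_spec : ∀ n : ℕ, app succ (num n) = Part.some (num (n + 1))
  pred_spec : ∀ n : ℕ, app pred (num (n + 1)) = Part.some (num n)
  d_spec : ∀ (n m : ℕ) (a b : A),
    ((((app d (num n)).bind fun u => app u (num m)).bind fun u => app u a).bind fun u => app u b) =
      Part.some (if n = m then a else b)

/-- Closed application terms built from the combinators. -/
inductive CTerm : Type
  | k | s | p | p0 | p1 | zero | one | succ | pred | d
  | app (t r : CTerm)

/-- The partial value of a closed term in a pca. -/
def CTerm.eval (A : Type u) [PCA A] : CTerm → Part A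
  | .k => Part.some PCA.k
  | .s => Part.some PCA.s
  | .p => Part.some PCA.p
  | .p0 => Part.some PCA.p0
  | .p1 => Part.some PCA.p1
  | .zero => Part.some (PCA.num 0)
  | .one => Part.some (PCA.num 1)
  | .succ => Part.some PCA.succ
  | .pred => Part.some PCA.pred
  | .d => Part.some PCA.d
  | .app t r => (t.eval A).bind fun a => (r.eval A).bind fun b => PCA.app a b

section Basic

variable {A : Type u} [PCA A]

/-- The application `a b`. -/
def ap (a b : A) : Part A := PCA.app a b

/-- `(a)₀`. -/
def fst (a : A) : Part A := PCA.app PCA.p0 a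

/-- `(a)₁`. -/
def snd (a : A) : Part A := PCA.app PCA.p1 a

/-- `(a)₁ b`. -/
def sndAp (a b : A) : Part A := (snd a).bind fun u => ap u b

/-- The numeral of `n`. -/
def num (n : ℕ) : A := PCA.num n

/-- `p a b`. -/
def pair (a b : A) : A := ((ap PCA.p a).bind fun u => ap u b).get (PCA.p_dom a b)

/-- `R` holds of two partial values: both are defined, and their values are related by `R`. -/
def Both (R : A → A → Prop) (s t : Part A) : Prop := ∃ a ∈ s, ∃ b ∈ t, R a b

end Basic

/-! ## The realizability universe -/

/-- The universe `V_ext(A)`. A name is a set of triples `⟨a, b, z⟩` with `a, b ∈ A` and `z` a name,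
presented as a small family of such triples: `⟨left i, right i, elt i⟩` for `i : ι`. -/
inductive VExt (A : Type u) : Type (u + 1)
  | mk (ι : Type u) (left right : ι → A) (elt : ι → VExt A) : VExt A

namespace VExt

variable {A : Type u}

/-- The index type of the triples in a name. -/
def Idx : VExt A → Type u
  | mk ι _ _ _ => ι

/-- The first component of a triple. -/
def left : (x : VExt A) → x.Idx → A
  | mk _ l _ _ => l

/-- The second component of a triple. -/
def right : (x : VExt A) → x.Idx → A
  | mk _ _ r _ => r

/-- The third component of a triple. -/
def elt : (x : VExt A) → x.Idx → VExt A
  | mk _ _ _ e => e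

/-- `IsElt z x`: the name `z` is the third component of a triple of `x`. -/
def IsElt (z x : VExt A) : Prop := ∃ i : x.Idx, x.elt i = z

theorem isElt_wf : WellFounded (IsElt (A := A)) := by
  refine ⟨fun x => ?_⟩
  induction x with
  | mk ι l r e ih => exact ⟨_, by rintro z ⟨i, rfl⟩; exact ih i⟩

/-- The order on unordered pairs of names along which realizability of equality is defined. -/
theorem pair_wf : WellFounded (Relation.TransGen (Sym2.GameAdd (IsElt (A := A)))) :=
  isElt_wf.sym2_gameAdd.transGen

theorem pair_lt {x y z w : VExt A} (hz : IsElt z x) (hw : IsElt w y) :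
    Relation.TransGen (Sym2.GameAdd IsElt) s(z, w) s(x, y) :=
  .tail (.single (Sym2.GameAdd.snd hw)) (Sym2.GameAdd.fst hz)

/-- The empty name. -/
def empty : VExt A := mk PEmpty PEmpty.elim PEmpty.elim PEmpty.elim

instance : Inhabited (VExt A) := ⟨empty⟩

variable [PCA A]

/-- `{⟨0, 0, x⟩}`. -/
def single (x : VExt A) : VExt A :=
  mk PUnit (fun _ => num 0) (fun _ => num 0) (fun _ => x)

/-- `{⟨0, 0, x⟩, ⟨1, 1, y⟩}`. -/
def upair (x y : VExt A) : VExt A :=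
  mk (ULift Bool) (fun i => if i.down then num 1 else num 0)
    (fun i => if i.down then num 1 else num 0) (fun i => if i.down then y else x)

/-- The internal ordered pair `{⟨0, 0, {x}⟩, ⟨1, 1, {x, y}⟩}`. -/
def opair (x y : VExt A) : VExt A := upair (single x) (upair x y)

/-- The canonical name of a natural number, `{⟨m, m, dot m⟩ | m < n}`. -/
def dot (n : ℕ) : VExt A :=
  mk (ULift (Fin n)) (fun m => num m.down) (fun m => num m.down) (fun m => dot m.down)
termination_by n
decreasing_by exact m.down.isLt

/-- `a = b ⊩ x = y`. The two membership clauses `(a c)₀ = (b d)₀ ⊩ z ∈ y` and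
`(a c)₁ = (b d)₁ ⊩ z ∈ x` are written out. -/
def EqR (x y : VExt A) (a b : A) : Prop :=
  (∀ i : x.Idx, Both
    (fun e f => ∃ j : y.Idx, y.left j ∈ fst e ∧ y.right j ∈ fst f ∧
      Both (fun e' f' => EqR (x.elt i) (y.elt j) e' f') (snd e) (snd f))
    ((ap a (x.left i)).bind fst) ((ap b (x.right i)).bind fst)) ∧
  (∀ j : y.Idx, Both
    (fun e f => ∃ i : x.Idx, x.left i ∈ fst e ∧ x.right i ∈ fst f ∧
      Both (fun e' f' => EqR (y.elt j) (x.elt i) e' f') (snd e) (snd f))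
    ((ap a (y.left j)).bind snd) ((ap b (y.right j)).bind snd))
termination_by pair_wf.wrap s(x, y)
decreasing_by
  · exact pair_lt ⟨i, rfl⟩ ⟨j, rfl⟩
  · rw [Sym2.eq_swap]
    exact pair_lt ⟨i, rfl⟩ ⟨j, rfl⟩

/-- `a = b ⊩ x ∈ y`. -/
def MemR (x y : VExt A) (a b : A) : Prop :=
  ∃ j : y.Idx, y.left j ∈ fst a ∧ y.right j ∈ fst b ∧ Both (EqR x (y.elt j)) (snd a) (snd b)

end VExt

/-! ## Formulas and realizability -/

/-- Formulas of the language of set theory with parameters in `V`, with bounded quantifiers as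
primitives. A quantifier binds a Lean variable. -/
inductive Fml (V : Type v) : Type v
  | mem (x y : V)
  | eq (x y : V)
  | and (φ ψ : Fml V)
  | or (φ ψ : Fml V)
  | neg (φ : Fml V)
  | imp (φ ψ : Fml V)
  | allB (y : V) (φ : V → Fml V)
  | exB (y : V) (φ : V → Fml V)
  | all (φ : V → Fml V)
  | ex (φ : V → Fml V)

section Realizes

variable {A : Type u} [PCA A]

/-- Extensional realizability: `Realizes φ a b` is `a = b ⊩ φ`. -/
def Realizes : Fml (VExt A) → A → A → Prop
  | .mem x y, a, b => VExt.MemR x y a b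
  | .eq x y, a, b => VExt.EqR x y a b
  | .and φ ψ, a, b => Both (Realizes φ) (fst a) (fst b) ∧ Both (Realizes ψ) (snd a) (snd b)
  | .or φ ψ, a, b =>
      (num 0 ∈ fst a ∧ num 0 ∈ fst b ∧ Both (Realizes φ) (snd a) (snd b)) ∨
      (num 1 ∈ fst a ∧ num 1 ∈ fst b ∧ Both (Realizes ψ) (snd a) (snd b))
  | .neg φ, _, _ => ∀ c d : A, ¬ Realizes φ c d
  | .imp φ ψ, a, b => ∀ c d : A, Realizes φ c d → Both (Realizes ψ) (ap a c) (ap b d)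
  | .allB y φ, a, b =>
      ∀ i : y.Idx, Both (Realizes (φ (y.elt i))) (ap a (y.left i)) (ap b (y.right i))
  | .exB y φ, a, b =>
      ∃ i : y.Idx, y.left i ∈ fst a ∧ y.right i ∈ fst b ∧
        Both (Realizes (φ (y.elt i))) (snd a) (snd b)
  | .all φ, a, b => ∀ x : VExt A, Realizes (φ x) a b
  | .ex φ, a, b => ∃ x : VExt A, Realizes (φ x) a b

/-- `t ⊩ φ` for a closed term `t`: it denotes some `a ∈ A` with `a = a ⊩ φ`. -/
def CTerm.Forces (t : CTerm) (φ : Fml (VExt A)) : Prop := ∃ a ∈ t.eval A, Realizes φ a a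

end Realizes

/-! ## Set-theoretic formulas -/

namespace Fml

variable {V : Type v}

/-- `φ ↔ ψ`. -/
def iff (φ ψ : Fml V) : Fml V := (φ.imp ψ).and (ψ.imp φ)

/-- `u = {x}`. -/
def isSingle (u x : V) : Fml V := (mem x u).and (allB u fun v => eq v x)

/-- `u = {x, y}`. -/
def isUpair (u x y : V) : Fml V :=
  (mem x u).and ((mem y u).and (allB u fun v => (eq v x).or (eq v y)))

/-- `z = ⟨x, y⟩`, where `⟨x, y⟩ = {{x}, {x, y}}`. -/
def isPair (z x y : V) : Fml V :=
  (exB z fun u => isSingle u x).and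
    ((exB z fun u => isUpair u x y).and (allB z fun u => (isSingle u x).or (isUpair u x y)))

/-- `⟨x, y⟩ ∈ f`. -/
def pairMem (x y f : V) : Fml V := exB f fun z => isPair z x y

/-- `x = ∅`. -/
def isEmpty (x : V) : Fml V := allB x fun y => neg (mem y x)

/-- `x = y ∪ {y}`. -/
def isSucc (x y : V) : Fml V :=
  (allB x fun z => (mem z y).or (eq z y)).and ((allB y fun z => mem z x).and (mem y x))

/-- `x = ω`: a set is in `x` iff it is empty or the successor of an element of `x`. -/
def isOmega (x : V) : Fml V :=
  all fun y => iff (mem y x) ((isEmpty y).or (exB x fun z => isSucc y z))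

/-- `f` is a set of ordered pairs. -/
def isRel (f : V) : Fml V := allB f fun z => ex fun x => ex fun y => isPair z x y

/-- `f` is a function. -/
def isFun (f : V) : Fml V :=
  (isRel f).and
    (allB f fun z₀ => allB f fun z₁ => all fun x => all fun y₀ => all fun y₁ =>
      ((isPair z₀ x y₀).and (isPair z₁ x y₁)).imp (eq y₀ y₁))

/-- `dom(f) = X`. -/
def hasDom (f X : V) : Fml V := all fun x => iff (mem x X) (ex fun y => pairMem x y f)

/-- `y ∈ F(x)`. -/
def memVal (y F x : V) : Fml V := ex fun Y => (pairMem x Y F).and (mem y Y)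

/-- `f ∈ Π(X, F)`: `f` is a function with domain `X` such that `f(x) ∈ F(x)` for all `x ∈ X`. -/
def memPi (f X F : V) : Fml V :=
  (isFun f).and ((hasDom f X).and (allB X fun x => ex fun y => (pairMem x y f).and (memVal y F x)))

/-- `Y = Π(X, F)`. -/
def isPi (Y X F : V) : Fml V := all fun f => iff (mem f Y) (memPi f X F)

/-- `z ∈ Σ(X, F)`: `z = ⟨x, y⟩` for some `x ∈ X` and `y ∈ F(x)`. -/
def memSigma (z X F : V) : Fml V :=
  exB X fun x => ex fun y => (isPair z x y).and (memVal y F x)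

/-- `Y = Σ(X, F)`. -/
def isSigma (Y X F : V) : Fml V := all fun z => iff (mem z Y) (memSigma z X F)

/-- `Y = I(x, y)`, where `I(x, y) = {z ∈ {∅} | x = y}`. -/
def isId (Y x y : V) : Fml V := all fun z => iff (mem z Y) ((isEmpty z).and (eq x y))

/-- `Z` is an iteration set for the inductive definition of `W(X, F)`, whose rules are
"from `ran(f)` infer `⟨x, f⟩`" for `x ∈ X` and `f` a function with domain `F(x)`: `Z` is a set of
ordered pairs and whenever `⟨u, y⟩ ∈ Z`, there are such `x`, `f` with `y = ⟨x, f⟩` and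
`ran(f) ⊆ ⋃_{v ∈ u} {w | ⟨v, w⟩ ∈ Z}`. -/
def isIterW (Z X F : V) : Fml V :=
  (isRel Z).and
    (all fun u => all fun y => (pairMem u y Z).imp
      (exB X fun x => ex fun f => (isPair y x f).and
        ((isFun f).and
          ((ex fun D => (pairMem x D F).and (hasDom f D)).and
            (all fun w => (ex fun t => pairMem t w f).imp (exB u fun v => pairMem v w Z))))))

/-- `y ∈ W(X, F)`, the smallest class `W` such that `⟨x, f⟩ ∈ W` whenever `x ∈ X` and
`f : F(x) → W`. As an inductively defined class it consists of those `y` for which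
`⟨u, y⟩ ∈ Z` for some set `u` and some iteration set `Z`. -/
def memW (y X F : V) : Fml V := ex fun u => ex fun Z => (isIterW Z X F).and (pairMem u y Z)

/-- `Y = W(X, F)`. -/
def isW (Y X F : V) : Fml V := all fun y => iff (mem y Y) (memW y X F)

end Fml

/-! ## Dependent types over a pca -/

/-- The three type structures. -/
inductive Kind : Type
  | piSigma | piSigmaI | piSigmaWI

/-- Does the structure have identity types? -/
def Kind.HasI : Kind → Prop
  | .piSigma => False
  | .piSigmaI => True
  | .piSigmaWI => True

/-- Does the structure have `W`-types? -/
def Kind.HasW : Kind → Prop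
  | .piSigma => False
  | .piSigmaI => False
  | .piSigmaWI => True

section Types

variable {A : Type u} [PCA A]

/-- `N_n = p 0 n`. -/
def tyFin (n : ℕ) : A := pair (num 0) (num n)

/-- `N = p 1 0`. -/
def tyNat : A := pair (num 1) (num 0)

/-- `Π_σ i = p 2 (p σ i)`. -/
def tyPi (σ i : A) : A := pair (num 2) (pair σ i)

/-- `Σ_σ i = p 3 (p σ i)`. -/
def tySigma (σ i : A) : A := pair (num 3) (pair σ i)

/-- `I_σ(a, b) = p 4 (p σ (p a b))`. -/
def tyId (σ a b : A) : A := pair (num 4) (pair σ (pair a b))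

/-- `W_σ i = p 5 (p σ i)`. -/
def tyW (σ i : A) : A := pair (num 5) (pair σ i)

/-- Equality of elements of `N_n`. -/
def relFin (n : ℕ) (a b : A) : Prop := ∃ m < n, a = num m ∧ b = num m

/-- Equality of elements of `N`. -/
def relNat (a b : A) : Prop := ∃ m : ℕ, a = num m ∧ b = num m

/-- Equality of elements of `Π_σ i`, where `B` is equality on `σ` and `F a b` equality on `i a`. -/
def relPi (B : A → A → Prop) (F : A → A → A → A → Prop) (f g : A) : Prop :=
  ∀ a b : A, B a b → Both (F a b) (ap f a) (ap g b)

/-- Equality of elements of `Σ_σ i`. -/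
def relSigma (B : A → A → Prop) (F : A → A → A → A → Prop) (a b : A) : Prop :=
  ∃ a₀ ∈ fst a, ∃ b₀ ∈ fst b, B a₀ b₀ ∧ Both (F a₀ b₀) (snd a) (snd b)

/-- Equality of elements of `I_σ(a, b)`. -/
def relId (B : A → A → Prop) (a b : A) (c d : A) : Prop := c = num 0 ∧ d = num 0 ∧ B a b

/-- Equality of elements of `W_σ i`: the smallest relation such that `c` and `d` are related if
`(c)₀` and `(d)₀` are related by `B`, and `(c)₁ p` and `(d)₁ q` are defined and related for all
`p`, `q` related by `F (c)₀ (d)₀`. -/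
inductive relW (B : A → A → Prop) (F : A → A → A → A → Prop) : A → A → Prop
  | mk (c d c₀ d₀ : A) (hc : c₀ ∈ fst c) (hd : d₀ ∈ fst d) (h₀ : B c₀ d₀)
      (hdom : ∀ p q : A, F c₀ d₀ p q → (sndAp c p).Dom ∧ (sndAp d q).Dom)
      (h : ∀ p q e e' : A, F c₀ d₀ p q → e ∈ sndAp c p → e' ∈ sndAp d q → relW B F e e') :
      relW B F c d

/-- The type structure of the given kind, as an inductively defined class of triples:
`TS K σ τ B` says that `σ ∼ τ` and that `B` is the relation `∼_σ`. The premises `hdom` and `hF`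
say that `i a` and `j b` are defined and `i a ∼ j b` whenever `B a b`, with `F a b` being the
relation `∼_{i a}`. -/
inductive TS (K : Kind) : A → A → (A → A → Prop) → Prop
  | fin (n : ℕ) : TS K (tyFin n) (tyFin n) (relFin n)
  | nat : TS K tyNat tyNat relNat
  | pi (σ τ i j : A) (B : A → A → Prop) (F : A → A → A → A → Prop) (hB : TS K σ τ B)
      (hdom : ∀ a b : A, B a b → (ap i a).Dom ∧ (ap j b).Dom)
      (hF : ∀ a b ρ ρ' : A, B a b → ρ ∈ ap i a → ρ' ∈ ap j b → TS K ρ ρ' (F a b)) :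
      TS K (tyPi σ i) (tyPi τ j) (relPi B F)
  | sigma (σ τ i j : A) (B : A → A → Prop) (F : A → A → A → A → Prop) (hB : TS K σ τ B)
      (hdom : ∀ a b : A, B a b → (ap i a).Dom ∧ (ap j b).Dom)
      (hF : ∀ a b ρ ρ' : A, B a b → ρ ∈ ap i a → ρ' ∈ ap j b → TS K ρ ρ' (F a b)) :
      TS K (tySigma σ i) (tySigma τ j) (relSigma B F)
  | id (hK : K.HasI) (σ τ a a' b b' : A) (B : A → A → Prop) (hB : TS K σ τ B)
      (ha : B a a') (hb : B b b') : TS K (tyId σ a b) (tyId τ a' b') (relId B a b)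
  | w (hK : K.HasW) (σ τ i j : A) (B : A → A → Prop) (F : A → A → A → A → Prop) (hB : TS K σ τ B)
      (hdom : ∀ a b : A, B a b → (ap i a).Dom ∧ (ap j b).Dom)
      (hF : ∀ a b ρ ρ' : A, B a b → ρ ∈ ap i a → ρ' ∈ ap j b → TS K ρ ρ' (F a b)) :
      TS K (tyW σ i) (tyW τ j) (relW B F)

/-- `σ ∼ τ`. -/
def Sim (K : Kind) (σ τ : A) : Prop := ∃ B, TS K σ τ B

/-- `a ∼_σ b`. -/
def SimAt (K : Kind) (σ a b : A) : Prop := ∃ τ B, TS K σ τ B ∧ B a b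

/-- `σ` is a type. -/
def IsType (K : Kind) (σ : A) : Prop := Sim K σ σ

/-- `a` has type `σ`. -/
def HasType (K : Kind) (σ a : A) : Prop := SimAt K σ a a

/-- `i` is a family of types over `σ`: `i a ∼ i b` whenever `a ∼_σ b`. -/
def IsFamily (K : Kind) (σ i : A) : Prop :=
  ∀ a b : A, SimAt K σ a b → Both (Sim K) (ap i a) (ap i b)

/-! ## Canonical names -/

/-- `Rep K σ a x` says that `a` has type `σ` and `x = a^σ`, by the inductive clauses for `a^σ`. -/
inductive Rep (K : Kind) : A → A → VExt A → Prop
  | fin (n m : ℕ) (h : m < n) : Rep K (tyFin n) (num m) (VExt.dot m)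
  | nat (m : ℕ) : Rep K tyNat (num m) (VExt.dot m)
  | pi (σ i f : A) (x y : A → VExt A) (hf : HasType K (tyPi σ i) f)
      (hx : ∀ a : A, HasType K σ a → Rep K σ a (x a))
      (hy : ∀ a τ e : A, HasType K σ a → τ ∈ ap i a → e ∈ ap f a → Rep K τ e (y a)) :
      Rep K (tyPi σ i) f
        (VExt.mk {q : A × A // SimAt K σ q.1 q.2} (fun q => q.1.1) (fun q => q.1.2)
          fun q => VExt.opair (x q.1.1) (y q.1.1))
  | sigma (σ i a a₀ a₁ τ : A) (x y : VExt A) (ha : HasType K (tySigma σ i) a)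
      (h₀ : a₀ ∈ fst a) (h₁ : a₁ ∈ snd a) (hτ : τ ∈ ap i a₀)
      (hx : Rep K σ a₀ x) (hy : Rep K τ a₁ y) : Rep K (tySigma σ i) a (VExt.opair x y)
  | id (σ a b c : A) (hc : HasType K (tyId σ a b) c) : Rep K (tyId σ a b) c VExt.empty
  | w (σ i c c₀ τ : A) (x : VExt A) (y z : A → VExt A) (hc : HasType K (tyW σ i) c)
      (h₀ : c₀ ∈ fst c) (hτ : τ ∈ ap i c₀) (hx : Rep K σ c₀ x)
      (hy : ∀ p : A, HasType K τ p → Rep K τ p (y p))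
      (hz : ∀ p e : A, HasType K τ p → e ∈ sndAp c p → Rep K (tyW σ i) e (z p)) :
      Rep K (tyW σ i) c
        (VExt.opair x
          (VExt.mk {q : A × A // SimAt K τ q.1 q.2} (fun q => q.1.1) (fun q => q.1.2)
            fun q => VExt.opair (y q.1.1) (z q.1.1)))

/-- `a^σ`, for `a` of type `σ`. -/
noncomputable def interp (K : Kind) (σ a : A) : VExt A :=
  Classical.epsilon fun x => Rep K σ a x

/-- `X_σ = {⟨a, b, a^σ⟩ | a ∼_σ b}`. -/
noncomputable def X (K : Kind) (σ : A) : VExt A :=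
  VExt.mk {q : A × A // SimAt K σ q.1 q.2} (fun q => q.1.1) (fun q => q.1.2)
    fun q => interp K σ q.1.1

/-- `F_{σ,i} = {⟨a, b, ⟨a^σ, X_τ⟩⟩ | a ∼_σ b ∧ i a = τ}`. -/
noncomputable def F (K : Kind) (σ i : A) : VExt A :=
  VExt.mk {q : A × A × A // SimAt K σ q.1 q.2.1 ∧ q.2.2 ∈ ap i q.1}
    (fun q => q.1.1) (fun q => q.1.2.1)
    fun q => VExt.opair (interp K σ q.1.1) (X K q.1.2.2)

end Types

end ExtRealizability

namespace ExtRealizability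

/-! ## Application of partial values -/

/-! The relation `a = b ⊩ φ` is ordinary unary realizability in disguise. The product `A × A` with
componentwise application is again a pca, a triple `⟨a, b, z⟩` of a name is a pair of an element of
`A × A` and a name, and each realizability clause becomes the usual one for the single realizer `(a,
b)`. This is `Tr`, with the clauses `tr_and`, ..., `tr_eq`. The combinators of `A × A` are diagonal,
so a closed term has a diagonal value there, and `forces_of_tr` brings the result back to `A`.
Realizers are written as lambda terms with lazy pairs, lazy case distinction and a fixed point
combinator. They mention no pca and no type, hence are uniform.

On the side of types, `TS.good` shows by one simultaneous induction that a code determines its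
relation and that this relation is a PER. Consequently names `a^σ` exist uniquely
(`HasType.hasName`), and related elements of related types have literally the same name
(`interp_congr`). The decisive converse is `Tr.simAt`: if `a^σ = b^σ` is realized at all, then `a
∼_σ b`. Together these make `F_{σ,i}`, the names of elements of `Π_σ i` and the branching functions
of elements of `W_σ i` graphs of functions in a strong sense (`IsGraph`): realized equality of
arguments forces literal equality of the values.

Each of the six statements then compares indices. An element of `X_τ` is an internal set equal to
some `a^τ`, with the index `a` supplied by the realizer. A realizer of `f ∈ Π(X_σ, F_{σ,i})`
computes from `a` the index of the value of `f` at `a^σ`. This computation is an element `g` of `Π_σ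
i`, because running it in `A × A` sends related pairs to related pairs, and `f = g^Π` by
extensionality (`Tr.fun_eq`). Sums are simpler, and identity types use `Tr.simAt` directly.

For `W`-types, `c^δ` is shown to lie in `W(X_σ, F_{σ,i})` by the iteration set of all `⟨u c, c^δ⟩`,
where `u c` is a name for the tree of predecessors of `c` (`exists_rank`, `tr_iter`). Conversely,
the fixed point combinator turns an entry `⟨u, y⟩` of any iteration set into an index for `y`, and
correctness is proved by ∈-induction on `u` (`Tr.of_w`). -/

theorem exists_some_of_dom {α : Type*} {s : Part α} (h : s.Dom) : ∃ a, s = Part.some a :=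
  ⟨s.get h, (Part.some_get h).symm⟩

section Pap

variable {P : Type u} [PCA P]

/-- Application of partial values. -/
def pap (s t : Part P) : Part P := s.bind fun a => t.bind fun b => PCA.app a b

infixl:70 " ⋄ " => pap

theorem some_pap_some (a b : P) : Part.some a ⋄ Part.some b = PCA.app a b := by simp [pap]

theorem dom_left_of_pap {s t : Part P} (h : (s ⋄ t).Dom) : s.Dom := by
  obtain ⟨v, hv⟩ := Part.dom_iff_mem.1 h
  obtain ⟨a, ha, -⟩ := Part.mem_bind_iff.1 hv
  exact Part.dom_iff_mem.2 ⟨a, ha⟩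

theorem dom_right_of_pap {s t : Part P} (h : (s ⋄ t).Dom) : t.Dom := by
  obtain ⟨v, hv⟩ := Part.dom_iff_mem.1 h
  obtain ⟨a, ha, h'⟩ := Part.mem_bind_iff.1 hv
  obtain ⟨b, hb, -⟩ := Part.mem_bind_iff.1 h'
  exact Part.dom_iff_mem.2 ⟨b, hb⟩

theorem pap_k (a b : P) : Part.some PCA.k ⋄ Part.some a ⋄ Part.some b = Part.some a := by
  simpa [pap] using PCA.k_spec a b

theorem pap_s (a b c : P) : Part.some PCA.s ⋄ Part.some a ⋄ Part.some b ⋄ Part.some c =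
    Part.some a ⋄ Part.some c ⋄ (Part.some b ⋄ Part.some c) := by
  simpa [pap] using PCA.s_spec a b c

theorem pap_k_dom (a : P) : (Part.some PCA.k ⋄ Part.some a).Dom := by
  refine dom_left_of_pap (t := Part.some a) ?_
  rw [pap_k]; trivial

theorem pap_s_dom (a b : P) : (Part.some PCA.s ⋄ Part.some a ⋄ Part.some b).Dom := by
  simpa [pap] using PCA.s_dom a b

/-- If `s`, `t` represent functions `f`, `g`, the combination `s s t` represents `f ⋄ g`. -/
theorem exists_s_rep {s t : Part P} {f g : P → Part P}
    (hs : ∃ a, s = Part.some a ∧ ∀ c, Part.some a ⋄ Part.some c = f c)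
    (ht : ∃ b, t = Part.some b ∧ ∀ c, Part.some b ⋄ Part.some c = g c) :
    ∃ e, Part.some PCA.s ⋄ s ⋄ t = Part.some e ∧ ∀ c, Part.some e ⋄ Part.some c = f c ⋄ g c := by
  obtain ⟨a, rfl, ha⟩ := hs
  obtain ⟨b, rfl, hb⟩ := ht
  obtain ⟨e, he⟩ := exists_some_of_dom (pap_s_dom a b)
  refine ⟨e, he, fun c => ?_⟩
  rw [← he, pap_s, ha, hb]

theorem exists_k_rep (a : P) :
    ∃ e, Part.some PCA.k ⋄ Part.some a = Part.some e ∧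
      ∀ c, Part.some e ⋄ Part.some c = Part.some a := by
  obtain ⟨c, hc⟩ := exists_some_of_dom (pap_k_dom a)
  exact ⟨c, hc, fun i => by rw [← hc, pap_k]⟩

theorem exists_skk : ∃ c : P, Part.some PCA.s ⋄ Part.some PCA.k ⋄ Part.some PCA.k = Part.some c ∧
    ∀ a, Part.some c ⋄ Part.some a = Part.some a := by
  obtain ⟨c, hc⟩ := exists_some_of_dom (pap_s_dom (PCA.k : P) PCA.k)
  refine ⟨c, hc, fun a => ?_⟩
  obtain ⟨d, hd⟩ := exists_some_of_dom (pap_k_dom a)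
  have h := pap_k a d
  rw [hd] at h
  rw [← hc, pap_s, hd, h]

/-- The first projection of a partial value. -/
def pfst (s : Part P) : Part P := Part.some PCA.p0 ⋄ s

/-- The second projection of a partial value. -/
def psnd (s : Part P) : Part P := Part.some PCA.p1 ⋄ s

theorem pfst_some (a : P) : pfst (Part.some a) = fst a := some_pap_some _ _

theorem psnd_some (a : P) : psnd (Part.some a) = snd a := some_pap_some _ _

theorem pfst_eq (s : Part P) : pfst s = s ⋄ Part.some PCA.k := by
  simp [pfst, pap, PCA.p0_spec]

theorem psnd_eq (s : Part P) : psnd s = s ⋄ (Part.some PCA.k ⋄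
    (Part.some PCA.s ⋄ Part.some PCA.k ⋄ Part.some PCA.k)) := by
  simp [psnd, pap, PCA.p1_spec]

theorem dom_of_pfst {s : Part P} (h : (pfst s).Dom) : s.Dom := dom_right_of_pap h

theorem pap_d (n m : ℕ) (a b : P) :
    Part.some PCA.d ⋄ Part.some (num n) ⋄ Part.some (num m) ⋄ Part.some a ⋄ Part.some b =
      Part.some (if n = m then a else b) := by
  simpa [pap, num] using PCA.d_spec n m a b

/-- If `n ≠ m` had the same numeral, `d n m a b` and `d m m a b` would coincide, giving `a = b` for
all `a`, `b`. This is what keeps type codes with different tags apart. -/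
theorem num_injective : Function.Injective (num : ℕ → P) := by
  intro n m h
  by_contra hne
  obtain ⟨a, b, hab⟩ := PCA.exists_ne (A := P)
  have h1 := pap_d n m a b
  have h2 := pap_d m m a b
  rw [h, h2] at h1
  simp [hne] at h1
  exact hab h1

theorem fst_pair (a b : P) : fst (pair a b) = Part.some a := by
  rw [← pfst_some, pfst_eq]
  have h : Part.some (pair a b) = Part.some PCA.p ⋄ Part.some a ⋄ Part.some b := by
    simp [pair, pap, ap]
  rw [h]
  have h1 := PCA.p_spec a b PCA.k
  have h2 := pap_k a b
  simp only [pap, Part.bind_some] at h2 ⊢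
  rw [h1, h2]

theorem snd_pair (a b : P) : snd (pair a b) = Part.some b := by
  rw [← psnd_some, psnd_eq]
  have h : Part.some (pair a b) = Part.some PCA.p ⋄ Part.some a ⋄ Part.some b := by
    simp [pair, pap, ap]
  obtain ⟨i, hi, hi'⟩ := exists_skk (P := P)
  obtain ⟨c, hc, hc'⟩ := exists_k_rep i
  rw [h, hi, hc]
  have h1 := PCA.p_spec a b c
  have h2 : Part.some c ⋄ Part.some a ⋄ Part.some b = Part.some b := by rw [hc', hi']
  simp only [pap, Part.bind_some] at h2 ⊢
  rw [h1, h2]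

theorem pair_inj {a b a' b' : P} (h : pair a b = pair a' b') : a = a' ∧ b = b' :=
  ⟨Part.some_injective (by rw [← fst_pair a b, h, fst_pair]),
    Part.some_injective (by rw [← snd_pair a b, h, snd_pair])⟩

end Pap

/-! ## Products of pcas -/

/-- The pair of two partial values. -/
def pprod {A : Type u} (s t : Part A) : Part (A × A) := s.bind fun a => t.map fun b => (a, b)

theorem mem_pprod {A : Type u} {s t : Part A} {v : A × A} : v ∈ pprod s t ↔ v.1 ∈ s ∧ v.2 ∈ t := by
  obtain ⟨a, b⟩ := v
  simp [pprod]

theorem pprod_some {A : Type u} (a b : A) : pprod (Part.some a) (Part.some b) = Part.some (a, b) := by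
  simp [pprod]

/-- Application in the product is defined exactly when both components are, so Kleene equalities
split. All pca axioms of `A × A` reduce to this. -/
theorem pprod_bind {A : Type u} (s t : Part A) (f g : A → Part A) :
    ((pprod s t).bind fun v => pprod (f v.1) (g v.2)) = pprod (s.bind f) (t.bind g) := by
  ext v
  simp only [Part.mem_bind_iff, mem_pprod]
  constructor
  · rintro ⟨w, ⟨h1, h2⟩, h3, h4⟩
    exact ⟨⟨_, h1, h3⟩, _, h2, h4⟩
  · rintro ⟨⟨a, h1, h3⟩, b, h2, h4⟩
    exact ⟨(a, b), ⟨h1, h2⟩, h3, h4⟩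

theorem pprod_dom {A : Type u} {s t : Part A} (hs : s.Dom) (ht : t.Dom) : (pprod s t).Dom :=
  Part.dom_iff_mem.2 ⟨(s.get hs, t.get ht), mem_pprod.2 ⟨Part.get_mem _, Part.get_mem _⟩⟩

/-- The product of a pca with itself, with componentwise application. -/
instance prodPCA (A : Type u) [PCA A] : PCA (A × A) where
  app f a := pprod (PCA.app f.1 a.1) (PCA.app f.2 a.2)
  exists_ne := by
    obtain ⟨a, b, h⟩ := PCA.exists_ne (A := A)
    exact ⟨(a, a), (b, a), fun h' => h (Prod.ext_iff.1 h').1⟩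
  k := (PCA.k, PCA.k)
  s := (PCA.s, PCA.s)
  p := (PCA.p, PCA.p)
  p0 := (PCA.p0, PCA.p0)
  p1 := (PCA.p1, PCA.p1)
  succ := (PCA.succ, PCA.succ)
  pred := (PCA.pred, PCA.pred)
  d := (PCA.d, PCA.d)
  num n := (PCA.num n, PCA.num n)
  k_spec a b := by
    rw [pprod_bind _ _ (fun u => PCA.app u b.1) fun u => PCA.app u b.2, PCA.k_spec, PCA.k_spec,
      pprod_some]
  s_dom a b := by
    rw [pprod_bind _ _ (fun u => PCA.app u b.1) fun u => PCA.app u b.2]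
    exact pprod_dom (PCA.s_dom _ _) (PCA.s_dom _ _)
  s_spec a b c := by
    rw [pprod_bind _ _ (fun u => PCA.app u b.1) fun u => PCA.app u b.2,
      pprod_bind _ _ (fun u => PCA.app u c.1) fun u => PCA.app u c.2, PCA.s_spec, PCA.s_spec]
    simp only [← pprod_bind]
  p_dom a b := by
    rw [pprod_bind _ _ (fun u => PCA.app u b.1) fun u => PCA.app u b.2]
    exact pprod_dom (PCA.p_dom _ _) (PCA.p_dom _ _)
  p_spec a b c := by
    rw [pprod_bind _ _ (fun u => PCA.app u b.1) fun u => PCA.app u b.2,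
      pprod_bind _ _ (fun u => PCA.app u c.1) fun u => PCA.app u c.2, PCA.p_spec, PCA.p_spec,
      pprod_bind _ _ (fun u => PCA.app u b.1) fun u => PCA.app u b.2]
  p0_spec a := by rw [PCA.p0_spec, PCA.p0_spec]
  p1_spec a := by
    rw [PCA.p1_spec, PCA.p1_spec]
    simp only [← pprod_bind]
  succ_spec n := by rw [PCA.succ_spec, pprod_some]
  pred_spec n := by rw [PCA.pred_spec, pprod_some]
  d_spec n m a b := by
    rw [pprod_bind _ _ (fun u => PCA.app u (PCA.num m)) fun u => PCA.app u (PCA.num m),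
      pprod_bind _ _ (fun u => PCA.app u a.1) fun u => PCA.app u a.2,
      pprod_bind _ _ (fun u => PCA.app u b.1) fun u => PCA.app u b.2, PCA.d_spec, PCA.d_spec,
      pprod_some]
    split <;> rfl

/-- Every combinator of the product is diagonal. This is the bridge from realizers in `A × A` back
to realizers in `A`. -/
theorem CTerm.eval_prod (A : Type u) [PCA A] (t : CTerm) :
    t.eval (A × A) = pprod (t.eval A) (t.eval A) := by
  induction t with
  | app t r ht hr =>
    simp only [CTerm.eval, ht, hr]
    rw [← pprod_bind]
    congr 1
    funext v
    rw [← pprod_bind]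
    rfl
  | _ => simp only [CTerm.eval, pprod_some]; rfl

/-! ## Lambda terms -/

/-- Closed terms denoting the constant function with value `t`. -/
def CTerm.thunk : CTerm → CTerm
  | .app t r => .app (.app .s t.thunk) r.thunk
  | t => .app .k t

/-- Terms with variables indexed by natural numbers. -/
inductive OTerm : Type
  | var (n : ℕ)
  | con (c : CTerm)
  | app (t r : OTerm)

infixl:70 " ⬝ " => OTerm.app

namespace OTerm

/-- Bracket abstraction. -/
def lam (n : ℕ) : OTerm → OTerm
  | var m => if m = n then con (.app (.app .s .k) .k) else con .k ⬝ var m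
  | con c => con c.thunk
  | app t r => con .s ⬝ lam n t ⬝ lam n r

/-- The constant function with value `t`. -/
def thunk : OTerm → OTerm
  | var m => con .k ⬝ var m
  | con c => con c.thunk
  | app t r => con .s ⬝ thunk t ⬝ thunk r

/-- The closed term obtained by substituting `k` for all variables. -/
def close : OTerm → CTerm
  | var _ => .k
  | con c => c
  | app t r => .app t.close r.close

/-- First projection. -/
def tfst (t : OTerm) : OTerm := con .p0 ⬝ t

/-- Second projection. -/
def tsnd (t : OTerm) : OTerm := con .p1 ⬝ t

/-- A pair whose components are only evaluated when projected. -/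
def lpair (t r : OTerm) : OTerm :=
  con .s ⬝ (con .s ⬝ (con .s ⬝ con (.app (.app .s .k) .k) ⬝ (con .k ⬝ thunk t)) ⬝ (con .k ⬝ thunk r))
    ⬝ con (.app .k .k)

/-- Definition by cases on the equality of two numerals. -/
def ite (a b t r : OTerm) : OTerm := con .d ⬝ a ⬝ b ⬝ thunk t ⬝ thunk r ⬝ con .k

/-- The fixed point combinator. -/
def fixComb : OTerm :=
  lam 0 (lam 1 (lam 2 (var 0 ⬝ (var 1 ⬝ var 1) ⬝ var 2)) ⬝
    lam 1 (lam 2 (var 0 ⬝ (var 1 ⬝ var 1) ⬝ var 2)))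

/-- The function `f` with `f n = t`, where `f` and `n` may occur in `t`. -/
def fixp (f n : ℕ) (t : OTerm) : OTerm := fixComb ⬝ lam f (lam n t)

end OTerm

/-- Updating an environment. -/
def upd {P : Type u} (ρ : ℕ → P) (n : ℕ) (a : P) (m : ℕ) : P := if m = n then a else ρ m

section Eval

variable {P : Type u} [PCA P]

/-- The partial value of a term in an environment. -/
def OTerm.eval (ρ : ℕ → P) : OTerm → Part P
  | .var n => Part.some (ρ n)
  | .con c => c.eval P
  | .app t r => t.eval ρ ⋄ r.eval ρ

theorem CTerm.exists_thunk (t : CTerm) :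
    ∃ a : P, t.thunk.eval P = Part.some a ∧ ∀ b : P, Part.some a ⋄ Part.some b = t.eval P := by
  induction t with
  | app t r ht hr => exact exists_s_rep ht hr
  | _ => exact exists_k_rep _

namespace OTerm

variable (ρ : ℕ → P)

/-- An abstraction converges even if its body does not: `s a b` is always defined, and closed
constants are abstracted by `CTerm.thunk` rather than by `k`, since a closed term may diverge. -/
theorem exists_lam (n : ℕ) (t : OTerm) : ∃ a : P, (lam n t).eval ρ = Part.some a ∧
    ∀ b : P, Part.some a ⋄ Part.some b = t.eval (upd ρ n b) := by
  induction t with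
  | var m =>
    by_cases h : m = n
    · simpa [lam, eval, CTerm.eval, upd, h, pap] using exists_skk
    · simpa [lam, eval, CTerm.eval, upd, h] using exists_k_rep (ρ m)
  | con c => exact c.exists_thunk
  | app t r ht hr => exact exists_s_rep ht hr

theorem exists_thunk (t : OTerm) : ∃ a : P, (thunk t).eval ρ = Part.some a ∧
    ∀ b : P, Part.some a ⋄ Part.some b = t.eval ρ := by
  induction t with
  | var m => exact exists_k_rep (ρ m)
  | con c => exact c.exists_thunk
  | app t r ht hr => exact exists_s_rep ht hr

/-- The value of an abstraction. -/
noncomputable def clo (n : ℕ) (t : OTerm) : P := (exists_lam ρ n t).choose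

theorem eval_lam (n : ℕ) (t : OTerm) : (lam n t).eval ρ = Part.some (clo ρ n t) :=
  (exists_lam ρ n t).choose_spec.1

theorem clo_pap (n : ℕ) (t : OTerm) (b : P) :
    Part.some (clo ρ n t) ⋄ Part.some b = t.eval (upd ρ n b) :=
  (exists_lam ρ n t).choose_spec.2 b

theorem eval_var (n : ℕ) : (var n).eval ρ = Part.some (ρ n) := rfl

theorem eval_con (c : CTerm) : (con c).eval ρ = c.eval P := rfl

theorem eval_app (t r : OTerm) : (t ⬝ r).eval ρ = t.eval ρ ⋄ r.eval ρ := rfl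

theorem eval_fst (t : OTerm) : (tfst t).eval ρ = pfst (t.eval ρ) := rfl

theorem eval_snd (t : OTerm) : (tsnd t).eval ρ = psnd (t.eval ρ) := rfl

theorem eval_close (t : OTerm) : t.close.eval P = t.eval fun _ => PCA.k := by
  induction t with
  | app t r ht hr => simp only [close, eval, ← ht, ← hr]; rfl
  | _ => rfl

/-- The value behaves as `λx. x a b k` with `a`, `b` thunks of the components: a projection selects
a thunk and the final `k` forces it. Hence the pair is defined unconditionally, and one component
can be used while the other diverges. -/
theorem exists_lpair (t r : OTerm) : ∃ a : P, (lpair t r).eval ρ = Part.some a ∧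
    pfst (Part.some a) = t.eval ρ ∧ psnd (Part.some a) = r.eval ρ := by
  obtain ⟨a, ha, ha'⟩ := exists_thunk ρ t
  obtain ⟨b, hb, hb'⟩ := exists_thunk ρ r
  obtain ⟨i, hi, hi'⟩ := exists_skk (P := P)
  obtain ⟨k', hk, hk'⟩ := exists_k_rep i
  obtain ⟨c, hc, hc'⟩ := exists_s_rep (exists_s_rep (exists_s_rep ⟨i, rfl, hi'⟩
    (exists_k_rep a)) (exists_k_rep b)) (exists_k_rep PCA.k)
  refine ⟨c, ?_, ?_, ?_⟩
  · rw [← hc, ← ha, ← hb, ← hi]; rfl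
  · rw [pfst_eq, hc', pap_k, ha']
  · rw [psnd_eq, hi, hk, hc', hk', hi', hb']

/-- The value of a pair. -/
noncomputable def pairVal (t r : OTerm) : P := (exists_lpair ρ t r).choose

theorem eval_lpair (t r : OTerm) : (lpair t r).eval ρ = Part.some (pairVal ρ t r) :=
  (exists_lpair ρ t r).choose_spec.1

theorem pfst_pairVal (t r : OTerm) : pfst (Part.some (pairVal ρ t r)) = t.eval ρ :=
  (exists_lpair ρ t r).choose_spec.2.1

theorem psnd_pairVal (t r : OTerm) : psnd (Part.some (pairVal ρ t r)) = r.eval ρ :=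
  (exists_lpair ρ t r).choose_spec.2.2

/-- `d` picks one of two thunks and `k` forces it, so the branch not taken need not be defined. -/
theorem eval_ite {a b : OTerm} {n m : ℕ} (t r : OTerm) (ha : a.eval ρ = Part.some (num n))
    (hb : b.eval ρ = Part.some (num m)) :
    (ite a b t r).eval ρ = if n = m then t.eval ρ else r.eval ρ := by
  obtain ⟨x, hx, hx'⟩ := exists_thunk ρ t
  obtain ⟨y, hy, hy'⟩ := exists_thunk ρ r
  simp only [ite, eval_app, ha, hb, hx, hy, eval_con, CTerm.eval, pap_d]
  split
  · exact hx' _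
  · exact hy' _

theorem eval_ite_zero {a : OTerm} (t r : OTerm) (ha : a.eval ρ = Part.some (num 0)) :
    (ite a (con .zero) t r).eval ρ = t.eval ρ := eval_ite ρ (m := 0) t r ha rfl

theorem eval_ite_one {a : OTerm} (t r : OTerm) (ha : a.eval ρ = Part.some (num 1)) :
    (ite a (con .zero) t r).eval ρ = r.eval ρ := eval_ite ρ (m := 0) t r ha rfl

theorem eval_ite_succ {a : OTerm} {n : ℕ} (t r : OTerm) (ha : a.eval ρ = Part.some (num (n + 1))) :
    (ite a (con .zero) t r).eval ρ = r.eval ρ := eval_ite ρ (m := 0) t r ha rfl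

theorem eval_succ_pap (n : ℕ) : CTerm.succ.eval P ⋄ Part.some (num n) = Part.some (num (n + 1)) :=
  (some_pap_some _ _).trans (PCA.succ_spec n)

theorem eval_pred_pap (n : ℕ) : CTerm.pred.eval P ⋄ Part.some (num (n + 1)) = Part.some (num n) :=
  (some_pap_some _ _).trans (PCA.pred_spec n)

theorem eval_zero : CTerm.zero.eval P = Part.some (num 0) := rfl

theorem eval_one : CTerm.one.eval P = Part.some (num 1) := rfl

theorem exists_fixp (f n : ℕ) (t : OTerm) : ∃ a : P, (fixp f n t).eval ρ = Part.some a ∧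
    ∀ b : P, Part.some a ⋄ Part.some b = t.eval (upd (upd ρ f a) n b) := by
  let F := clo ρ f (lam n t)
  let b := var 0 ⬝ (var 1 ⬝ var 1) ⬝ var 2
  let w := clo (upd ρ 0 F) 1 (lam 2 b)
  -- Self-application of `w` stops at an abstraction because of the extra `lam 2`; this abstraction
  -- is the fixed point, defined before it receives an argument.
  have hw : Part.some w ⋄ Part.some w = Part.some (clo (upd (upd ρ 0 F) 1 w) 2 b) := by
    rw [clo_pap, eval_lam]
  refine ⟨clo (upd (upd ρ 0 F) 1 w) 2 b, ?_, fun c => ?_⟩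
  · simp only [fixp, fixComb, eval_app, eval_lam, clo_pap]
    rfl
  · have h : (b.eval (upd (upd (upd ρ 0 F) 1 w) 2 c)) =
      Part.some F ⋄ (Part.some w ⋄ Part.some w) ⋄ Part.some c := rfl
    rw [clo_pap, h, hw, clo_pap, eval_lam, clo_pap]

end OTerm

end Eval

end ExtRealizability

namespace ExtRealizability

attribute [simp] OTerm.eval_close OTerm.eval_lam OTerm.clo_pap OTerm.eval_app OTerm.eval_var
attribute [simp] OTerm.eval_con OTerm.eval_fst OTerm.eval_snd OTerm.eval_lpair OTerm.pfst_pairVal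
attribute [simp] OTerm.psnd_pairVal

/-! ## Realizability over the product pca -/

section Tr

variable {A : Type u}

/-- The triple `⟨p.1, p.2, z⟩` belongs to the name `x`. -/
def VExt.El (x : VExt A) (p : A × A) (z : VExt A) : Prop :=
  ∃ i : x.Idx, (x.left i, x.right i) = p ∧ x.elt i = z

open VExt (El)

theorem VExt.El.isElt {x z : VExt A} {p : A × A} (h : El x p z) : VExt.IsElt z x :=
  let ⟨i, _, hi⟩ := h
  ⟨i, hi⟩

theorem VExt.el_idx (x : VExt A) (i : x.Idx) : El x (x.left i, x.right i) (x.elt i) :=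
  ⟨i, rfl, rfl⟩

theorem both_iff (R : A → A → Prop) (s t : Part A) : Both R s t ↔ ∃ v ∈ pprod s t, R v.1 v.2 := by
  constructor
  · rintro ⟨a, ha, b, hb, h⟩
    exact ⟨(a, b), mem_pprod.2 ⟨ha, hb⟩, h⟩
  · rintro ⟨v, hv, h⟩
    exact ⟨_, (mem_pprod.1 hv).1, _, (mem_pprod.1 hv).2, h⟩

theorem pprod_eq_some {s t : Part A} {p : A × A} :
    pprod s t = Part.some p ↔ p.1 ∈ s ∧ p.2 ∈ t := by
  rw [Part.eq_some_iff, mem_pprod]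

variable [PCA A]

/-- The partial element `s` of `A × A` is defined and realizes `φ`. -/
def Tr (s : Part (A × A)) (φ : Fml (VExt A)) : Prop := ∃ v ∈ s, Realizes φ v.1 v.2

variable {s t : Part (A × A)} {φ ψ : Fml (VExt A)} {x y z : VExt A}

theorem Tr.dom (h : Tr s φ) : s.Dom :=
  let ⟨_, hv, _⟩ := h
  Part.dom_iff_mem.2 ⟨_, hv⟩

theorem Tr.exists_some (h : Tr s φ) : ∃ v, s = Part.some v := exists_some_of_dom h.dom

theorem tr_some {v : A × A} : Tr (Part.some v) φ ↔ Realizes φ v.1 v.2 := by simp [Tr]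

theorem both_realizes {s t : Part A} : Both (Realizes φ) s t ↔ Tr (pprod s t) φ := both_iff _ _ _

theorem pap_prod (a b : A × A) :
    Part.some a ⋄ Part.some b = pprod (ap a.1 b.1) (ap a.2 b.2) := some_pap_some _ _

theorem pfst_prod (a : A × A) : pfst (Part.some a) = pprod (fst a.1) (fst a.2) := some_pap_some _ _

theorem psnd_prod (a : A × A) : psnd (Part.some a) = pprod (snd a.1) (snd a.2) := some_pap_some _ _

theorem pprod_bind_fst (s t : Part A) : pprod (s.bind fst) (t.bind fst) = pfst (pprod s t) := by
  rw [← pprod_bind, pfst, pap, Part.bind_some]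
  rfl

theorem pprod_bind_snd (s t : Part A) : pprod (s.bind snd) (t.bind snd) = psnd (pprod s t) := by
  rw [← pprod_bind, psnd, pap, Part.bind_some]
  rfl

theorem dom_of_eq_some {α : Type*} {s : Part α} {a : α} (h : s = Part.some a) : s.Dom := by
  rw [h]; trivial

/-- Here and in the following lemmas the clauses become those of unary realizability for a partial
element. Application is strict, so a defined projection makes `s` defined; for negation, implication
and bounded universal quantification definedness has to be asked for separately. -/
theorem tr_and : Tr s (φ.and ψ) ↔ Tr (pfst s) φ ∧ Tr (psnd s) ψ := by
  by_cases h : s.Dom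
  · obtain ⟨v, rfl⟩ := exists_some_of_dom h
    rw [tr_some, Realizes, both_realizes, both_realizes, pfst_prod, psnd_prod]
  · exact ⟨fun h' => absurd h'.dom h, fun h' => absurd (dom_of_pfst h'.1.dom) h⟩

theorem tr_or : Tr s (φ.or ψ) ↔ (pfst s = Part.some (num 0) ∧ Tr (psnd s) φ) ∨
    (pfst s = Part.some (num 1) ∧ Tr (psnd s) ψ) := by
  by_cases h : s.Dom
  · obtain ⟨v, rfl⟩ := exists_some_of_dom h
    rw [tr_some, Realizes, both_realizes, both_realizes, pfst_prod, psnd_prod, pprod_eq_some,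
      pprod_eq_some, and_assoc, and_assoc]
    rfl
  · refine ⟨fun h' => absurd h'.dom h, ?_⟩
    rintro (h' | h') <;> exact absurd (dom_of_pfst (dom_of_eq_some h'.1)) h

theorem tr_neg : Tr s φ.neg ↔ s.Dom ∧ ∀ v, ¬ Tr (Part.some v) φ := by
  constructor
  · rintro h
    obtain ⟨v, rfl⟩ := h.exists_some
    exact ⟨trivial, fun w hw => tr_some.1 h _ _ (tr_some.1 hw)⟩
  · rintro ⟨h, h'⟩
    obtain ⟨v, rfl⟩ := exists_some_of_dom h
    exact tr_some.2 fun c d hcd => h' (c, d) (tr_some.2 hcd)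

theorem tr_imp : Tr s (φ.imp ψ) ↔
    s.Dom ∧ ∀ v, Tr (Part.some v) φ → Tr (s ⋄ Part.some v) ψ := by
  constructor
  · rintro h
    obtain ⟨v, rfl⟩ := h.exists_some
    refine ⟨trivial, fun w hw => ?_⟩
    rw [pap_prod]
    exact both_realizes.1 (tr_some.1 h _ _ (tr_some.1 hw))
  · rintro ⟨h, h'⟩
    obtain ⟨v, rfl⟩ := exists_some_of_dom h
    refine tr_some.2 fun c d hcd => ?_
    have := h' (c, d) (tr_some.2 hcd)
    rw [pap_prod] at this
    exact both_realizes.2 this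

theorem Tr.imp (h : Tr s (φ.imp ψ)) (ht : Tr t φ) : Tr (s ⋄ t) ψ := by
  obtain ⟨v, rfl⟩ := ht.exists_some
  exact (tr_imp.1 h).2 v ht

theorem tr_iff : Tr s (φ.iff ψ) ↔ Tr (pfst s) (φ.imp ψ) ∧ Tr (psnd s) (ψ.imp φ) := tr_and

theorem tr_allB {φ : VExt A → Fml (VExt A)} : Tr s (.allB y φ) ↔
    s.Dom ∧ ∀ p z, El y p z → Tr (s ⋄ Part.some p) (φ z) := by
  constructor
  · rintro h
    obtain ⟨v, rfl⟩ := h.exists_some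
    refine ⟨trivial, ?_⟩
    rintro p z ⟨i, rfl, rfl⟩
    rw [pap_prod]
    exact both_realizes.1 (tr_some.1 h i)
  · rintro ⟨h, h'⟩
    obtain ⟨v, rfl⟩ := exists_some_of_dom h
    refine tr_some.2 fun i => ?_
    have := h' _ _ (y.el_idx i)
    rw [pap_prod] at this
    exact both_realizes.2 this

theorem tr_exB {φ : VExt A → Fml (VExt A)} : Tr s (.exB y φ) ↔
    ∃ p z, El y p z ∧ pfst s = Part.some p ∧ Tr (psnd s) (φ z) := by
  constructor
  · rintro h
    obtain ⟨v, rfl⟩ := h.exists_some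
    obtain ⟨i, hl, hr, h⟩ := tr_some.1 h
    refine ⟨_, _, y.el_idx i, ?_, ?_⟩
    · rw [pfst_prod, pprod_eq_some]
      exact ⟨hl, hr⟩
    · rw [psnd_prod]
      exact both_realizes.1 h
  · rintro ⟨p, z, ⟨i, rfl, rfl⟩, h, h'⟩
    obtain ⟨v, rfl⟩ := exists_some_of_dom (dom_of_pfst (dom_of_eq_some h))
    rw [pfst_prod, pprod_eq_some] at h
    rw [psnd_prod] at h'
    exact tr_some.2 ⟨i, h.1, h.2, both_realizes.2 h'⟩

theorem tr_all {φ : VExt A → Fml (VExt A)} : Tr s (.all φ) ↔ ∀ x, Tr s (φ x) := by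
  constructor
  · rintro h x
    obtain ⟨v, rfl⟩ := h.exists_some
    exact tr_some.2 (tr_some.1 h x)
  · intro h
    -- Some instance is needed to know that `s` is defined; any name will do.
    obtain ⟨v, rfl⟩ := (h VExt.empty).exists_some
    exact tr_some.2 fun x => tr_some.1 (h x)

theorem tr_ex {φ : VExt A → Fml (VExt A)} : Tr s (.ex φ) ↔ ∃ x, Tr s (φ x) := by
  constructor
  · rintro ⟨v, hv, x, hx⟩
    exact ⟨x, v, hv, hx⟩
  · rintro ⟨x, v, hv, hx⟩
    exact ⟨v, hv, x, hx⟩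

theorem tr_mem : Tr s (.mem x y) ↔
    ∃ p z, El y p z ∧ pfst s = Part.some p ∧ Tr (psnd s) (.eq x z) :=
  tr_exB (φ := fun z => Fml.eq x z)

theorem tr_eq : Tr s (.eq x y) ↔ s.Dom ∧
    (∀ p z, El x p z → Tr (pfst (s ⋄ Part.some p)) (.mem z y)) ∧
    (∀ p z, El y p z → Tr (psnd (s ⋄ Part.some p)) (.mem z x)) := by
  constructor
  · rintro h
    obtain ⟨v, rfl⟩ := h.exists_some
    have h := tr_some.1 h
    rw [Realizes, VExt.EqR] at h
    refine ⟨trivial, ?_, ?_⟩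
    · rintro p z ⟨i, rfl, rfl⟩
      rw [pap_prod, ← pprod_bind_fst]
      exact (both_iff _ _ _).1 (h.1 i)
    · rintro p z ⟨i, rfl, rfl⟩
      rw [pap_prod, ← pprod_bind_snd]
      exact (both_iff _ _ _).1 (h.2 i)
  · rintro ⟨h, h1, h2⟩
    obtain ⟨v, rfl⟩ := exists_some_of_dom h
    rw [tr_some, Realizes, VExt.EqR]
    refine ⟨fun i => ?_, fun i => ?_⟩
    · have := h1 _ _ (x.el_idx i)
      rw [pap_prod, ← pprod_bind_fst] at this
      exact (both_iff _ _ _).2 this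
    · have := h2 _ _ (y.el_idx i)
      rw [pap_prod, ← pprod_bind_snd] at this
      exact (both_iff _ _ _).2 this

/-- The value in `A × A` is diagonal by `CTerm.eval_prod`, so its two components are one and the
same realizer. -/
theorem forces_of_tr {c : CTerm} (h : Tr (c.eval (A × A)) φ) : c.Forces φ := by
  obtain ⟨v, hv, h⟩ := h
  rw [CTerm.eval_prod, mem_pprod] at hv
  have := Part.mem_unique hv.1 hv.2
  exact ⟨v.1, hv.1, by rw [← this] at h; exact h⟩

end Tr

/-! ## Equality and membership -/

section Equality

open OTerm VExt

variable {A : Type u} [PCA A] {s t : Part (A × A)} {x y z : VExt A}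

theorem Tr.eq_left {p : A × A} {w : VExt A} (h : Tr s (.eq x y)) (hw : El x p w) :
    Tr (pfst (s ⋄ Part.some p)) (.mem w y) := (tr_eq.1 h).2.1 p w hw

theorem Tr.eq_right {p : A × A} {w : VExt A} (h : Tr s (.eq x y)) (hw : El y p w) :
    Tr (psnd (s ⋄ Part.some p)) (.mem w x) := (tr_eq.1 h).2.2 p w hw

/-- Realizer of reflexivity. -/
def reflC : CTerm :=
  (fixp 0 1 (lpair (lpair (var 1) (var 0)) (lpair (var 1) (var 0)))).close

/-- The fixed point `e` satisfies `e p = ((p, e), (p, e))`: the element with index `p` is found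
again under the index `p`, and equality with itself is realized by `e` inductively. -/
theorem tr_refl (x : VExt A) : Tr (reflC.eval (A × A)) (.eq x x) := by
  obtain ⟨e, he, hrec⟩ := exists_fixp (P := A × A) (fun _ => PCA.k) 0 1
    (lpair (lpair (var 1) (var 0)) (lpair (var 1) (var 0)))
  rw [reflC, eval_close, he]
  induction x using isElt_wf.induction with
  | _ x ih =>
    rw [tr_eq]
    refine ⟨trivial, fun p z hz => ?_, fun p z hz => ?_⟩ <;>
    · simp only [hrec, eval_lpair, pfst_pairVal, psnd_pairVal]
      exact tr_mem.2 ⟨p, z, hz, by simp [upd], by simpa [upd] using ih z hz.isElt⟩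

/-- Realizer of symmetry. -/
def symmC : CTerm :=
  (lam 0 (lam 1 (lpair (tsnd (var 0 ⬝ var 1)) (tfst (var 0 ⬝ var 1))))).close

/-- No recursion is needed: the two halves of a realizer of equality are mirror images, so
exchanging them suffices. -/
theorem Tr.symm (h : Tr s (.eq x y)) : Tr (symmC.eval _ ⋄ s) (.eq y x) := by
  obtain ⟨v, rfl⟩ := h.exists_some
  simp only [symmC, eval_close, eval_lam, clo_pap]
  rw [tr_eq]
  refine ⟨trivial, fun p z hz => ?_, fun p z hz => ?_⟩
  · simpa [upd] using h.eq_right hz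
  · simpa [upd] using h.eq_left hz

/-- The step of the recursion for transitivity. -/
def transStep : OTerm :=
  let m := tfst (tfst (var 1) ⬝ var 2)
  let n := tfst (tsnd (var 1) ⬝ tfst m)
  let m' := tsnd (tsnd (var 1) ⬝ var 2)
  let n' := tsnd (tfst (var 1) ⬝ tfst m')
  lam 2 (lpair (lpair (tfst n) (var 0 ⬝ lpair (tsnd m) (tsnd n)))
    (lpair (tfst n') (var 0 ⬝ lpair (tsnd m') (tsnd n'))))

/-- Realizer of transitivity. -/
def transC : CTerm :=
  (lam 3 (lam 4 (fixp 0 1 transStep ⬝ lpair (var 3) (var 4)))).close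

/-- Induction on the middle name: an element of `x` is matched with one of `y` and then with one of
`z`, and the two matching equalities are composed by a recursive call at that element of `y`. -/
theorem Tr.trans (h : Tr s (.eq x y)) (h' : Tr t (.eq y z)) :
    Tr (transC.eval _ ⋄ s ⋄ t) (.eq x z) := by
  obtain ⟨a, rfl⟩ := h.exists_some
  obtain ⟨b, rfl⟩ := h'.exists_some
  obtain ⟨e, he, hrec⟩ := exists_fixp (P := A × A) (upd (upd (fun _ => PCA.k) 3 a) 4 b) 0 1 transStep
  simp only [transC, eval_close, eval_lam, clo_pap, eval_app, he, eval_lpair]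
  -- The two realizers travel as a single argument `v`, which has to vary along the induction.
  generalize hv : pairVal (P := A × A) _ _ _ = v
  rw [← show pfst (Part.some v) = Part.some a by simp [← hv, upd]] at h
  rw [← show psnd (Part.some v) = Part.some b by simp [← hv, upd]] at h'
  clear hv he
  induction y using isElt_wf.induction generalizing x z v with
  | _ y ih =>
    rw [hrec, transStep, eval_lam, tr_eq]
    refine ⟨trivial, fun p w hw => ?_, fun p w hw => ?_⟩
    · obtain ⟨q, w', hw', hq, h1⟩ := tr_mem.1 (h.eq_left hw)
      obtain ⟨r, w'', hw'', hr, h2⟩ := tr_mem.1 (h'.eq_left hw')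
      refine tr_mem.2 ⟨r, w'', hw'', ?_, ?_⟩
      · simp [upd, hq, hr]
      · simp only [clo_pap, eval_lpair, pfst_pairVal, psnd_pairVal, eval_app, eval_var]
        apply ih w' hw'.isElt <;> simpa [upd, hq]
    · obtain ⟨q, w', hw', hq, h1⟩ := tr_mem.1 (h'.eq_right hw)
      obtain ⟨r, w'', hw'', hr, h2⟩ := tr_mem.1 (h.eq_right hw')
      refine tr_mem.2 ⟨r, w'', hw'', ?_, ?_⟩
      · simp [upd, hq, hr]
      · simp only [clo_pap, eval_lpair, psnd_pairVal, eval_app, eval_var]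
        apply ih w' hw'.isElt <;> simpa [upd, hq]

end Equality

end ExtRealizability

namespace ExtRealizability

attribute [simp] OTerm.eval_zero OTerm.eval_one

/-! ### Substitution in membership, and internal unordered and ordered pairs -/

section Pairing

open OTerm VExt

variable {A : Type u} [PCA A] {s t : Part (A × A)} {x y z x' y' w : VExt A} {p : A × A}

/-- Realizer of substitution on the left of a membership. -/
def memLeftC : CTerm :=
  (lam 0 (lam 1 (lpair (tfst (var 1)) (con transC ⬝ var 0 ⬝ tsnd (var 1))))).close

theorem Tr.mem_left (h : Tr s (.eq x y)) (h' : Tr t (.mem y z)) :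
    Tr (memLeftC.eval _ ⋄ s ⋄ t) (.mem x z) := by
  obtain ⟨a, rfl⟩ := h.exists_some
  obtain ⟨b, rfl⟩ := h'.exists_some
  obtain ⟨p, w, hw, hp, h'⟩ := tr_mem.1 h'
  exact tr_mem.2 ⟨p, w, hw, by simp [memLeftC, upd, hp], by simpa [memLeftC, upd] using h.trans h'⟩

/-- Realizer of substitution on the right of a membership. -/
def memRightC : CTerm :=
  let m := tfst (var 1 ⬝ tfst (var 0))
  (lam 0 (lam 1 (lpair (tfst m) (con transC ⬝ tsnd (var 0) ⬝ tsnd m)))).close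

theorem Tr.mem_right (h : Tr s (.mem x y)) (h' : Tr t (.eq y z)) :
    Tr (memRightC.eval _ ⋄ s ⋄ t) (.mem x z) := by
  obtain ⟨a, rfl⟩ := h.exists_some
  obtain ⟨b, rfl⟩ := h'.exists_some
  obtain ⟨p, w, hw, hp, h⟩ := tr_mem.1 h
  obtain ⟨q, w', hw', hq, h'⟩ := tr_mem.1 (h'.eq_left hw)
  exact tr_mem.2 ⟨q, w', hw', by simp [memRightC, upd, hp, hq],
    by simpa [memRightC, upd, hp] using h.trans h'⟩

theorem VExt.el_single : El (single x) p w ↔ p = num 0 ∧ w = x := by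
  constructor
  · rintro ⟨i, h, h'⟩
    exact ⟨h.symm, h'.symm⟩
  · rintro ⟨rfl, rfl⟩
    exact ⟨⟨⟩, rfl, rfl⟩

theorem VExt.el_upair : El (upair x y) p w ↔ (p = num 0 ∧ w = x) ∨ (p = num 1 ∧ w = y) := by
  constructor
  · rintro ⟨⟨_ | _⟩, h, h'⟩
    · exact .inl ⟨h.symm, h'.symm⟩
    · exact .inr ⟨h.symm, h'.symm⟩
  · rintro (⟨rfl, rfl⟩ | ⟨rfl, rfl⟩)
    · exact ⟨⟨false⟩, rfl, rfl⟩
    · exact ⟨⟨true⟩, rfl, rfl⟩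

theorem VExt.el_single_zero : El (single x) (num 0) x := el_single.2 ⟨rfl, rfl⟩

theorem VExt.el_upair_zero : El (upair x y) (num 0) x := el_upair.2 (.inl ⟨rfl, rfl⟩)

theorem VExt.el_upair_one : El (upair x y) (num 1) y := el_upair.2 (.inr ⟨rfl, rfl⟩)

theorem tr_mem_single : Tr s (.mem w (single x)) ↔
    pfst s = Part.some (num 0) ∧ Tr (psnd s) (.eq w x) := by
  rw [tr_mem]
  simp only [el_single]
  constructor
  · rintro ⟨_, _, ⟨rfl, rfl⟩, h, h'⟩
    exact ⟨h, h'⟩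
  · rintro ⟨h, h'⟩
    exact ⟨_, _, ⟨rfl, rfl⟩, h, h'⟩

theorem tr_mem_upair : Tr s (.mem w (upair x y)) ↔
    (pfst s = Part.some (num 0) ∧ Tr (psnd s) (.eq w x)) ∨
      (pfst s = Part.some (num 1) ∧ Tr (psnd s) (.eq w y)) := by
  rw [tr_mem]
  simp only [el_upair]
  constructor
  · rintro ⟨_, _, ⟨rfl, rfl⟩ | ⟨rfl, rfl⟩, h, h'⟩
    · exact .inl ⟨h, h'⟩
    · exact .inr ⟨h, h'⟩
  · rintro (⟨h, h'⟩ | ⟨h, h'⟩)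
    · exact ⟨_, _, .inl ⟨rfl, rfl⟩, h, h'⟩
    · exact ⟨_, _, .inr ⟨rfl, rfl⟩, h, h'⟩

/-- Realizer of the congruence of singletons. -/
def singleCongrC : CTerm :=
  (lam 0 (lam 1 (lpair (lpair (con .zero) (var 0))
    (lpair (con .zero) (con symmC ⬝ var 0))))).close

theorem Tr.single_congr (h : Tr s (.eq x y)) :
    Tr (singleCongrC.eval _ ⋄ s) (.eq (single x) (single y)) := by
  obtain ⟨a, rfl⟩ := h.exists_some
  simp only [singleCongrC, eval_close, eval_lam, clo_pap]
  rw [tr_eq]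
  refine ⟨trivial, fun p w hw => ?_, fun p w hw => ?_⟩ <;>
    obtain ⟨rfl, rfl⟩ := el_single.1 hw
  · exact tr_mem_single.2 (by simpa [upd] using h)
  · exact tr_mem_single.2 (by simpa [upd] using h.symm)

/-- Realizer of the congruence of unordered pairs. -/
def upairCongrC : CTerm :=
  (lam 0 (lam 1 (lam 2 (lpair (lpair (var 2) (ite (var 2) (con .zero) (var 0) (var 1)))
    (lpair (var 2) (ite (var 2) (con .zero) (con symmC ⬝ var 0) (con symmC ⬝ var 1))))))).close

theorem Tr.upair_congr (h : Tr s (.eq x x')) (h' : Tr t (.eq y y')) :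
    Tr (upairCongrC.eval _ ⋄ s ⋄ t) (.eq (upair x y) (upair x' y')) := by
  obtain ⟨a, rfl⟩ := h.exists_some
  obtain ⟨b, rfl⟩ := h'.exists_some
  simp only [upairCongrC, eval_close, eval_lam, clo_pap]
  rw [tr_eq]
  refine ⟨trivial, fun p w hw => ?_, fun p w hw => ?_⟩ <;> rw [tr_mem_upair] <;>
    obtain ⟨rfl, rfl⟩ | ⟨rfl, rfl⟩ := el_upair.1 hw
  · exact .inl ⟨by simp [upd], by simpa [upd, eval_ite_zero] using h⟩
  · exact .inr ⟨by simp [upd], by simpa [upd, eval_ite_one] using h'⟩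
  · exact .inl ⟨by simp [upd], by simpa [upd, eval_ite_zero] using h.symm⟩
  · exact .inr ⟨by simp [upd], by simpa [upd, eval_ite_one] using h'.symm⟩

/-- Realizer of the congruence of ordered pairs. -/
def opairCongrC : CTerm :=
  (lam 0 (lam 1 (con upairCongrC ⬝ (con singleCongrC ⬝ var 0) ⬝
    (con upairCongrC ⬝ var 0 ⬝ var 1)))).close

theorem Tr.opair_congr (h : Tr s (.eq x x')) (h' : Tr t (.eq y y')) :
    Tr (opairCongrC.eval _ ⋄ s ⋄ t) (.eq (opair x y) (opair x' y')) := by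
  obtain ⟨a, rfl⟩ := h.exists_some
  obtain ⟨b, rfl⟩ := h'.exists_some
  simpa [opair, opairCongrC, upd] using h.single_congr.upair_congr (h.upair_congr h')

/-- Realizer of the injectivity of ordered pairs in the first component. -/
def opairInjLeftC : CTerm :=
  (lam 0 (con symmC ⬝ tsnd (tsnd (tsnd (tfst (var 0 ⬝ con .zero)) ⬝ con .zero)))).close

/-- The element `{x}` equals `{x'}` or `{x', y'}`. Both list `x'` under the index `0`, so the same
realizer of `x' = x` works in the two cases and no test is needed. -/
theorem Tr.opair_inj_left (h : Tr s (.eq (opair x y) (opair x' y'))) :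
    Tr (opairInjLeftC.eval _ ⋄ s) (.eq x x') := by
  obtain ⟨a, rfl⟩ := h.exists_some
  have key : Tr (psnd (psnd (psnd (pfst (Part.some a ⋄ Part.some (num 0))) ⋄
      Part.some (num 0)))) (.eq x' x) := by
    obtain ⟨-, h⟩ | ⟨-, h⟩ := tr_mem_upair.1 (h.eq_left el_upair_zero)
    · exact (tr_mem_single.1 (h.eq_right el_single_zero)).2
    · exact (tr_mem_single.1 (h.eq_right el_upair_zero)).2
  simpa [opairInjLeftC, upd] using key.symm

/-- Whether `{x, y}` is matched with `{x'}` or with `{x', y'}`, the tag attached to `y` tells which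
of `x'`, `y'` it equals, since `x'` has tag `0` in both sets. -/
theorem Tr.mem_opair_elim (h : Tr s (.mem (upair x y) (opair x' y'))) :
    (pfst (pfst (psnd s ⋄ Part.some (num 1))) = Part.some (num 0) ∧
        Tr (psnd (pfst (psnd s ⋄ Part.some (num 1)))) (.eq y x')) ∨
      (pfst (pfst (psnd s ⋄ Part.some (num 1))) = Part.some (num 1) ∧
        Tr (psnd (pfst (psnd s ⋄ Part.some (num 1)))) (.eq y y')) := by
  obtain ⟨-, h⟩ | ⟨-, h⟩ := tr_mem_upair.1 h
  · exact .inl (tr_mem_single.1 (h.eq_left el_upair_one))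
  · exact tr_mem_upair.1 (h.eq_left el_upair_one)

/-- Realizer of the injectivity of ordered pairs in the second component. -/
def opairInjRightC : CTerm :=
  let l := tfst (tsnd (tfst (var 0 ⬝ con .one)) ⬝ con .one)
  let k := tfst (tsnd (tsnd (var 0 ⬝ con .one)) ⬝ con .one)
  (lam 0 (ite (tfst l) (con .zero)
    (ite (tfst k) (con .zero)
      (con transC ⬝ tsnd l ⬝ (con transC ⬝ (con symmC ⬝ (con opairInjLeftC ⬝ var 0)) ⬝
        (con symmC ⬝ tsnd k)))
      (con symmC ⬝ tsnd k))
    (tsnd l))).close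

/-- Either `y = y'` is found directly, or `y = x'`. In the latter case one looks at `y'` in the
other direction: it equals `y`, or it equals `x`, and then `y = x' = x = y'`. -/
theorem Tr.opair_inj_right (h : Tr s (.eq (opair x y) (opair x' y'))) :
    Tr (opairInjRightC.eval _ ⋄ s) (.eq y y') := by
  obtain ⟨a, rfl⟩ := h.exists_some
  obtain ⟨h0, h1⟩ | ⟨h0, h1⟩ := (h.eq_left el_upair_one).mem_opair_elim
  · obtain ⟨h2, h3⟩ | ⟨h2, h3⟩ := (h.eq_right el_upair_one).mem_opair_elim
    · simpa [opairInjRightC, upd, eval_ite_zero, h0, h2] using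
        h1.trans (h.opair_inj_left.symm.trans h3.symm)
    · simpa [opairInjRightC, upd, eval_ite_zero, eval_ite_one, h0, h2] using h3.symm
  · simpa [opairInjRightC, upd, eval_ite_one, h0] using h1

/-- Realizer of `u = {x} → isSingle u x`. -/
def isSingleC : CTerm :=
  (lam 0 (lpair (tsnd (var 0 ⬝ con .zero)) (lam 1 (tsnd (tfst (var 0 ⬝ var 1)))))).close

theorem Tr.isSingle (h : Tr s (.eq w (single x))) : Tr (isSingleC.eval _ ⋄ s) (.isSingle w x) := by
  obtain ⟨a, rfl⟩ := h.exists_some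
  rw [Fml.isSingle, tr_and, tr_allB]
  refine ⟨?_, ?_, fun p v hv => ?_⟩
  · simpa [isSingleC, upd] using h.eq_right el_single_zero
  · simp [isSingleC]
  · simpa [isSingleC, upd] using (tr_mem_single.1 (h.eq_left hv)).2

/-- Realizer of `isSingle u x → u = {x}`. -/
def ofIsSingleC : CTerm :=
  (lam 0 (lam 1 (lpair (lpair (con .zero) (tsnd (var 0) ⬝ var 1)) (tfst (var 0))))).close

theorem Tr.of_isSingle (h : Tr s (.isSingle w x)) :
    Tr (ofIsSingleC.eval _ ⋄ s) (.eq w (single x)) := by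
  obtain ⟨a, rfl⟩ := h.exists_some
  rw [Fml.isSingle, tr_and, tr_allB] at h
  rw [tr_eq]
  refine ⟨by simp [ofIsSingleC], fun p v hv => ?_, fun p v hv => ?_⟩
  · rw [tr_mem_single]
    simpa [ofIsSingleC, upd] using h.2.2 p v hv
  · obtain ⟨rfl, rfl⟩ := el_single.1 hv
    simpa [ofIsSingleC, upd] using h.1

/-- Realizer of `u = {x, y} → isUpair u x y`. -/
def isUpairC : CTerm :=
  (lam 0 (lpair (tsnd (var 0 ⬝ con .zero)) (lpair (tsnd (var 0 ⬝ con .one))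
    (lam 1 (tfst (var 0 ⬝ var 1)))))).close

theorem Tr.isUpair (h : Tr s (.eq w (upair x y))) :
    Tr (isUpairC.eval _ ⋄ s) (.isUpair w x y) := by
  obtain ⟨a, rfl⟩ := h.exists_some
  rw [Fml.isUpair, tr_and, tr_and, tr_allB]
  refine ⟨?_, ?_, ?_, fun p v hv => ?_⟩
  · simpa [isUpairC, upd] using h.eq_right el_upair_zero
  · simpa [isUpairC, upd] using h.eq_right el_upair_one
  · simp [isUpairC]
  · rw [tr_or]
    simpa [isUpairC, upd] using tr_mem_upair.1 (h.eq_left hv)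

/-- Realizer of `isUpair u x y → u = {x, y}`. -/
def ofIsUpairC : CTerm :=
  (lam 0 (lam 1 (lpair (tsnd (tsnd (var 0)) ⬝ var 1)
    (ite (var 1) (con .zero) (tfst (var 0)) (tfst (tsnd (var 0))))))).close

theorem Tr.of_isUpair (h : Tr s (.isUpair w x y)) :
    Tr (ofIsUpairC.eval _ ⋄ s) (.eq w (upair x y)) := by
  obtain ⟨a, rfl⟩ := h.exists_some
  rw [Fml.isUpair, tr_and, tr_and, tr_allB] at h
  rw [tr_eq]
  refine ⟨by simp [ofIsUpairC], fun p v hv => ?_, fun p v hv => ?_⟩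
  · have := h.2.2.2 p v hv
    rw [tr_or] at this
    rw [tr_mem_upair]
    simpa [ofIsUpairC, upd] using this
  · obtain ⟨rfl, rfl⟩ | ⟨rfl, rfl⟩ := el_upair.1 hv
    · simpa [ofIsUpairC, upd, eval_ite_zero] using h.1
    · simpa [ofIsUpairC, upd, eval_ite_one] using h.2.1

/-- Realizer of `z = ⟨x, y⟩_A → isPair z x y`. -/
def isPairC : CTerm :=
  let m := tsnd (var 0 ⬝ con .zero)
  let n := tsnd (var 0 ⬝ con .one)
  let l := tfst (var 0 ⬝ var 1)
  (lam 0 (lpair (lpair (tfst m) (con isSingleC ⬝ (con symmC ⬝ tsnd m)))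
    (lpair (lpair (tfst n) (con isUpairC ⬝ (con symmC ⬝ tsnd n)))
      (lam 1 (lpair (tfst l)
        (ite (tfst l) (con .zero) (con isSingleC ⬝ tsnd l) (con isUpairC ⬝ tsnd l))))))).close

/-- Together with `Tr.of_isPair` this replaces the formula `isPair` by an equation with `opair`, to
which congruence and injectivity of pairs apply. -/
theorem Tr.isPair (h : Tr s (.eq z (opair x y))) : Tr (isPairC.eval _ ⋄ s) (.isPair z x y) := by
  obtain ⟨a, rfl⟩ := h.exists_some
  rw [Fml.isPair, tr_and, tr_and, tr_allB, tr_exB, tr_exB]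
  refine ⟨?_, ?_, ?_, fun p v hv => ?_⟩
  · obtain ⟨q, u, hu, hq, h⟩ := tr_mem.1 (h.eq_right el_upair_zero)
    exact ⟨q, u, hu, by simp [isPairC, upd, hq], by simpa [isPairC, upd] using h.symm.isSingle⟩
  · obtain ⟨q, u, hu, hq, h⟩ := tr_mem.1 (h.eq_right el_upair_one)
    exact ⟨q, u, hu, by simp [isPairC, upd, hq], by simpa [isPairC, upd] using h.symm.isUpair⟩
  · simp [isPairC]
  · rw [tr_or]
    obtain ⟨h1, h2⟩ | ⟨h1, h2⟩ := tr_mem_upair.1 (h.eq_left hv)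
    · exact .inl ⟨by simp [isPairC, upd, h1],
        by simpa [isPairC, upd, eval_ite_zero, h1] using h2.isSingle⟩
    · exact .inr ⟨by simp [isPairC, upd, h1],
        by simpa [isPairC, upd, eval_ite_one, h1] using h2.isUpair⟩

/-- Realizer of `isPair z x y → z = ⟨x, y⟩_A`. -/
def ofIsPairC : CTerm :=
  let l := tsnd (tsnd (var 0)) ⬝ var 1
  let m := tfst (var 0)
  let n := tfst (tsnd (var 0))
  (lam 0 (lam 1 (lpair
    (lpair (tfst l) (ite (tfst l) (con .zero) (con ofIsSingleC ⬝ tsnd l) (con ofIsUpairC ⬝ tsnd l)))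
    (ite (var 1) (con .zero)
      (lpair (tfst m) (con symmC ⬝ (con ofIsSingleC ⬝ tsnd m)))
      (lpair (tfst n) (con symmC ⬝ (con ofIsUpairC ⬝ tsnd n))))))).close

theorem Tr.of_isPair (h : Tr s (.isPair z x y)) :
    Tr (ofIsPairC.eval _ ⋄ s) (.eq z (opair x y)) := by
  obtain ⟨a, rfl⟩ := h.exists_some
  rw [Fml.isPair, tr_and, tr_and, tr_allB, tr_exB, tr_exB] at h
  obtain ⟨⟨q, u, hu, hq, hqu⟩, ⟨r, v, hv, hr, hrv⟩, -, h⟩ := h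
  rw [tr_eq]
  refine ⟨by simp [ofIsPairC], fun p c hc => ?_, fun p c hc => ?_⟩
  · have := h p c hc
    rw [tr_or] at this
    refine tr_mem_upair.2 ?_
    obtain ⟨h1, h2⟩ | ⟨h1, h2⟩ := this
    · exact .inl ⟨by simp [ofIsPairC, upd, h1],
        by simpa [ofIsPairC, upd, eval_ite_zero, h1] using h2.of_isSingle⟩
    · exact .inr ⟨by simp [ofIsPairC, upd, h1],
        by simpa [ofIsPairC, upd, eval_ite_one, h1] using h2.of_isUpair⟩
  · rw [tr_mem]
    obtain ⟨rfl, rfl⟩ | ⟨rfl, rfl⟩ := el_upair.1 hc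
    · exact ⟨q, u, hu, by simp [ofIsPairC, upd, eval_ite_zero, hq],
        by simpa [ofIsPairC, upd, eval_ite_zero] using hqu.of_isSingle.symm⟩
    · exact ⟨r, v, hv, by simp [ofIsPairC, upd, eval_ite_one, hr],
        by simpa [ofIsPairC, upd, eval_ite_one] using hrv.of_isUpair.symm⟩

end Pairing

end ExtRealizability

namespace ExtRealizability

/-! ### Internal functions: graphs, domains, values, extensionality -/

section Functions

open OTerm VExt

variable {A : Type u}

/-- The name `Y` is `{⟨p.1, p.2, x p⟩ | D p}`. -/
def VExt.Enum (Y : VExt A) (D : A × A → Prop) (x : A × A → VExt A) : Prop :=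
  ∀ p z, El Y p z ↔ D p ∧ z = x p

theorem VExt.Enum.el {Y : VExt A} {D : A × A → Prop} {x : A × A → VExt A} {p : A × A}
    (h : Enum Y D x) (hp : D p) :
    El Y p (x p) := (h p _).2 ⟨hp, rfl⟩

variable [PCA A] {s t r : Part (A × A)} {x y z f w G Y D' : VExt A} {p : A × A}

/-- Realizer of `⟨x, y⟩_A ∈ f → pairMem x y f`. -/
def pairMemC : CTerm :=
  (lam 0 (lpair (tfst (var 0)) (con isPairC ⬝ (con symmC ⬝ tsnd (var 0))))).close

theorem Tr.pairMem (h : Tr s (.mem (opair x y) f)) : Tr (pairMemC.eval _ ⋄ s) (.pairMem x y f) := by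
  obtain ⟨a, rfl⟩ := h.exists_some
  obtain ⟨p, z, hz, hp, h⟩ := tr_mem.1 h
  rw [Fml.pairMem, tr_exB]
  exact ⟨p, z, hz, by simp [pairMemC, upd, hp], by simpa [pairMemC, upd] using h.symm.isPair⟩

/-- Realizer of `pairMem x y f → ⟨x, y⟩_A ∈ f`. -/
def ofPairMemC : CTerm :=
  (lam 0 (lpair (tfst (var 0)) (con symmC ⬝ (con ofIsPairC ⬝ tsnd (var 0))))).close

theorem Tr.of_pairMem (h : Tr s (.pairMem x y f)) :
    Tr (ofPairMemC.eval _ ⋄ s) (.mem (opair x y) f) := by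
  obtain ⟨a, rfl⟩ := h.exists_some
  rw [Fml.pairMem, tr_exB] at h
  obtain ⟨p, z, hz, hp, h⟩ := h
  exact tr_mem.2 ⟨p, z, hz, by simp [ofPairMemC, upd, hp],
    by simpa [ofPairMemC, upd] using h.of_isPair.symm⟩

theorem VExt.Enum.tr_mem {D : A × A → Prop} {x : A × A → VExt A} (h : Enum Y D x) :
    Tr s (.mem z Y) ↔ ∃ p, D p ∧ pfst s = Part.some p ∧ Tr (psnd s) (.eq z (x p)) := by
  rw [ExtRealizability.tr_mem]
  constructor
  · rintro ⟨p, z, hz, h1, h2⟩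
    obtain ⟨hp, rfl⟩ := (h p z).1 hz
    exact ⟨p, hp, h1, h2⟩
  · rintro ⟨p, hp, h1, h2⟩
    exact ⟨p, _, h.el hp, h1, h2⟩

/-- `G` is the internal graph `{⟨p.1, p.2, ⟨x p, y p⟩_A⟩ | D p}` of a function with domain
`{⟨p.1, p.2, x p⟩ | D p}`. -/
structure VExt.IsGraph (G : VExt A) (D : A × A → Prop) (x y : A × A → VExt A) : Prop where
  enum : Enum G D fun p => opair (x p) (y p)
  -- The values are required to be literally equal names, so that single-valuedness needs no
  -- realizer of its own.
  inj : ∀ p q t, D p → D q → Tr t (.eq (x p) (x q)) → y p = y q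

variable {D : A × A → Prop} {ix iy : A × A → VExt A}

/-- Realizer of `f = G → isFun f` for graphs `G`. -/
def isFunC : CTerm :=
  let d₁ := con transC ⬝ (con symmC ⬝ tsnd (tfst (var 0 ⬝ var 1))) ⬝ (con ofIsPairC ⬝ tfst (var 3))
  let d₂ := con transC ⬝ (con symmC ⬝ tsnd (tfst (var 0 ⬝ var 2))) ⬝ (con ofIsPairC ⬝ tsnd (var 3))
  (lam 0 (lpair (lam 1 (con isPairC ⬝ tsnd (tfst (var 0 ⬝ var 1))))
    (lam 1 (lam 2 (lam 3 (con transC ⬝ (con symmC ⬝ (con opairInjRightC ⬝ d₁)) ⬝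
      (con opairInjRightC ⬝ d₂))))))).close

theorem Tr.isFun (h : Tr s (.eq f G)) (hG : IsGraph G D ix iy) :
    Tr (isFunC.eval _ ⋄ s) (.isFun f) := by
  obtain ⟨a, rfl⟩ := h.exists_some
  rw [Fml.isFun, tr_and, Fml.isRel, tr_allB, tr_allB]
  refine ⟨⟨by simp [isFunC], fun p z hz => ?_⟩, by simp [isFunC], fun p z hz => ?_⟩
  · obtain ⟨q, hq, -, h1⟩ := hG.enum.tr_mem.1 (h.eq_left hz)
    rw [tr_ex]
    refine ⟨ix q, ?_⟩
    rw [tr_ex]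
    exact ⟨iy q, by simpa [isFunC, upd] using h1.isPair⟩
  · rw [tr_allB]
    refine ⟨by simp [isFunC], fun p' z' hz' => ?_⟩
    simp only [tr_all, tr_imp, tr_and]
    refine fun x y y' => ⟨by simp [isFunC], fun v hv => ?_⟩
    obtain ⟨q, hq, -, h1⟩ := hG.enum.tr_mem.1 (h.eq_left hz)
    obtain ⟨q', hq', -, h2⟩ := hG.enum.tr_mem.1 (h.eq_left hz')
    have d1 := h1.symm.trans hv.1.of_isPair
    have d2 := h2.symm.trans hv.2.of_isPair
    have h3 := d1.opair_inj_right.symm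
    -- Both entries have arguments equal to `x`, so their values are the same name, through which
    -- `y` and `y'` are compared.
    rw [hG.inj q q' _ hq hq' (d1.opair_inj_left.trans d2.opair_inj_left.symm)] at h3
    simpa [isFunC, upd] using h3.trans d2.opair_inj_right

/-- Realizer of `f = G → Y' = Y → hasDom f Y'` for graphs `G` of functions with domain `Y`. -/
def hasDomC : CTerm :=
  let m := con memRightC ⬝ var 2 ⬝ var 1
  let n := con memRightC ⬝ (con ofPairMemC ⬝ var 2) ⬝ var 0
  (lam 0 (lam 1 (lpair
    (lam 2 (con pairMemC ⬝ (con memLeftC ⬝ (con opairCongrC ⬝ tsnd m ⬝ con reflC) ⬝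
      (tsnd (var 0 ⬝ tfst m)))))
    (lam 2 (con memRightC ⬝ (lpair (tfst n) (con opairInjLeftC ⬝ tsnd n)) ⬝
      (con symmC ⬝ var 1)))))).close

theorem Tr.hasDom (h : Tr s (.eq f G)) (h' : Tr t (.eq D' Y)) (hG : IsGraph G D ix iy)
    (hY : Enum Y D ix) : Tr (hasDomC.eval _ ⋄ s ⋄ t) (.hasDom f D') := by
  obtain ⟨a, rfl⟩ := h.exists_some
  obtain ⟨b, rfl⟩ := h'.exists_some
  simp only [Fml.hasDom, tr_all, tr_iff, tr_imp, tr_ex]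
  refine fun x => ⟨⟨by simp [hasDomC], fun v hv => ?_⟩, by simp [hasDomC], fun v hv => ?_⟩
  · have hm := hv.mem_right h'
    obtain ⟨q, hq, h1, h2⟩ := hY.tr_mem.1 hm
    refine ⟨iy q, ?_⟩
    simpa [hasDomC, upd, h1] using
      ((h2.opair_congr (tr_refl _)).mem_left (h.eq_right (hG.enum.el hq))).pairMem
  · obtain ⟨y, hv⟩ := hv
    obtain ⟨q, hq, h1, h2⟩ := hG.enum.tr_mem.1 (hv.of_pairMem.mem_right h)
    simp only [hasDomC, eval_close, eval_lam, clo_pap, eval_lpair, psnd_pairVal]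
    refine Tr.mem_right (y := Y) (hY.tr_mem.2 ⟨q, hq, ?_, ?_⟩) (by simpa [upd] using h'.symm)
    · simpa [upd] using h1
    · simpa [upd] using h2.opair_inj_left

/-- Realizer of the uniqueness of the values of a function. -/
def funUniqueC : CTerm :=
  (lam 0 (lam 1 (lam 2 (tsnd (var 0) ⬝ tfst (var 1) ⬝ tfst (var 2) ⬝
    lpair (tsnd (var 1)) (tsnd (var 2)))))).close

theorem Tr.fun_unique (h : Tr r (.isFun f)) (h₁ : Tr s (.pairMem x y f))
    (h₂ : Tr t (.pairMem x z f)) : Tr (funUniqueC.eval _ ⋄ r ⋄ s ⋄ t) (.eq y z) := by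
  obtain ⟨a, rfl⟩ := h.exists_some
  obtain ⟨b, rfl⟩ := h₁.exists_some
  obtain ⟨c, rfl⟩ := h₂.exists_some
  rw [Fml.pairMem, tr_exB] at h₁ h₂
  obtain ⟨p, u, hu, hp, h₁⟩ := h₁
  obtain ⟨q, v, hv, hq, h₂⟩ := h₂
  rw [Fml.isFun, tr_and, tr_allB (y := f)] at h
  have h3 := (tr_allB.1 (h.2.2 p u hu)).2 q v hv
  simp only [tr_all] at h3
  simp only [funUniqueC, eval_close, eval_lam, clo_pap]
  exact Tr.imp (by simpa [upd, hp, hq] using h3 x y z)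
    (tr_and.2 ⟨by simpa [upd] using h₁, by simpa [upd] using h₂⟩)

/-- Realizer of the fact that the elements of a function are pairs. -/
def funPairC : CTerm := (lam 0 (lam 1 (lpair (var 1) (tfst (var 0) ⬝ var 1)))).close

/-- Unbounded existential quantifiers carry no computational witness: the components `x`, `y` are
found as names only, and the realizer merely keeps the index `p` of the pair. -/
theorem Tr.fun_pair (h : Tr r (.isFun f)) (hz : El f p z) :
    ∃ x y, Tr (funPairC.eval _ ⋄ r ⋄ Part.some p) (.pairMem x y f) ∧
      Tr (ofIsPairC.eval _ ⋄ psnd (funPairC.eval _ ⋄ r ⋄ Part.some p)) (.eq z (opair x y)) := by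
  obtain ⟨a, rfl⟩ := h.exists_some
  rw [Fml.isFun, tr_and, Fml.isRel, tr_allB] at h
  have h1 := h.1.2 p z hz
  simp only [tr_ex] at h1
  obtain ⟨x, y, h1⟩ := h1
  have h2 : Tr (psnd (funPairC.eval _ ⋄ Part.some a ⋄ Part.some p)) (.isPair z x y) := by
    simpa [funPairC, upd] using h1
  refine ⟨x, y, ?_, h2.of_isPair⟩
  rw [Fml.pairMem, tr_exB]
  exact ⟨p, z, hz, by simp [funPairC, upd], h2⟩

/-- Realizer of substitution in the first component of a pair in a relation. -/
def pairMemLeftC : CTerm :=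
  (lam 0 (lam 1 (con pairMemC ⬝ (con memLeftC ⬝ (con opairCongrC ⬝ var 0 ⬝ con reflC) ⬝
    (con ofPairMemC ⬝ var 1))))).close

theorem Tr.pairMem_left (h : Tr s (.eq x y)) (h' : Tr t (.pairMem y z f)) :
    Tr (pairMemLeftC.eval _ ⋄ s ⋄ t) (.pairMem x z f) := by
  obtain ⟨a, rfl⟩ := h.exists_some
  obtain ⟨b, rfl⟩ := h'.exists_some
  simpa [pairMemLeftC, upd] using ((h.opair_congr (tr_refl _)).mem_left h'.of_pairMem).pairMem

theorem Tr.mem_dom (h : Tr s (.hasDom f D')) (h' : Tr t (.pairMem x y f)) :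
    Tr (psnd s ⋄ t) (.mem x D') := by
  rw [Fml.hasDom, tr_all] at h
  exact (tr_iff.1 (h x)).2.imp (tr_ex.2 ⟨y, h'⟩)

/-- Realizer of the equality of a function `f` and a graph. -/
def funEqC : CTerm :=
  let b := con funPairC ⬝ var 0 ⬝ var 4
  let m := con memRightC ⬝ (tsnd (var 1) ⬝ b) ⬝ var 2
  let n := var 3 ⬝ tfst m
  let e := con funUniqueC ⬝ var 0 ⬝ b ⬝ (con pairMemLeftC ⬝ tsnd m ⬝ tfst n)
  (lam 0 (lam 1 (lam 2 (lam 3 (lam 4 (lpair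
    (lpair (tfst m) (con transC ⬝ (con ofIsPairC ⬝ tsnd b) ⬝
      (con opairCongrC ⬝ tsnd m ⬝ (con transC ⬝ e ⬝ tsnd n))))
    (con memLeftC ⬝ (con opairCongrC ⬝ con reflC ⬝ (con symmC ⬝ tsnd (var 3 ⬝ var 4))) ⬝
      (con ofPairMemC ⬝ tfst (var 3 ⬝ var 4))))))))).close

/-- A function `f` is equal to the graph `{⟨p.1, p.2, ⟨x p, y p⟩_A⟩ | D p}` if its domain is
`{⟨p.1, p.2, x p⟩ | D p}` and its value at `x p` is `y p`. -/
theorem Tr.fun_eq {a : A × A} (h : Tr r (.isFun f)) (h' : Tr s (.hasDom f D')) (h₁ : Tr t (.eq D' Y))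
    (h₂ : ∀ p, D p → ∃ w, Tr (pfst (Part.some a ⋄ Part.some p)) (.pairMem (ix p) w f) ∧
      Tr (psnd (Part.some a ⋄ Part.some p)) (.eq w (iy p)))
    (hG : Enum G D fun p => opair (ix p) (iy p)) (hY : Enum Y D ix) :
    Tr (funEqC.eval _ ⋄ r ⋄ s ⋄ t ⋄ Part.some a) (.eq f G) := by
  obtain ⟨b, rfl⟩ := h.exists_some
  obtain ⟨c, rfl⟩ := h'.exists_some
  obtain ⟨d, rfl⟩ := h₁.exists_some
  rw [tr_eq]
  refine ⟨by simp [funEqC], fun p z hz => ?_, fun p z hz => ?_⟩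
  · obtain ⟨x, y, h3, h4⟩ := h.fun_pair hz
    have hm := (h'.mem_dom h3).mem_right h₁
    obtain ⟨q, hq, h5, h6⟩ := hY.tr_mem.1 hm
    obtain ⟨w, h7, h8⟩ := h₂ q hq
    -- The element `z = ⟨x, y⟩` has `x` equal to the graph's argument with index `q`; uniqueness of
    -- values of `f` identifies `y` with the prescribed value there.
    have h9 := h.fun_unique h3 (h6.pairMem_left h7)
    refine hG.tr_mem.2 ⟨q, hq, by simpa [funEqC, upd] using h5, ?_⟩
    simpa [funEqC, upd, h5] using h4.trans (h6.opair_congr (h9.trans h8))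
  · obtain ⟨hp, rfl⟩ := (hG p z).1 hz
    obtain ⟨w, h3, h4⟩ := h₂ p hp
    simpa [funEqC, upd] using ((tr_refl _).opair_congr h4.symm).mem_left h3.of_pairMem

/-- Realizer of `pairMem x w F → w = F(x)`. -/
def valC : CTerm := (lam 0 (con opairInjRightC ⬝ tsnd (con ofPairMemC ⬝ var 0))).close

/-- The pair is matched with some entry `q` of the graph, possibly different from `p`; by `inj` the
values at `p` and `q` are the same name, so injectivity of pairs already gives the realizer. -/
theorem Tr.eq_val (hG : IsGraph G D ix iy) (hp : D p) (h : Tr s (.pairMem (ix p) w G)) :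
    Tr (valC.eval _ ⋄ s) (.eq w (iy p)) := by
  obtain ⟨a, rfl⟩ := h.exists_some
  obtain ⟨q, hq, h1, h2⟩ := hG.enum.tr_mem.1 h.of_pairMem
  rw [hG.inj p q _ hp hq h2.opair_inj_left]
  simpa [valC, upd] using h2.opair_inj_right

/-- Realizer of `memVal y F x → y ∈ F(x)`. -/
def ofMemValC : CTerm := (lam 0 (con memRightC ⬝ tsnd (var 0) ⬝ (con valC ⬝ tfst (var 0)))).close

theorem Tr.of_memVal (hG : IsGraph G D ix iy) (hp : D p) (h : Tr s (.memVal y G (ix p))) :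
    Tr (ofMemValC.eval _ ⋄ s) (.mem y (iy p)) := by
  obtain ⟨a, rfl⟩ := h.exists_some
  simp only [Fml.memVal, tr_ex, tr_and] at h
  obtain ⟨W, h1, h2⟩ := h
  simpa [ofMemValC, upd] using h2.mem_right (h1.eq_val hG hp)

/-- Realizer of `pairMem (x p) (y p) G` for `p` in the domain of the graph `G`. -/
def graphC : CTerm := (lam 0 (lpair (var 0) (con isPairC ⬝ con reflC))).close

theorem tr_graph (hG : Enum G D fun p => opair (ix p) (iy p)) (hp : D p) :
    Tr (graphC.eval _ ⋄ Part.some p) (.pairMem (ix p) (iy p) G) := by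
  rw [Fml.pairMem, tr_exB]
  exact ⟨p, _, hG.el hp, by simp [graphC, upd],
    by simpa [graphC, upd] using (tr_refl (opair (ix p) (iy p))).isPair⟩

/-- Realizer of `y ∈ F(x) → memVal y F x`. -/
def memValC : CTerm := (lam 0 (lam 1 (lpair (con graphC ⬝ var 0) (var 1)))).close

theorem Tr.memVal (hG : Enum G D fun p => opair (ix p) (iy p)) (hp : D p)
    (h : Tr s (.mem y (iy p))) : Tr (memValC.eval _ ⋄ Part.some p ⋄ s) (.memVal y G (ix p)) := by
  obtain ⟨a, rfl⟩ := h.exists_some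
  simp only [Fml.memVal, tr_ex, tr_and]
  exact ⟨_, by simpa [memValC, upd] using tr_graph hG hp, by simpa [memValC, upd] using h⟩

end Functions

end ExtRealizability

namespace ExtRealizability

/-! ## Functionality of the type structures -/

section TypeStructure

variable {A : Type u} {K : Kind} {σ τ ρ i j a b c d : A} {B B' : A → A → Prop}
  {F F' : A → A → A → A → Prop}

/-- `R` is a partial equivalence relation. -/
structure IsPER (R : A → A → Prop) : Prop where
  symm : ∀ a b, R a b → R b a
  trans : ∀ a b c, R a b → R b c → R a c

theorem IsPER.left {R : A → A → Prop} (h : IsPER R) (hab : R a b) : R a a :=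
  h.trans _ _ _ hab (h.symm _ _ hab)

theorem IsPER.right {R : A → A → Prop} (h : IsPER R) (hab : R a b) : R b b :=
  h.trans _ _ _ (h.symm _ _ hab) hab

/-- The family `F` of relations is invariant under the relation `B`. -/
structure IsPERFam (B : A → A → Prop) (F : A → A → A → A → Prop) : Prop where
  per : IsPER B
  fam : ∀ a b, B a b → IsPER (F a b)
  left : ∀ a b, B a b → F a a = F a b
  right : ∀ a b, B a b → F b b = F a b
  symm : ∀ a b, B a b → F b a = F a b

theorem IsPERFam.trans_left (h : IsPERFam B F) (hab : B a b) (hbc : B b c) : F a b = F a c := by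
  rw [← h.left a b hab, h.left a c (h.per.trans _ _ _ hab hbc)]

theorem IsPERFam.trans_right (h : IsPERFam B F) (hab : B a b) (hbc : B b c) : F b c = F a c := by
  rw [← h.left b c hbc, h.right a b hab, h.trans_left hab hbc]

variable [PCA A]

/-- `j b` is related to `i a` with relation `F a b` whenever `B a b`. -/
def FamRel (R : A → A → (A → A → Prop) → Prop) (B : A → A → Prop) (F : A → A → A → A → Prop)
    (i j : A) : Prop :=
  ∀ a b, B a b → ∃ ρ ∈ ap i a, ∃ ρ' ∈ ap j b, R ρ ρ' (F a b)

theorem famRel_iff {R : A → A → (A → A → Prop) → Prop} : FamRel R B F i j ↔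
    (∀ a b : A, B a b → (ap i a).Dom ∧ (ap j b).Dom) ∧
      (∀ a b ρ ρ' : A, B a b → ρ ∈ ap i a → ρ' ∈ ap j b → R ρ ρ' (F a b)) := by
  constructor
  · refine fun h => ⟨fun a b hab => ?_, fun a b ρ ρ' hab h1 h2 => ?_⟩
    · obtain ⟨ρ, hρ, ρ', hρ', -⟩ := h a b hab
      exact ⟨Part.dom_iff_mem.2 ⟨_, hρ⟩, Part.dom_iff_mem.2 ⟨_, hρ'⟩⟩
    · obtain ⟨ρ, hρ, ρ', hρ', h⟩ := h a b hab
      rwa [Part.mem_unique h1 hρ, Part.mem_unique h2 hρ']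
  · exact fun h a b hab => ⟨_, Part.get_mem (h.1 a b hab).1, _, Part.get_mem (h.1 a b hab).2,
      h.2 a b _ _ hab (Part.get_mem _) (Part.get_mem _)⟩

/-- The tag of a code is a numeral, so `num_injective` rules out all constructors but one, and
`pair_inj` recovers the data. The other inversion lemmas, including those for `Rep`, work in the
same way. -/
theorem TS.inv_fin {n : ℕ} (h : TS K (tyFin n) ρ B) : ρ = tyFin n ∧ B = relFin n := by
  generalize hα : (tyFin n : A) = α at h
  cases h <;> obtain ⟨h1, h2⟩ := pair_inj hα <;>
    first | exact absurd (num_injective h1) (by decide) | skip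
  rw [num_injective h2]
  exact ⟨rfl, rfl⟩

theorem TS.inv_nat (h : TS K tyNat ρ B) : ρ = tyNat ∧ B = relNat := by
  generalize hα : (tyNat : A) = α at h
  cases h <;> obtain ⟨h1, h2⟩ := pair_inj hα <;>
    first | exact absurd (num_injective h1) (by decide) | skip
  exact ⟨rfl, rfl⟩

theorem TS.inv_pi (h : TS K (tyPi σ i) ρ B') : ∃ τ j B F, ρ = tyPi τ j ∧ B' = relPi B F ∧
    TS K σ τ B ∧ FamRel (TS K) B F i j := by
  generalize hα : tyPi σ i = α at h
  cases h <;> obtain ⟨h1, h2⟩ := pair_inj hα <;>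
    first | exact absurd (num_injective h1) (by decide) | skip
  obtain ⟨rfl, rfl⟩ := pair_inj h2
  exact ⟨_, _, _, _, rfl, rfl, ‹_›, famRel_iff.2 ⟨‹_›, ‹_›⟩⟩

theorem TS.inv_sigma (h : TS K (tySigma σ i) ρ B') : ∃ τ j B F, ρ = tySigma τ j ∧
    B' = relSigma B F ∧ TS K σ τ B ∧ FamRel (TS K) B F i j := by
  generalize hα : tySigma σ i = α at h
  cases h <;> obtain ⟨h1, h2⟩ := pair_inj hα <;>
    first | exact absurd (num_injective h1) (by decide) | skip
  obtain ⟨rfl, rfl⟩ := pair_inj h2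
  exact ⟨_, _, _, _, rfl, rfl, ‹_›, famRel_iff.2 ⟨‹_›, ‹_›⟩⟩

theorem TS.inv_w (h : TS K (tyW σ i) ρ B') : ∃ τ j B F, ρ = tyW τ j ∧ K.HasW ∧
    B' = relW B F ∧ TS K σ τ B ∧ FamRel (TS K) B F i j := by
  generalize hα : tyW σ i = α at h
  cases h <;> obtain ⟨h1, h2⟩ := pair_inj hα <;>
    first | exact absurd (num_injective h1) (by decide) | skip
  obtain ⟨rfl, rfl⟩ := pair_inj h2
  exact ⟨_, _, _, _, rfl, ‹_›, rfl, ‹_›, famRel_iff.2 ⟨‹_›, ‹_›⟩⟩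

theorem TS.inv_id (h : TS K (tyId σ a b) ρ B') : ∃ τ a' b' B, ρ = tyId τ a' b' ∧ K.HasI ∧
    B' = relId B a b ∧ TS K σ τ B ∧ B a a' ∧ B b b' := by
  generalize hα : tyId σ a b = α at h
  cases h <;> obtain ⟨h1, h2⟩ := pair_inj hα <;>
    first | exact absurd (num_injective h1) (by decide) | skip
  obtain ⟨rfl, h3⟩ := pair_inj h2
  obtain ⟨rfl, rfl⟩ := pair_inj h3
  exact ⟨_, _, _, _, rfl, ‹_›, rfl, ‹_›, ‹_›, ‹_›⟩

theorem TS.mk_pi (hB : TS K σ τ B) (hF : FamRel (TS K) B F i j) :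
    TS K (tyPi σ i) (tyPi τ j) (relPi B F) :=
  .pi _ _ _ _ _ _ hB (famRel_iff.1 hF).1 (famRel_iff.1 hF).2

theorem TS.mk_sigma (hB : TS K σ τ B) (hF : FamRel (TS K) B F i j) :
    TS K (tySigma σ i) (tySigma τ j) (relSigma B F) :=
  .sigma _ _ _ _ _ _ hB (famRel_iff.1 hF).1 (famRel_iff.1 hF).2

theorem TS.mk_w (hK : K.HasW) (hB : TS K σ τ B) (hF : FamRel (TS K) B F i j) :
    TS K (tyW σ i) (tyW τ j) (relW B F) :=
  .w hK _ _ _ _ _ _ hB (famRel_iff.1 hF).1 (famRel_iff.1 hF).2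

theorem relPi_congr (h : ∀ a b, B a b → F a b = F' a b) : relPi B F = relPi B F' := by
  funext f g
  refine propext (forall_congr' fun a => forall_congr' fun b => forall_congr' fun hab => ?_)
  rw [h a b hab]

theorem relSigma_congr (h : ∀ a b, B a b → F a b = F' a b) : relSigma B F = relSigma B F' := by
  funext f g
  refine propext (exists_congr fun a => and_congr_right fun _ => exists_congr fun b =>
    and_congr_right fun _ => and_congr_right fun hab => ?_)
  rw [h a b hab]

theorem relW_mono (h : ∀ a b, B a b → F a b = F' a b) (hab : relW B F a b) : relW B F' a b := by
  induction hab with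
  | mk c d c₀ d₀ hc hd h₀ hdom _ ih =>
    rw [h _ _ h₀] at hdom ih
    exact .mk c d c₀ d₀ hc hd h₀ hdom ih

theorem relW_congr (h : ∀ a b, B a b → F a b = F' a b) : relW B F = relW B F' := by
  funext a b
  exact propext ⟨relW_mono h, relW_mono fun a b hab => (h a b hab).symm⟩

theorem IsPERFam.relPi (h : IsPERFam B F) : IsPER (relPi B F) where
  symm f g hfg a b hab := by
    obtain ⟨x, hx, y, hy, hxy⟩ := hfg b a (h.per.symm _ _ hab)
    rw [h.symm a b hab] at hxy
    exact ⟨y, hy, x, hx, (h.fam a b hab).symm _ _ hxy⟩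
  trans f g k hfg hgk a b hab := by
    obtain ⟨x, hx, y, hy, hxy⟩ := hfg a a (h.per.left hab)
    obtain ⟨y', hy', z, hz, hyz⟩ := hgk a b hab
    rw [h.left a b hab] at hxy
    rw [Part.mem_unique hy' hy] at hyz
    exact ⟨x, hx, z, hz, (h.fam a b hab).trans _ _ _ hxy hyz⟩

theorem IsPERFam.relSigma (h : IsPERFam B F) : IsPER (relSigma B F) where
  symm := by
    rintro f g ⟨a, ha, b, hb, hab, x, hx, y, hy, hxy⟩
    refine ⟨b, hb, a, ha, h.per.symm _ _ hab, y, hy, x, hx, ?_⟩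
    rw [h.symm a b hab]
    exact (h.fam a b hab).symm _ _ hxy
  trans := by
    rintro f g k ⟨a, ha, b, hb, hab, x, hx, y, hy, hxy⟩ ⟨b', hb', c, hc, hbc, y', hy', z, hz, hyz⟩
    obtain rfl := Part.mem_unique hb hb'
    obtain rfl := Part.mem_unique hy hy'
    refine ⟨a, ha, c, hc, h.per.trans _ _ _ hab hbc, x, hx, z, hz, ?_⟩
    rw [h.trans_left hab hbc] at hxy
    rw [h.trans_right hab hbc] at hyz
    exact (h.fam a c (h.per.trans _ _ _ hab hbc)).trans _ _ _ hxy hyz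

theorem IsPERFam.relW (h : IsPERFam B F) : IsPER (relW B F) where
  symm f g hfg := by
    induction hfg with
    | mk c d c₀ d₀ hc hd h₀ hdom _ ih =>
      refine .mk d c d₀ c₀ hd hc (h.per.symm _ _ h₀) ?_ ?_
      · rw [h.symm _ _ h₀]
        exact fun p q hpq => (hdom q p ((h.fam _ _ h₀).symm _ _ hpq)).symm
      · rw [h.symm _ _ h₀]
        exact fun p q e e' hpq he he' => ih q p e' e ((h.fam _ _ h₀).symm _ _ hpq) he' he
  trans f g k hfg := by
    induction hfg generalizing k with
    | mk c d c₀ d₀ hc hd h₀ hdom _ ih =>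
      rintro ⟨_, _, d₀', e₀, hd', he, h₀', hdom', h'⟩
      obtain rfl := Part.mem_unique hd hd'
      have h1 := h.per.trans _ _ _ h₀ h₀'
      rw [h.trans_left h₀ h₀'] at hdom ih
      rw [h.trans_right h₀ h₀'] at hdom' h'
      refine .mk c k c₀ e₀ hc he h1 (fun p q hpq => ?_) fun p q x z hpq hx hz => ?_
      · exact ⟨(hdom p q hpq).1, (hdom' p q hpq).2⟩
      -- The middle term is the branch of the middle tree at `p`: the first hypothesis is used at
      -- `(p, p)` and the second at `(p, q)`.
      · have hpp := (h.fam _ _ h1).left hpq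
        exact ih p p x _ hpp hx (Part.get_mem (hdom p p hpp).2) _
          (h' p q _ z hpq (Part.get_mem _) hz)

/-- The properties of a related pair of types that are proved by induction. -/
structure TSGood (K : Kind) (σ τ : A) (B : A → A → Prop) : Prop where
  ts : TS K σ τ B
  left : ∀ τ' B', TS K σ τ' B' → B' = B ∧ TS K τ τ' B
  right : ∀ τ' B', TS K τ τ' B' → B' = B ∧ TS K σ τ' B
  symm : TS K τ σ B
  per : IsPER B

/-- The part of the induction for `TS.good` that is common to `Π`, `Σ` and `W`. Any two of the
relations `F a b`, `F a a`, `F b a` belong to derivations sharing a code, so uniqueness of the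
relation of a code identifies them. -/
theorem TSGood.famRel (hB : TSGood K σ τ B) (hF : FamRel (TSGood K) B F i j) :
    IsPERFam B F ∧ FamRel (TS K) B F j i ∧
    (∀ j' F', FamRel (TS K) B F' i j' → (∀ a b, B a b → F' a b = F a b) ∧ FamRel (TS K) B F j j') ∧
    (∀ j' F', FamRel (TS K) B F' j j' → (∀ a b, B a b → F' a b = F a b) ∧ FamRel (TS K) B F i j') := by
  -- Both relations belong to the code `i a`.
  have hl : ∀ a b, B a b → F a a = F a b := by
    intro a b hab
    obtain ⟨ρ, hρ, ρ', hρ', h⟩ := hF a b hab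
    obtain ⟨ρ₁, hρ₁, ρ₂, hρ₂, h'⟩ := hF a a (hB.per.left hab)
    rw [Part.mem_unique hρ₁ hρ] at h'
    exact (h.left _ _ h'.ts).1
  -- Here the shared code is `j a`, which occurs on the right in the derivations for `F b a` and `F
  -- a a`.
  have hs : ∀ a b, B a b → F b a = F a b := by
    intro a b hab
    obtain ⟨ρ, hρ, ρ', hρ', h⟩ := hF b a (hB.per.symm _ _ hab)
    obtain ⟨ρ₁, hρ₁, ρ₂, hρ₂, h'⟩ := hF a a (hB.per.left hab)
    rw [Part.mem_unique hρ' hρ₂] at h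
    rw [← hl a b hab]
    exact (h'.right _ _ h.symm).1
  refine ⟨⟨hB.per, fun a b hab => ?_, hl, fun a b hab => ?_, hs⟩, fun a b hab => ?_,
    fun j' F' hF' => ?_, fun j' F' hF' => ?_⟩
  · obtain ⟨ρ, hρ, ρ', hρ', h⟩ := hF a b hab
    exact h.per
  · rw [hl b a (hB.per.symm _ _ hab), hs a b hab]
  · obtain ⟨ρ, hρ, ρ', hρ', h⟩ := hF b a (hB.per.symm _ _ hab)
    exact ⟨ρ', hρ', ρ, hρ, hs a b hab ▸ h.symm⟩
  · have key : ∀ a b, B a b → F' a b = F a b := by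
      intro a b hab
      obtain ⟨ρ, hρ, ρ', hρ', h⟩ := hF a b hab
      obtain ⟨ρ₁, hρ₁, ρ₂, hρ₂, h'⟩ := hF' a b hab
      rw [Part.mem_unique hρ₁ hρ] at h'
      exact (h.left _ _ h').1
    refine ⟨key, fun a b hab => ?_⟩
    obtain ⟨ρ, hρ, ρ', hρ', h⟩ := hF a a (hB.per.left hab)
    obtain ⟨ρ₁, hρ₁, ρ₂, hρ₂, h'⟩ := hF' a b hab
    rw [Part.mem_unique hρ₁ hρ] at h'
    exact ⟨ρ', hρ', ρ₂, hρ₂, hl a b hab ▸ (h.left _ _ h').2⟩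
  · have key : ∀ a b, B a b → F' a b = F a b ∧ ∃ ρ ∈ ap i a, ∃ ρ' ∈ ap j' b, TS K ρ ρ' (F a b) := by
      intro a b hab
      obtain ⟨ρ, hρ, ρ', hρ', h⟩ := hF a a (hB.per.left hab)
      obtain ⟨ρ₁, hρ₁, ρ₂, hρ₂, h'⟩ := hF' a b hab
      rw [Part.mem_unique hρ₁ hρ'] at h'
      have h2 := h.right _ _ h'
      rw [← hl a b hab]
      exact ⟨h2.1, ρ, hρ, ρ₂, hρ₂, h2.2⟩
    exact ⟨fun a b hab => (key a b hab).1, fun a b hab => (key a b hab).2⟩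

theorem relId_congr (h : IsPER B) {a' b' : A} (ha : B a a') (hb : B b b') :
    relId B a b = relId B a' b' := by
  funext x y
  refine propext (and_congr_right fun _ => and_congr_right fun _ => ⟨fun hab => ?_, fun hab => ?_⟩)
  · exact h.trans _ _ _ (h.symm _ _ ha) (h.trans _ _ _ hab hb)
  · exact h.trans _ _ _ ha (h.trans _ _ _ hab (h.symm _ _ hb))

/-- The five properties are proved simultaneously, since they feed each other: symmetry and
uniqueness for the fibres give invariance of the family, for which the relation on the base must
already be a PER, and invariance gives the PER and uniqueness for the compound type. -/
theorem TS.good (h : TS K σ τ B) : TSGood K σ τ B := by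
  induction h with
  | fin n =>
    refine ⟨.fin n, fun τ' B' h => ?_, fun τ' B' h => ?_, .fin n, ⟨?_, ?_⟩⟩
    · obtain ⟨rfl, rfl⟩ := h.inv_fin
      exact ⟨rfl, .fin n⟩
    · obtain ⟨rfl, rfl⟩ := h.inv_fin
      exact ⟨rfl, .fin n⟩
    · rintro _ _ ⟨m, hm, rfl, rfl⟩
      exact ⟨m, hm, rfl, rfl⟩
    · rintro _ _ _ ⟨m, hm, rfl, rfl⟩ ⟨m', -, h, rfl⟩
      exact ⟨m, hm, rfl, h.symm⟩
  | nat =>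
    refine ⟨.nat, fun τ' B' h => ?_, fun τ' B' h => ?_, .nat, ⟨?_, ?_⟩⟩
    · obtain ⟨rfl, rfl⟩ := h.inv_nat
      exact ⟨rfl, .nat⟩
    · obtain ⟨rfl, rfl⟩ := h.inv_nat
      exact ⟨rfl, .nat⟩
    · rintro _ _ ⟨m, rfl, rfl⟩
      exact ⟨m, rfl, rfl⟩
    · rintro _ _ _ ⟨m, rfl, rfl⟩ ⟨m', h, rfl⟩
      exact ⟨m, rfl, h.symm⟩
  | pi σ τ i j B F hB hdom hF ihB ihF =>
    have hG := famRel_iff.2 ⟨hdom, ihF⟩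
    obtain ⟨hper, hsymm, hl, hr⟩ := ihB.famRel hG
    refine ⟨hB.mk_pi (famRel_iff.2 ⟨hdom, hF⟩), fun τ' B' h => ?_, fun τ' B' h => ?_,
      ihB.symm.mk_pi hsymm, hper.relPi⟩
    · obtain ⟨τ', j', B', F', rfl, rfl, h1, h2⟩ := h.inv_pi
      obtain ⟨rfl, h1⟩ := ihB.left _ _ h1
      obtain ⟨h3, h4⟩ := hl _ _ h2
      exact ⟨relPi_congr h3, h1.mk_pi h4⟩
    · obtain ⟨τ', j', B', F', rfl, rfl, h1, h2⟩ := h.inv_pi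
      obtain ⟨rfl, h1⟩ := ihB.right _ _ h1
      obtain ⟨h3, h4⟩ := hr _ _ h2
      exact ⟨relPi_congr h3, h1.mk_pi h4⟩
  | sigma σ τ i j B F hB hdom hF ihB ihF =>
    have hG := famRel_iff.2 ⟨hdom, ihF⟩
    obtain ⟨hper, hsymm, hl, hr⟩ := ihB.famRel hG
    refine ⟨hB.mk_sigma (famRel_iff.2 ⟨hdom, hF⟩), fun τ' B' h => ?_, fun τ' B' h => ?_,
      ihB.symm.mk_sigma hsymm, hper.relSigma⟩
    · obtain ⟨τ', j', B', F', rfl, rfl, h1, h2⟩ := h.inv_sigma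
      obtain ⟨rfl, h1⟩ := ihB.left _ _ h1
      obtain ⟨h3, h4⟩ := hl _ _ h2
      exact ⟨relSigma_congr h3, h1.mk_sigma h4⟩
    · obtain ⟨τ', j', B', F', rfl, rfl, h1, h2⟩ := h.inv_sigma
      obtain ⟨rfl, h1⟩ := ihB.right _ _ h1
      obtain ⟨h3, h4⟩ := hr _ _ h2
      exact ⟨relSigma_congr h3, h1.mk_sigma h4⟩
  | w hK σ τ i j B F hB hdom hF ihB ihF =>
    have hG := famRel_iff.2 ⟨hdom, ihF⟩
    obtain ⟨hper, hsymm, hl, hr⟩ := ihB.famRel hG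
    refine ⟨hB.mk_w hK (famRel_iff.2 ⟨hdom, hF⟩), fun τ' B' h => ?_, fun τ' B' h => ?_,
      ihB.symm.mk_w hK hsymm, hper.relW⟩
    · obtain ⟨τ', j', B', F', rfl, -, rfl, h1, h2⟩ := h.inv_w
      obtain ⟨rfl, h1⟩ := ihB.left _ _ h1
      obtain ⟨h3, h4⟩ := hl _ _ h2
      exact ⟨relW_congr h3, h1.mk_w hK h4⟩
    · obtain ⟨τ', j', B', F', rfl, -, rfl, h1, h2⟩ := h.inv_w
      obtain ⟨rfl, h1⟩ := ihB.right _ _ h1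
      obtain ⟨h3, h4⟩ := hr _ _ h2
      exact ⟨relW_congr h3, h1.mk_w hK h4⟩
  | id hK σ τ a a' b b' B hB ha hb ihB =>
    have hper := ihB.per
    have hrel := relId_congr hper ha hb
    refine ⟨.id hK _ _ _ _ _ _ _ hB ha hb, fun τ' B' h => ?_, fun τ' B' h => ?_,
      hrel ▸ .id hK _ _ _ _ _ _ _ ihB.symm (hper.symm _ _ ha) (hper.symm _ _ hb), ?_, ?_⟩
    · obtain ⟨τ', a'', b'', B', rfl, -, rfl, h1, h2, h3⟩ := h.inv_id
      obtain ⟨rfl, h1⟩ := ihB.left _ _ h1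
      exact ⟨rfl, hrel ▸ .id hK _ _ _ _ _ _ _ h1 (hper.trans _ _ _ (hper.symm _ _ ha) h2)
        (hper.trans _ _ _ (hper.symm _ _ hb) h3)⟩
    · obtain ⟨τ', a'', b'', B', rfl, -, rfl, h1, h2, h3⟩ := h.inv_id
      obtain ⟨rfl, h1⟩ := ihB.right _ _ h1
      exact ⟨hrel.symm, .id hK _ _ _ _ _ _ _ h1 (hper.trans _ _ _ ha h2) (hper.trans _ _ _ hb h3)⟩
    · rintro _ _ ⟨rfl, rfl, h⟩
      exact ⟨rfl, rfl, h⟩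
    · rintro _ _ _ ⟨rfl, rfl, h⟩ ⟨-, rfl, -⟩
      exact ⟨rfl, rfl, h⟩

/-- By uniqueness, the existentially defined `SimAt K σ` is the relation of every derivation with
`σ` on the left. From here on derivations can be dropped in favour of `SimAt`. -/
theorem TS.simAt_eq (h : TS K σ τ B) : SimAt K σ = B := by
  funext a b
  refine propext ⟨?_, fun hab => ⟨τ, B, h, hab⟩⟩
  rintro ⟨τ', B', h', hab⟩
  rwa [(h.good.left _ _ h').1] at hab

theorem TS.isType_left (h : TS K σ τ B) : IsType K σ := ⟨B, (h.good.right _ _ h.good.symm).2⟩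

theorem IsType.ts (h : IsType K σ) : TS K σ σ (SimAt K σ) := by
  obtain ⟨B, h⟩ := h
  rwa [h.simAt_eq]

theorem Sim.ts (h : Sim K σ τ) : TS K σ τ (SimAt K σ) := by
  obtain ⟨B, h⟩ := h
  rwa [h.simAt_eq]

theorem Sim.simAt_eq (h : Sim K σ τ) : SimAt K σ = SimAt K τ := by
  rw [h.ts.good.symm.simAt_eq]

theorem IsType.per (h : IsType K σ) : IsPER (SimAt K σ) := h.ts.good.per

theorem SimAt.isType (h : SimAt K σ a b) : IsType K σ :=
  let ⟨_, _, h, _⟩ := h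
  h.isType_left

theorem SimAt.symm (h : SimAt K σ a b) : SimAt K σ b a := h.isType.per.symm _ _ h

theorem SimAt.trans (h : SimAt K σ a b) (h' : SimAt K σ b c) : SimAt K σ a c :=
  h.isType.per.trans _ _ _ h h'

theorem SimAt.left (h : SimAt K σ a b) : HasType K σ a := h.isType.per.left h

theorem SimAt.right (h : SimAt K σ a b) : HasType K σ b := h.isType.per.right h

end TypeStructure

end ExtRealizability

namespace ExtRealizability

/-! ## Canonical forms of types -/

section Families

open Classical in
/-- The value of a defined partial value. -/
noncomputable def val {A : Type u} [PCA A] (s : Part A) : A := if h : s.Dom then s.get h else PCA.k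

variable {A : Type u} [PCA A] {K : Kind} {σ τ ρ i j a b c d f g : A} {s t : Part A}

theorem val_eq_of_mem (h : a ∈ s) : val s = a := by
  obtain rfl := Part.eq_some_iff.2 h
  simp [val]

theorem val_mem (h : s.Dom) : val s ∈ s := by
  rw [val, dif_pos h]
  exact Part.get_mem h

theorem both_val {R : A → A → Prop} : Both R s t ↔ s.Dom ∧ t.Dom ∧ R (val s) (val t) := by
  constructor
  · rintro ⟨a, ha, b, hb, h⟩
    rw [val_eq_of_mem ha, val_eq_of_mem hb]
    exact ⟨Part.dom_iff_mem.2 ⟨_, ha⟩, Part.dom_iff_mem.2 ⟨_, hb⟩, h⟩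
  · exact fun ⟨h1, h2, h⟩ => ⟨_, val_mem h1, _, val_mem h2, h⟩

/-- The family of relations `∼_{i a}`. -/
def famAt (K : Kind) (i : A) (a _b : A) : A → A → Prop := SimAt K (val (ap i a))

theorem IsFamily.dom (hi : IsFamily K σ i) (h : SimAt K σ a b) : (ap i a).Dom :=
  (both_val.1 (hi a b h)).1

theorem IsFamily.sim (hi : IsFamily K σ i) (h : SimAt K σ a b) :
    Sim K (val (ap i a)) (val (ap i b)) := (both_val.1 (hi a b h)).2.2

theorem IsFamily.famRel (hi : IsFamily K σ i) :
    FamRel (TS K) (SimAt K σ) (famAt K i) i i := fun _ _ h =>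
  ⟨_, val_mem (hi.dom h), _, val_mem (hi.dom h.symm), (hi.sim h).ts⟩

theorem FamRel.isFamily {B : A → A → Prop} {F : A → A → A → A → Prop}
    (h : FamRel (TS K) B F i i) (hB : TS K σ τ B) : IsFamily K σ i := by
  intro a b hab
  rw [hB.simAt_eq] at hab
  obtain ⟨ρ, hρ, ρ', hρ', h⟩ := h a b hab
  exact ⟨ρ, hρ, ρ', hρ', _, h⟩

theorem IsType.pi_inv (h : IsType K (tyPi σ i)) : IsType K σ ∧ IsFamily K σ i := by
  obtain ⟨τ, j, B, F, h0, -, h1, h2⟩ := h.ts.inv_pi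
  obtain ⟨rfl, rfl⟩ := pair_inj (pair_inj h0).2
  exact ⟨h1.isType_left, h2.isFamily h1⟩

theorem IsType.sigma_inv (h : IsType K (tySigma σ i)) : IsType K σ ∧ IsFamily K σ i := by
  obtain ⟨τ, j, B, F, h0, -, h1, h2⟩ := h.ts.inv_sigma
  obtain ⟨rfl, rfl⟩ := pair_inj (pair_inj h0).2
  exact ⟨h1.isType_left, h2.isFamily h1⟩

theorem IsType.w_inv (h : IsType K (tyW σ i)) : K.HasW ∧ IsType K σ ∧ IsFamily K σ i := by
  obtain ⟨τ, j, B, F, h0, hK, -, h1, h2⟩ := h.ts.inv_w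
  obtain ⟨rfl, rfl⟩ := pair_inj (pair_inj h0).2
  exact ⟨hK, h1.isType_left, h2.isFamily h1⟩

theorem simAt_fin (n : ℕ) : SimAt K (tyFin n : A) = relFin n := (TS.fin n).simAt_eq

theorem simAt_nat : SimAt K (tyNat : A) = relNat := TS.nat.simAt_eq

theorem IsType.simAt_pi (hσ : IsType K σ) (hi : IsFamily K σ i) :
    SimAt K (tyPi σ i) = relPi (SimAt K σ) (famAt K i) := (hσ.ts.mk_pi hi.famRel).simAt_eq

theorem IsType.simAt_sigma (hσ : IsType K σ) (hi : IsFamily K σ i) :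
    SimAt K (tySigma σ i) = relSigma (SimAt K σ) (famAt K i) := (hσ.ts.mk_sigma hi.famRel).simAt_eq

theorem IsType.simAt_w (hK : K.HasW) (hσ : IsType K σ) (hi : IsFamily K σ i) :
    SimAt K (tyW σ i) = relW (SimAt K σ) (famAt K i) := (hσ.ts.mk_w hK hi.famRel).simAt_eq

theorem HasType.simAt_id (hK : K.HasI) (ha : HasType K σ a) (hb : HasType K σ b) :
    SimAt K (tyId σ a b) = relId (SimAt K σ) a b :=
  (TS.id hK _ _ _ _ _ _ _ ha.isType.ts ha hb).simAt_eq

/-- An element of `Π_σ i` maps related arguments to related values. -/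
theorem SimAt.pi_elim (hfg : SimAt K (tyPi σ i) f g) (hab : SimAt K σ a b) :
    (ap f a).Dom ∧ (ap g b).Dom ∧ SimAt K (val (ap i a)) (val (ap f a)) (val (ap g b)) := by
  obtain ⟨hσ, hi⟩ := hfg.isType.pi_inv
  rw [hσ.simAt_pi hi] at hfg
  exact both_val.1 (hfg a b hab)

theorem SimAt.sigma_elim (h : SimAt K (tySigma σ i) a b) :
    ((fst a).Dom ∧ (fst b).Dom ∧ SimAt K σ (val (fst a)) (val (fst b))) ∧
      (snd a).Dom ∧ (snd b).Dom ∧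
        SimAt K (val (ap i (val (fst a)))) (val (snd a)) (val (snd b)) := by
  obtain ⟨hσ, hi⟩ := h.isType.sigma_inv
  rw [hσ.simAt_sigma hi] at h
  obtain ⟨a₀, ha, b₀, hb, h1, h2⟩ := h
  rw [← val_eq_of_mem ha, ← val_eq_of_mem hb] at h1
  rw [← val_eq_of_mem ha] at h2
  exact ⟨⟨Part.dom_iff_mem.2 ⟨_, ha⟩, Part.dom_iff_mem.2 ⟨_, hb⟩, h1⟩, both_val.1 h2⟩

theorem SimAt.w_elim (h : SimAt K (tyW σ i) c d) :
    ((fst c).Dom ∧ (fst d).Dom ∧ SimAt K σ (val (fst c)) (val (fst d))) ∧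
      ∀ p q, SimAt K (val (ap i (val (fst c)))) p q → (sndAp c p).Dom ∧ (sndAp d q).Dom ∧
        SimAt K (tyW σ i) (val (sndAp c p)) (val (sndAp d q)) := by
  obtain ⟨hK, hσ, hi⟩ := h.isType.w_inv
  rw [hσ.simAt_w hK hi] at h ⊢
  obtain ⟨_, _, c₀, d₀, hc, hd, h₀, hdom, h⟩ := h
  refine ⟨⟨Part.dom_iff_mem.2 ⟨_, hc⟩, Part.dom_iff_mem.2 ⟨_, hd⟩, ?_⟩, fun p q hpq => ?_⟩
  · rwa [val_eq_of_mem hc, val_eq_of_mem hd]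
  · rw [val_eq_of_mem hc] at hpq
    have := hdom p q hpq
    exact ⟨this.1, this.2, h p q _ _ hpq (val_mem this.1) (val_mem this.2)⟩

theorem SimAt.w_intro (hK : K.HasW) (hi : IsFamily K σ i) (hc : (fst c).Dom) (hd : (fst d).Dom)
    (h₀ : SimAt K σ (val (fst c)) (val (fst d)))
    (h : ∀ p q, SimAt K (val (ap i (val (fst c)))) p q → (sndAp c p).Dom ∧ (sndAp d q).Dom ∧
        SimAt K (tyW σ i) (val (sndAp c p)) (val (sndAp d q))) : SimAt K (tyW σ i) c d := by
  rw [h₀.isType.simAt_w hK hi] at h ⊢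
  refine .mk c d _ _ (val_mem hc) (val_mem hd) h₀ (fun p q hpq => ?_)
    fun p q e e' hpq he he' => ?_
  · exact ⟨(h p q hpq).1, (h p q hpq).2.1⟩
  · have := (h p q hpq).2.2
    rwa [val_eq_of_mem he, val_eq_of_mem he'] at this

/-- Induction on types. -/
theorem IsType.induction {motive : A → Prop} (fin : ∀ n, motive (tyFin n)) (nat : motive tyNat)
    (pi : ∀ σ i, IsType K σ → IsFamily K σ i → motive σ →
      (∀ a, HasType K σ a → motive (val (ap i a))) → motive (tyPi σ i))
    (sigma : ∀ σ i, IsType K σ → IsFamily K σ i → motive σ →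
      (∀ a, HasType K σ a → motive (val (ap i a))) → motive (tySigma σ i))
    (id : ∀ σ a b, K.HasI → HasType K σ a → HasType K σ b → motive σ → motive (tyId σ a b))
    (w : ∀ σ i, K.HasW → IsType K σ → IsFamily K σ i → motive σ →
      (∀ a, HasType K σ a → motive (val (ap i a))) → motive (tyW σ i))
    (h : IsType K σ) : motive σ := by
  have h := h.ts
  generalize SimAt K σ = B at h
  suffices ∀ σ τ B, TS K σ τ B → motive σ from this _ _ _ h
  clear h
  intro σ τ B h
  have key : ∀ {σ τ i j : A} {B F} (hB : TS K σ τ B) (hF : FamRel (TS K) B F i j)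
    (ihF : ∀ a b ρ ρ' : A, B a b → ρ ∈ ap i a → ρ' ∈ ap j b → motive ρ) (a : A),
      HasType K σ a → motive (val (ap i a)) := by
    intro σ τ i j B F hB hF ihF a ha
    have ha : B a a := by rw [← hB.simAt_eq]; exact ha
    obtain ⟨ρ, hρ, ρ', hρ', -⟩ := hF a a ha
    rw [val_eq_of_mem hρ]
    exact ihF _ _ _ _ ha hρ hρ'
  induction h with
  | fin n => exact fin n
  | nat => exact nat
  | pi σ τ i j B F hB hdom hF ihB ihF =>
    have hF' := famRel_iff.2 ⟨hdom, hF⟩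
    obtain ⟨hσ, hi⟩ := (hB.mk_pi hF').isType_left.pi_inv
    exact pi σ i hσ hi ihB (key hB hF' ihF)
  | sigma σ τ i j B F hB hdom hF ihB ihF =>
    have hF' := famRel_iff.2 ⟨hdom, hF⟩
    obtain ⟨hσ, hi⟩ := (hB.mk_sigma hF').isType_left.sigma_inv
    exact sigma σ i hσ hi ihB (key hB hF' ihF)
  | id hK σ τ a a' b b' B hB ha hb ihB =>
    rw [← hB.simAt_eq] at ha hb
    exact id σ a b hK ha.left hb.left ihB
  | w hK σ τ i j B F hB hdom hF ihB ihF =>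
    have hF' := famRel_iff.2 ⟨hdom, hF⟩
    -- The `Π`-type on the same data serves only to extract that `σ` is a type and `i` a family over
    -- it.
    obtain ⟨hσ, hi⟩ := (hB.mk_pi hF').isType_left.pi_inv
    exact w σ i hK hσ hi ihB (key hB hF' ihF)

/-- Induction on elements of `W_σ i`. -/
theorem SimAt.w_induction {motive : A → A → Prop}
    (step : ∀ c d, SimAt K (tyW σ i) c d →
      (∀ p q, SimAt K (val (ap i (val (fst c)))) p q →
        motive (val (sndAp c p)) (val (sndAp d q))) → motive c d)
    (h : SimAt K (tyW σ i) c d) : motive c d := by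
  obtain ⟨hK, hσ, hi⟩ := h.isType.w_inv
  rw [hσ.simAt_w hK hi] at h step
  induction h with
  | mk c d c₀ d₀ hc hd h₀ hdom h ih =>
    refine step _ _ (.mk c d c₀ d₀ hc hd h₀ hdom h) fun p q hpq => ?_
    rw [val_eq_of_mem hc] at hpq
    exact ih p q _ _ hpq (val_mem (hdom p q hpq).1) (val_mem (hdom p q hpq).2)

end Families

/-! ## Canonical names -/

section Names

open VExt

variable {A : Type u}

/-- The name `{⟨a, b, x a⟩ | R a b}`. -/
def VExt.ofRel (R : A → A → Prop) (x : A → VExt A) : VExt A :=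
  mk {q : A × A // R q.1 q.2} (fun q => q.1.1) (fun q => q.1.2) fun q => x q.1.1

theorem VExt.enum_ofRel (R : A → A → Prop) (x : A → VExt A) :
    Enum (ofRel R x) (fun p => R p.1 p.2) fun p => x p.1 := by
  intro p z
  constructor
  · rintro ⟨⟨q, hq⟩, rfl, rfl⟩
    exact ⟨hq, rfl⟩
  · rintro ⟨hp, rfl⟩
    exact ⟨⟨p, hp⟩, rfl, rfl⟩

theorem VExt.ofRel_congr {R : A → A → Prop} {x y : A → VExt A} (h : ∀ a b, R a b → x a = y a) :
    ofRel R x = ofRel R y := by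
  have : (fun q : {q : A × A // R q.1 q.2} => x q.1.1) = fun q => y q.1.1 :=
    funext fun q => h _ _ q.2
  rw [ofRel, ofRel, this]

variable [PCA A] {K : Kind} {σ τ i j a b c f : A} {x z : VExt A}

theorem Rep.inv_fin {n : ℕ} (h : Rep K (tyFin n) a x) : ∃ m < n, a = num m ∧ x = dot m := by
  generalize hα : (tyFin n : A) = α at h
  cases h <;> obtain ⟨h1, h2⟩ := pair_inj hα <;>
    first | exact absurd (num_injective h1) (by decide) | skip
  obtain rfl := num_injective h2
  exact ⟨_, ‹_›, rfl, rfl⟩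

theorem Rep.inv_nat (h : Rep K tyNat a x) : ∃ m, a = num m ∧ x = dot m := by
  generalize hα : (tyNat : A) = α at h
  cases h <;> obtain ⟨h1, h2⟩ := pair_inj hα <;>
    first | exact absurd (num_injective h1) (by decide) | skip
  exact ⟨_, rfl, rfl⟩

theorem Rep.inv_pi (h : Rep K (tyPi σ i) f z) : ∃ x y : A → VExt A,
    (∀ a : A, HasType K σ a → Rep K σ a (x a)) ∧
    (∀ a τ e : A, HasType K σ a → τ ∈ ap i a → e ∈ ap f a → Rep K τ e (y a)) ∧
    z = ofRel (SimAt K σ) fun a => opair (x a) (y a) := by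
  generalize hα : tyPi σ i = α at h
  cases h <;> obtain ⟨h1, h2⟩ := pair_inj hα <;>
    first | exact absurd (num_injective h1) (by decide) | skip
  obtain ⟨rfl, rfl⟩ := pair_inj h2
  exact ⟨_, _, ‹_›, ‹_›, rfl⟩

theorem Rep.inv_sigma (h : Rep K (tySigma σ i) a z) : ∃ a₀ a₁ τ x y,
    a₀ ∈ fst a ∧ a₁ ∈ snd a ∧ τ ∈ ap i a₀ ∧ Rep K σ a₀ x ∧ Rep K τ a₁ y ∧ z = opair x y := by
  generalize hα : tySigma σ i = α at h
  cases h <;> obtain ⟨h1, h2⟩ := pair_inj hα <;>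
    first | exact absurd (num_injective h1) (by decide) | skip
  obtain ⟨rfl, rfl⟩ := pair_inj h2
  exact ⟨_, _, _, _, _, ‹_›, ‹_›, ‹_›, ‹_›, ‹_›, rfl⟩

theorem Rep.inv_id (h : Rep K (tyId σ a b) c z) : z = empty := by
  generalize hα : tyId σ a b = α at h
  cases h <;> obtain ⟨h1, h2⟩ := pair_inj hα <;>
    first | exact absurd (num_injective h1) (by decide) | skip
  rfl

theorem Rep.inv_w (h : Rep K (tyW σ i) c z) : ∃ (c₀ τ : A) (x : VExt A) (y y' : A → VExt A),
    c₀ ∈ fst c ∧ τ ∈ ap i c₀ ∧ Rep K σ c₀ x ∧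
    (∀ p : A, HasType K τ p → Rep K τ p (y p)) ∧
    (∀ p e : A, HasType K τ p → e ∈ sndAp c p → Rep K (tyW σ i) e (y' p)) ∧
    z = opair x (ofRel (SimAt K τ) fun p => opair (y p) (y' p)) := by
  generalize hα : tyW σ i = α at h
  cases h <;> obtain ⟨h1, h2⟩ := pair_inj hα <;>
    first | exact absurd (num_injective h1) (by decide) | skip
  obtain ⟨rfl, rfl⟩ := pair_inj h2
  exact ⟨_, _, _, _, _, ‹_›, ‹_›, ‹_›, ‹_›, ‹_›, rfl⟩

/-- `a^σ` exists and is unique. -/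
def HasName (K : Kind) (σ a : A) : Prop := ∀ z, Rep K σ a z ↔ z = interp K σ a

theorem interp_eq_of_forall (h : ∀ z, Rep K σ a z ↔ z = x) : interp K σ a = x :=
  (h _).1 (Classical.epsilon_spec (p := fun z => Rep K σ a z) ⟨x, (h x).2 rfl⟩)

theorem hasName_of_forall (h : ∀ z, Rep K σ a z ↔ z = x) : HasName K σ a := by
  rw [HasName, interp_eq_of_forall h]
  exact h

theorem HasName.rep (h : HasName K σ a) : Rep K σ a (interp K σ a) := (h _).2 rfl

theorem rep_fin {n m : ℕ} (h : m < n) : Rep K (tyFin n : A) (num m) z ↔ z = dot m := by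
  constructor
  · intro hz
    obtain ⟨m', -, h1, rfl⟩ := hz.inv_fin
    rw [num_injective h1]
  · rintro rfl
    exact .fin n m h

theorem rep_nat {m : ℕ} : Rep K (tyNat : A) (num m) z ↔ z = dot m := by
  constructor
  · intro hz
    obtain ⟨m', h1, rfl⟩ := hz.inv_nat
    rw [num_injective h1]
  · rintro rfl
    exact .nat m

theorem rep_pi (hf : HasType K (tyPi σ i) f) (hσ : ∀ a, HasType K σ a → HasName K σ a)
    (hi : ∀ a, HasType K σ a → HasName K (val (ap i a)) (val (ap f a))) :
    Rep K (tyPi σ i) f z ↔ z = ofRel (SimAt K σ) fun a =>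
      opair (interp K σ a) (interp K (val (ap i a)) (val (ap f a))) := by
  have hfam := hf.isType.pi_inv.2
  constructor
  · intro h
    obtain ⟨x, y, hx, hy, rfl⟩ := h.inv_pi
    -- The functions `x`, `y` are determined only at elements of `σ`, which are the only arguments
    -- that `ofRel` uses.
    refine ofRel_congr fun a b hab => ?_
    have ha := hab.left
    rw [← (hσ a ha _).1 (hx a ha),
      ← (hi a ha _).1 (hy a _ _ ha (val_mem (hfam.dom ha)) (val_mem (hf.pi_elim ha).1))]
  · rintro rfl
    refine .pi σ i f _ (fun a => interp K (val (ap i a)) (val (ap f a))) hf (fun a ha => (hσ a ha).rep) fun a τ e ha hτ he => ?_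
    have := (hi a ha).rep
    rwa [val_eq_of_mem hτ, val_eq_of_mem he] at this ⊢

theorem rep_sigma (ha : HasType K (tySigma σ i) a) (hσ : HasName K σ (val (fst a)))
    (hi : HasName K (val (ap i (val (fst a)))) (val (snd a))) :
    Rep K (tySigma σ i) a z ↔
      z = opair (interp K σ (val (fst a))) (interp K (val (ap i (val (fst a)))) (val (snd a))) := by
  obtain ⟨⟨h1, -, h0⟩, h2, -, -⟩ := ha.sigma_elim
  constructor
  · intro h
    obtain ⟨a₀, a₁, τ, x, y, h₀, h₁, hτ, hx, hy, rfl⟩ := h.inv_sigma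
    obtain rfl := val_eq_of_mem h₀
    obtain rfl := val_eq_of_mem h₁
    obtain rfl := val_eq_of_mem hτ
    rw [(hσ _).1 hx, (hi _).1 hy]
  · rintro rfl
    exact .sigma σ i a _ _ _ _ _ ha (val_mem h1) (val_mem h2)
      (val_mem (ha.isType.sigma_inv.2.dom h0)) hσ.rep hi.rep

theorem rep_id (hc : HasType K (tyId σ a b) c) : Rep K (tyId σ a b) c z ↔ z = empty := by
  constructor
  · exact fun h => h.inv_id
  · rintro rfl
    exact .id σ a b c hc

theorem rep_w (hc : HasType K (tyW σ i) c) (hσ : HasName K σ (val (fst c)))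
    (hi : ∀ p, HasType K (val (ap i (val (fst c)))) p → HasName K (val (ap i (val (fst c)))) p)
    (hw : ∀ p, HasType K (val (ap i (val (fst c)))) p →
      HasName K (tyW σ i) (val (sndAp c p))) :
    Rep K (tyW σ i) c z ↔ z = opair (interp K σ (val (fst c)))
      (ofRel (SimAt K (val (ap i (val (fst c))))) fun p =>
        opair (interp K (val (ap i (val (fst c)))) p) (interp K (tyW σ i) (val (sndAp c p)))) := by
  obtain ⟨⟨h1, -, h0⟩, h2⟩ := hc.w_elim
  constructor
  · intro h
    obtain ⟨c₀, τ, x, y, y', h₀, hτ, hx, hy, hy', rfl⟩ := h.inv_w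
    obtain rfl := val_eq_of_mem h₀
    obtain rfl := val_eq_of_mem hτ
    rw [(hσ _).1 hx]
    congr 1
    refine ofRel_congr fun p q hpq => ?_
    have hp := hpq.left
    rw [← (hi p hp _).1 (hy p hp), ← (hw p hp _).1 (hy' p _ hp (val_mem (h2 p p hp).1))]
  · rintro rfl
    refine .w σ i c _ _ _ _ (fun p => interp K (tyW σ i) (val (sndAp c p))) hc (val_mem h1)
      (val_mem (hc.isType.w_inv.2.2.dom h0)) hσ.rep (fun p hp => (hi p hp).rep) fun p e hp he => ?_
    have := (hw p hp).rep
    rwa [val_eq_of_mem he] at this ⊢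

theorem HasType.hasName (h : HasType K σ a) : HasName K σ a := by
  suffices ∀ a, HasType K σ a → HasName K σ a from this a h
  refine IsType.induction (motive := fun σ => ∀ a, HasType K σ a → HasName K σ a)
    ?_ ?_ ?_ ?_ ?_ ?_ h.isType
  · intro n a ha
    rw [HasType, simAt_fin] at ha
    obtain ⟨m, hm, rfl, -⟩ := ha
    exact hasName_of_forall fun z => rep_fin hm
  · intro a ha
    rw [HasType, simAt_nat] at ha
    obtain ⟨m, rfl, -⟩ := ha
    exact hasName_of_forall fun z => rep_nat
  · exact fun σ i _ _ ihσ ihi f hf => hasName_of_forall fun z =>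
      rep_pi hf ihσ fun a ha => ihi a ha _ (hf.pi_elim ha).2.2.left
  · exact fun σ i _ _ ihσ ihi a ha => hasName_of_forall fun z =>
      rep_sigma ha (ihσ _ ha.sigma_elim.1.2.2.left) (ihi _ ha.sigma_elim.1.2.2.left _
        ha.sigma_elim.2.2.2.left)
  · exact fun σ a b _ _ _ _ c hc => hasName_of_forall fun z => rep_id hc
  · intro σ i _ _ _ ihσ ihi c hc
    refine SimAt.w_induction (motive := fun c _ => HasName K (tyW σ i) c) (fun c d hcd ih => ?_) hc
    have hc := hcd.left
    exact hasName_of_forall fun z => rep_w hc (ihσ _ hc.w_elim.1.2.2.left)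
      (ihi _ hc.w_elim.1.2.2.left) fun p hp => ih p p hp

theorem interp_fin {n m : ℕ} (h : m < n) : interp K (tyFin n : A) (num m) = dot m :=
  interp_eq_of_forall fun _ => rep_fin h

theorem interp_nat (m : ℕ) : interp K (tyNat : A) (num m) = dot m :=
  interp_eq_of_forall fun _ => rep_nat

theorem interp_pi (hf : HasType K (tyPi σ i) f) :
    interp K (tyPi σ i) f = ofRel (SimAt K σ) fun a =>
      opair (interp K σ a) (interp K (val (ap i a)) (val (ap f a))) :=
  interp_eq_of_forall fun _ => rep_pi hf (fun _ h => h.hasName) fun _ ha =>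
    (hf.pi_elim ha).2.2.left.hasName

theorem interp_sigma (ha : HasType K (tySigma σ i) a) : interp K (tySigma σ i) a =
    opair (interp K σ (val (fst a))) (interp K (val (ap i (val (fst a)))) (val (snd a))) :=
  interp_eq_of_forall fun _ =>
    rep_sigma ha ha.sigma_elim.1.2.2.left.hasName ha.sigma_elim.2.2.2.left.hasName

theorem interp_id (hc : HasType K (tyId σ a b) c) : interp K (tyId σ a b) c = empty :=
  interp_eq_of_forall fun _ => rep_id hc

/-- The graph of the branching function of `c`, of type `W_σ i`. -/
noncomputable def branch (K : Kind) (σ i c : A) : VExt A :=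
  ofRel (SimAt K (val (ap i (val (fst c))))) fun p =>
    opair (interp K (val (ap i (val (fst c)))) p) (interp K (tyW σ i) (val (sndAp c p)))

theorem interp_w (hc : HasType K (tyW σ i) c) :
    interp K (tyW σ i) c = opair (interp K σ (val (fst c))) (branch K σ i c) :=
  interp_eq_of_forall fun _ => rep_w hc hc.w_elim.1.2.2.left.hasName (fun _ h => h.hasName)
    fun p hp => (hc.w_elim.2 p p hp).2.2.left.hasName

/-- Names are literally equal, not just equal up to a realizer, because a name for a function or a
tree lists the whole relation on its domain and depends on values only up to `∼`. The induction
follows the derivation of `σ ∼ τ`, with an inner induction on trees for `W`. -/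
theorem interp_congr (hab : SimAt K σ a b) (h : Sim K σ τ) : interp K σ a = interp K τ b := by
  have hB := h.ts
  generalize hC : SimAt K σ = B at hab hB
  clear hC h
  induction hB generalizing a b with
  | fin n =>
    obtain ⟨m, hm, rfl, rfl⟩ := hab
    rfl
  | nat =>
    obtain ⟨m, rfl, rfl⟩ := hab
    rfl
  | pi σ τ i j B F hB hdom hF ihB ihF =>
    have hT := hB.mk_pi (famRel_iff.2 ⟨hdom, hF⟩)
    rw [← hT.simAt_eq] at hab
    have hb := hab.right
    rw [HasType, Sim.simAt_eq ⟨_, hT⟩] at hb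
    rw [interp_pi hab.left, interp_pi hb, ← Sim.simAt_eq ⟨_, hB⟩]
    refine ofRel_congr fun c d hcd => ?_
    have hcc := hcd.left
    obtain ⟨h1, h2, h3⟩ := hab.pi_elim hcc
    have hB' : B c c := by rw [← hB.simAt_eq]; exact hcc
    have hd := hdom c c hB'
    rw [(hF c c _ _ hB' (val_mem hd.1) (val_mem hd.2)).simAt_eq] at h3
    rw [ihB hB', ihF c c _ _ hB' (val_mem hd.1) (val_mem hd.2) h3]
  | sigma σ τ i j B F hB hdom hF ihB ihF =>
    have hT := hB.mk_sigma (famRel_iff.2 ⟨hdom, hF⟩)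
    rw [← hT.simAt_eq] at hab
    have hb := hab.right
    rw [HasType, Sim.simAt_eq ⟨_, hT⟩] at hb
    rw [interp_sigma hab.left, interp_sigma hb]
    obtain ⟨⟨-, -, h1⟩, -, -, h2⟩ := hab.sigma_elim
    rw [hB.simAt_eq] at h1
    have hd := hdom _ _ h1
    rw [ihB h1, ihF _ _ _ _ h1 (val_mem hd.1) (val_mem hd.2)]
    rwa [← (hF _ _ _ _ h1 (val_mem hd.1) (val_mem hd.2)).simAt_eq]
  | id hK σ τ a a' b b' B hB ha hb ihB =>
    have hT := TS.id hK _ _ _ _ _ _ _ hB ha hb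
    rw [← hT.simAt_eq] at hab
    have hb := hab.right
    rw [HasType, Sim.simAt_eq ⟨_, hT⟩] at hb
    rw [interp_id hab.left, interp_id hb]
  | w hK σ τ i j B F hB hdom hF ihB ihF =>
    have hT := hB.mk_w hK (famRel_iff.2 ⟨hdom, hF⟩)
    rw [← hT.simAt_eq] at hab
    refine SimAt.w_induction (motive := fun a b => interp K (tyW σ i) a = interp K (tyW τ j) b)
      (fun c d hab ih => ?_) hab
    have hb := hab.right
    rw [HasType, Sim.simAt_eq ⟨_, hT⟩] at hb
    rw [interp_w hab.left, interp_w hb]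
    obtain ⟨⟨-, -, h1⟩, h2⟩ := hab.w_elim
    rw [hB.simAt_eq] at h1
    have hd := hdom _ _ h1
    have hF' := hF _ _ _ _ h1 (val_mem hd.1) (val_mem hd.2)
    rw [ihB h1, branch, branch, ← Sim.simAt_eq ⟨_, hF'⟩]
    congr 1
    refine ofRel_congr fun p q hpq => ?_
    have hpp := hpq.left
    rw [ih p p hpp, ihF _ _ _ _ h1 (val_mem hd.1) (val_mem hd.2)]
    rwa [← hF'.simAt_eq]

theorem X_eq (K : Kind) (σ : A) : X K σ = ofRel (SimAt K σ) (interp K σ) := rfl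

theorem X_congr (h : Sim K σ τ) : X K σ = X K τ := by
  rw [X_eq, X_eq, h.simAt_eq]
  exact ofRel_congr fun a b hab => interp_congr (h.simAt_eq ▸ hab.left) h

/-- Elements of `σ` in the product pca. -/
def InTy (K : Kind) (σ : A) (p : A × A) : Prop := SimAt K σ p.1 p.2

theorem enum_X (K : Kind) (σ : A) : Enum (X K σ) (InTy K σ) fun p => interp K σ p.1 :=
  enum_ofRel _ _

theorem enum_F (hi : IsFamily K σ i) : Enum (F K σ i) (InTy K σ)
    fun p => opair (interp K σ p.1) (X K (val (ap i p.1))) := by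
  intro p z
  constructor
  · rintro ⟨⟨⟨a, b, τ⟩, hq, hτ⟩, rfl, rfl⟩
    have hτ : τ ∈ ap i a := hτ
    obtain rfl := val_eq_of_mem hτ
    exact ⟨hq, rfl⟩
  · rintro ⟨hp, rfl⟩
    exact ⟨⟨⟨p.1, p.2, val (ap i p.1)⟩, hp, val_mem (hi.dom hp)⟩, rfl, rfl⟩

end Names

end ExtRealizability

namespace ExtRealizability

/-! ## Injectivity of canonical names -/

section Injectivity

open VExt

variable {A : Type u} [PCA A] {K : Kind} {σ τ ρ i j a b c d f g : A} {s t : Part (A × A)}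
  {x y z : VExt A} {p q : A × A}

theorem el_dot {n : ℕ} : El (dot n) p z ↔ ∃ m < n, p = num m ∧ z = dot m := by
  rw [dot]
  constructor
  · rintro ⟨⟨m⟩, rfl, rfl⟩
    exact ⟨m, m.2, rfl, rfl⟩
  · rintro ⟨m, hm, rfl, rfl⟩
    exact ⟨⟨⟨m, hm⟩⟩, rfl, rfl⟩

theorem tr_mem_dot {n : ℕ} : Tr s (.mem z (dot n)) ↔
    ∃ m < n, pfst s = Part.some (num m) ∧ Tr (psnd s) (.eq z (dot m)) := by
  rw [tr_mem]
  constructor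
  · rintro ⟨p, w, hw, h1, h2⟩
    obtain ⟨m, hm, rfl, rfl⟩ := el_dot.1 hw
    exact ⟨m, hm, h1, h2⟩
  · rintro ⟨m, hm, h1, h2⟩
    exact ⟨_, _, el_dot.2 ⟨m, hm, rfl, rfl⟩, h1, h2⟩

/-- If, say, `n < m`, then `dot n` is an element of `dot m`, hence of itself; so it equals `dot k`
for some `k < n`, against the induction hypothesis. -/
theorem Tr.dot_inj {n m : ℕ} (h : Tr s (.eq (dot n) (dot m))) : n = m := by
  induction n using Nat.strong_induction_on generalizing m s with
  | _ n ih =>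
    rcases lt_trichotomy n m with hlt | heq | hlt
    · obtain ⟨k, hk, -, h⟩ := tr_mem_dot.1 (h.eq_right (el_dot.2 ⟨n, hlt, rfl, rfl⟩))
      exact absurd (ih k hk h.symm) hk.ne
    · exact heq
    · obtain ⟨k, hk, -, h⟩ := tr_mem_dot.1 (h.eq_left (el_dot.2 ⟨m, hlt, rfl, rfl⟩))
      exact absurd (ih m hlt h) hk.ne'

theorem IsFamily.interp_congr (hi : IsFamily K σ i) (hab : SimAt K σ a b)
    (hc : SimAt K (val (ap i a)) c d) :
    interp K (val (ap i a)) c = interp K (val (ap i b)) d :=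
  ExtRealizability.interp_congr hc (hi.sim hab)

theorem IsFamily.simAt_eq (hi : IsFamily K σ i) (hab : SimAt K σ a b) :
    SimAt K (val (ap i a)) = SimAt K (val (ap i b)) := (hi.sim hab).simAt_eq

theorem enum_interp_pi (hf : HasType K (tyPi σ i) f) : Enum (interp K (tyPi σ i) f) (InTy K σ)
    fun p => opair (interp K σ p.1) (interp K (val (ap i p.1)) (val (ap f p.1))) := by
  rw [interp_pi hf]
  exact enum_ofRel _ _

theorem enum_branch (K : Kind) (σ i c : A) :
    Enum (branch K σ i c) (InTy K (val (ap i (val (fst c)))))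
      fun p => opair (interp K (val (ap i (val (fst c)))) p.1)
        (interp K (tyW σ i) (val (sndAp c p.1))) :=
  enum_ofRel _ _

/-- Realizability of `a^σ = b^σ` implies `a ∼_σ b`. -/
theorem Tr.simAt (h : Tr s (.eq (interp K σ a) (interp K σ b))) (ha : HasType K σ a)
    (hb : HasType K σ b) : SimAt K σ a b := by
  suffices ∀ a b s, HasType K σ a → HasType K σ b → Tr s (.eq (interp K σ a) (interp K σ b)) →
    SimAt K σ a b from this a b s ha hb h
  refine IsType.induction (motive := fun σ => ∀ a b s, HasType K σ a → HasType K σ b →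
    Tr s (.eq (interp K σ a) (interp K σ b)) → SimAt K σ a b) ?_ ?_ ?_ ?_ ?_ ?_ ha.isType
  · intro n a b s ha hb h
    rw [HasType, simAt_fin] at ha hb
    obtain ⟨m, hm, rfl, -⟩ := ha
    obtain ⟨m', hm', rfl, -⟩ := hb
    rw [interp_fin hm, interp_fin hm'] at h
    rw [simAt_fin]
    exact ⟨m, hm, rfl, by rw [h.dot_inj]⟩
  · intro a b s ha hb h
    rw [HasType, simAt_nat] at ha hb
    obtain ⟨m, rfl, -⟩ := ha
    obtain ⟨m', rfl, -⟩ := hb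
    rw [interp_nat, interp_nat] at h
    rw [simAt_nat]
    exact ⟨m, rfl, by rw [h.dot_inj]⟩
  · intro σ i hσ hi ihσ ihi f g s hf hg h
    rw [hσ.simAt_pi hi]
    intro a b hab
    -- The entry of `f` at `a` is matched with an entry of `g` at some `q`. Injectivity for `σ`
    -- gives `a ∼ q.1`, and injectivity for `i a` relates the value of `f` at `a` to that of `g` at
    -- `q.1`, hence to that of `g` at `b`.
    obtain ⟨q, hq, -, h1⟩ := (enum_interp_pi hg).tr_mem.1
      (h.eq_left ((enum_interp_pi hf).el (p := (a, b)) hab))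
    have haq := ihσ _ _ _ hab.left (SimAt.left hq) h1.opair_inj_left
    obtain ⟨-, hgb, h2⟩ := hg.pi_elim (haq.symm.trans hab)
    obtain ⟨hfa, -, h3⟩ := hf.pi_elim hab.left
    rw [← hi.simAt_eq haq] at h2
    have h4 := h1.opair_inj_right
    rw [← hi.interp_congr haq h2.left] at h4
    exact both_val.2 ⟨hfa, hgb, (ihi a hab.left _ _ _ h3 h2.left h4).trans h2⟩
  · intro σ i hσ hi ihσ ihi a b s ha hb h
    rw [interp_sigma ha, interp_sigma hb] at h
    obtain ⟨⟨ha1, -, ha2⟩, ha3, -, ha4⟩ := ha.sigma_elim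
    obtain ⟨⟨hb1, -, hb2⟩, hb3, -, hb4⟩ := hb.sigma_elim
    have h0 := ihσ _ _ _ ha2 hb2 h.opair_inj_left
    have h1 := h.opair_inj_right
    rw [← hi.simAt_eq h0] at hb4
    rw [← hi.interp_congr h0 hb4] at h1
    rw [hσ.simAt_sigma hi]
    exact ⟨_, val_mem ha1, _, val_mem hb1, h0, both_val.2 ⟨ha3, hb3, ihi _ ha2 _ _ _ ha4 hb4 h1⟩⟩
  -- Elements of an identity type are all `0`.
  · intro σ a b hK ha hb _ c d s hc hd _
    rw [HasType, ha.simAt_id hK hb] at hc hd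
    rw [ha.simAt_id hK hb]
    exact ⟨hc.1, hd.1, hc.2.2⟩
  · intro σ i hK hσ hi ihσ ihi a b s ha hb h
    refine SimAt.w_induction (motive := fun c _ => ∀ b s, HasType K (tyW σ i) b →
      Tr s (.eq (interp K (tyW σ i) c) (interp K (tyW σ i) b)) → SimAt K (tyW σ i) c b)
      (fun c _ hc ih b s hb h => ?_) ha b s hb h
    replace hc := hc.left
    rw [interp_w hc, interp_w hb] at h
    obtain ⟨⟨hc1, -, hc2⟩, hc3⟩ := hc.w_elim
    obtain ⟨⟨hb1, -, hb2⟩, hb3⟩ := hb.w_elim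
    have h0 := ihσ _ _ _ hc2 hb2 h.opair_inj_left
    refine .w_intro hK hi hc1 hb1 h0 fun p q hpq => ?_
    -- As for `Π`: the branch of `c` at `p` is matched with a branch of `b` at some `r ∼ p`, and the
    -- inner induction hypothesis compares the two subtrees.
    obtain ⟨r, hr, -, h1⟩ := (enum_branch K σ i b).tr_mem.1
      (h.opair_inj_right.eq_left ((enum_branch K σ i c).el (p := (p, q)) hpq))
    have hr' : SimAt K (val (ap i (val (fst c)))) r.1 r.2 := by rwa [hi.simAt_eq h0]
    have h2 := h1.opair_inj_left
    rw [← hi.interp_congr h0 hr'.left] at h2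
    have hpr := ihi _ hc2 _ _ _ hpq.left hr'.left h2
    obtain ⟨hb4, hb5, hb6⟩ := hb3 r.1 q (by rw [← hi.simAt_eq h0]; exact hpr.symm.trans hpq)
    exact ⟨(hc3 p p hpq.left).1, hb5,
      (ih p p hpq.left _ _ hb6.left h1.opair_inj_right).trans hb6⟩

/-- Injectivity of names enters through `inj`: realized equality of arguments gives `a ∼_σ b`, hence
`i a ∼ i b`, and `X` depends only on the class of a type. -/
theorem isGraph_F (hi : IsFamily K σ i) : IsGraph (F K σ i) (InTy K σ) (fun p => interp K σ p.1)
    fun p => X K (val (ap i p.1)) where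
  enum := enum_F hi
  inj _ _ _ hp hq h := X_congr (hi.sim (h.simAt (SimAt.left hp) (SimAt.left hq)))

theorem isGraph_interp_pi (hf : HasType K (tyPi σ i) f) :
    IsGraph (interp K (tyPi σ i) f) (InTy K σ) (fun p => interp K σ p.1)
      fun p => interp K (val (ap i p.1)) (val (ap f p.1)) where
  enum := enum_interp_pi hf
  inj _ _ _ hp hq h := by
    have hpq := h.simAt (SimAt.left hp) (SimAt.left hq)
    exact hf.isType.pi_inv.2.interp_congr hpq (hf.pi_elim hpq).2.2

theorem isGraph_branch (hc : HasType K (tyW σ i) c) :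
    IsGraph (branch K σ i c) (InTy K (val (ap i (val (fst c)))))
      (fun p => interp K (val (ap i (val (fst c)))) p.1)
      fun p => interp K (tyW σ i) (val (sndAp c p.1)) where
  enum := enum_branch K σ i c
  inj _ _ _ hp hq h := by
    have hpq := h.simAt (SimAt.left hp) (SimAt.left hq)
    exact interp_congr (hc.w_elim.2 _ _ hpq).2.2 ⟨_, hc.isType.ts⟩

end Injectivity

end ExtRealizability

namespace ExtRealizability

/-! ## The realizers -/

section Realizers

open OTerm VExt

theorem not_el_empty {A : Type u} {p : A × A} {w : VExt A} : ¬ El empty p w := by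
  rintro ⟨i, -⟩
  exact i.elim

variable {A : Type u} [PCA A] {K : Kind} {σ i a b : A} {s : Part (A × A)} {x y z w : VExt A}
  {p q : A × A}

theorem eval_k : CTerm.k.eval (A × A) = Part.some PCA.k := rfl

/-- A triple in `x` always produces a realizer of the membership of its third component, namely its
index paired with reflexivity, and the formula refutes this. -/
theorem not_tr_mem_of_isEmpty (h : Tr s (.isEmpty x)) : ¬ El x p w := by
  intro hw
  rw [Fml.isEmpty, tr_allB] at h
  have := h.2 p w hw
  rw [tr_neg] at this
  refine this.2 (pairVal (fun _ => p) (var 0) (con reflC)) (tr_mem.2 ⟨p, w, hw, ?_, ?_⟩)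
  · simp
  · simpa using tr_refl w

theorem tr_isEmpty (hs : s.Dom) (h : ∀ p w, ¬ El x p w) : Tr s (.isEmpty x) := by
  rw [Fml.isEmpty, tr_allB]
  exact ⟨hs, fun p w hw => absurd hw (h p w)⟩

theorem tr_eq_empty (hs : s.Dom) (h : ∀ p w, ¬ El x p w) (h' : ∀ p w, ¬ El y p w) :
    Tr s (.eq x y) :=
  tr_eq.2 ⟨hs, fun p w hw => absurd hw (h p w), fun p w hw => absurd hw (h' p w)⟩

theorem not_el_of_tr_eq (h : Tr s (.eq x y)) (hy : ∀ p w, ¬ El y p w) : ¬ El x p w := by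
  intro hw
  obtain ⟨q, w', hw', -⟩ := tr_mem.1 (h.eq_left hw)
  exact hy _ _ hw'

theorem not_el_dot_zero : ¬ El (dot 0 : VExt A) p w := by
  rw [el_dot]
  rintro ⟨m, hm, -⟩
  exact absurd hm (Nat.not_lt_zero m)

theorem tr_mem_X_nat : Tr s (.mem z (X K (tyNat : A))) ↔
    ∃ n, pfst s = Part.some (num n) ∧ Tr (psnd s) (.eq z (dot n)) := by
  rw [(enum_X K tyNat).tr_mem]
  constructor
  · rintro ⟨p, hp, h1, h2⟩
    rw [InTy, simAt_nat] at hp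
    obtain ⟨m, h3, h4⟩ := hp
    obtain rfl : p = num m := Prod.ext h3 h4
    rw [show (num m : A × A).1 = num m from rfl, interp_nat] at h2
    exact ⟨m, h1, h2⟩
  · rintro ⟨n, h1, h2⟩
    refine ⟨num n, ?_, h1, ?_⟩
    · rw [InTy, simAt_nat]
      exact ⟨n, rfl, rfl⟩
    · rwa [show (num n : A × A).1 = num n from rfl, interp_nat]

/-- Realizer of `y = n + 1 → isSucc y n`, from `n + 1` and a realizer of the premise. -/
def isSuccC : CTerm :=
  let l := tfst (var 1 ⬝ var 2)
  let n := con .pred ⬝ var 0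
  (lam 0 (lam 1 (lpair
    (lam 2 (ite (tfst l) n (lpair (con .one) (tsnd l)) (lpair (con .zero) l)))
    (lpair (lam 2 (tsnd (var 1 ⬝ var 2))) (tsnd (var 1 ⬝ n)))))).close

theorem Tr.isSucc {n : ℕ} (h : Tr s (.eq y (dot (n + 1)))) :
    Tr (isSuccC.eval _ ⋄ Part.some (num (n + 1)) ⋄ s) (.isSucc y (dot n)) := by
  obtain ⟨a, rfl⟩ := h.exists_some
  rw [Fml.isSucc, tr_and, tr_and, tr_allB, tr_allB]
  refine ⟨⟨by simp [isSuccC], fun p w hw => ?_⟩, ⟨by simp [isSuccC], fun p w hw => ?_⟩, ?_⟩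
  · rw [tr_or]
    have h1 := h.eq_left hw
    obtain ⟨m, hm, h2, h3⟩ := tr_mem_dot.1 h1
    simp only [isSuccC, eval_close, eval_lam, clo_pap, eval_lpair, pfst_pairVal]
    rw [eval_ite (n := m) (m := n) _ _ _ (by simpa [upd] using h2)
      (by simpa [upd] using eval_pred_pap n)]
    split
    · next heq =>
      subst heq
      exact .inr ⟨by simp, by simpa [upd] using h3⟩
    -- An index below `n + 1` other than `n` lies below `n`, so the realizer of membership in `dot
    -- (n + 1)` already realizes membership in `dot n`.
    · refine .inl ⟨by simp, ?_⟩
      have : Tr (pfst (Part.some a ⋄ Part.some p)) (.mem w (dot n)) :=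
        tr_mem_dot.2 ⟨m, by omega, h2, h3⟩
      simpa [upd] using this
  · obtain ⟨m, hm, rfl, rfl⟩ := el_dot.1 hw
    simpa [isSuccC, upd] using h.eq_right (el_dot.2 ⟨m, hm.trans (Nat.lt_succ_self n), rfl, rfl⟩)
  · simpa [isSuccC, upd, eval_pred_pap] using
      h.eq_right (el_dot.2 ⟨n, Nat.lt_succ_self n, rfl, rfl⟩)

/-- Realizer of `isSucc y n → y = n + 1`. -/
def ofIsSuccC : CTerm :=
  let m := tfst (var 1) ⬝ var 2
  (lam 0 (lam 1 (lam 2 (lpair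
    (ite (tfst m) (con .zero) (tsnd m) (lpair (var 0) (tsnd m)))
    (ite (var 2) (var 0) (tsnd (tsnd (var 1))) (tfst (tsnd (var 1)) ⬝ var 2)))))).close

theorem Tr.of_isSucc {n : ℕ} (h : Tr s (.isSucc y (dot n))) :
    Tr (ofIsSuccC.eval _ ⋄ Part.some (num n) ⋄ s) (.eq y (dot (n + 1))) := by
  obtain ⟨a, rfl⟩ := h.exists_some
  rw [Fml.isSucc, tr_and, tr_and, tr_allB, tr_allB] at h
  obtain ⟨⟨-, h1⟩, ⟨-, h2⟩, h3⟩ := h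
  rw [tr_eq]
  refine ⟨by simp [ofIsSuccC], fun p w hw => ?_, fun p w hw => ?_⟩
  · have h4 := h1 p w hw
    rw [tr_or] at h4
    obtain ⟨h4, h5⟩ | ⟨h4, h5⟩ := h4
    · obtain ⟨m, hm, h6, h7⟩ := tr_mem_dot.1 h5
      exact tr_mem_dot.2 ⟨m, by omega, by simpa [ofIsSuccC, upd, eval_ite_zero, h4] using h6,
        by simpa [ofIsSuccC, upd, eval_ite_zero, h4] using h7⟩
    · exact tr_mem_dot.2 ⟨n, by omega, by simp [ofIsSuccC, upd, eval_ite_one, h4],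
        by simpa [ofIsSuccC, upd, eval_ite_one, h4] using h5⟩
  · obtain ⟨m, hm, rfl, rfl⟩ := el_dot.1 hw
    simp only [ofIsSuccC, eval_close, eval_lam, clo_pap, eval_lpair, psnd_pairVal]
    rw [eval_ite (n := m) (m := n) _ _ _ (by simp [upd]) (by simp [upd])]
    split
    · next heq =>
      subst heq
      simpa [upd] using h3
    · simpa [upd] using h2 _ _ (el_dot.2 ⟨m, by omega, rfl, rfl⟩)

/-- Realizer of `X_N = ω`. -/
def omegaC : CTerm :=
  let n := tfst (tsnd (var 0))
  (lpair
    (lam 0 (ite (tfst (var 0)) (con .zero) (lpair (con .zero) (con .k))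
      (lpair (con .one) (lpair (con .pred ⬝ tfst (var 0))
        (con isSuccC ⬝ tfst (var 0) ⬝ tsnd (var 0))))))
    (lam 0 (ite (tfst (var 0)) (con .zero) (lpair (con .zero) (con .k))
      (lpair (con .succ ⬝ n) (con ofIsSuccC ⬝ n ⬝ tsnd (tsnd (var 0))))))).close

/-- The index of an element of `X_N` is its numeral, so testing it against zero decides the
disjunction. In the other direction the tag of the disjunction and the index supplied by the bounded
quantifier determine the numeral. -/
theorem tr_omega (K : Kind) : Tr (omegaC.eval _) (.isOmega (X K (tyNat : A))) := by
  simp only [Fml.isOmega, tr_all, tr_iff, tr_imp]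
  refine fun y => ⟨⟨by simp [omegaC], fun v hv => ?_⟩, by simp [omegaC], fun v hv => ?_⟩
  · rw [tr_mem_X_nat] at hv
    rw [tr_or]
    obtain ⟨n, h1, h2⟩ := hv
    rcases n with - | n
    · refine .inl ⟨by simp [omegaC, upd, eval_ite_zero, h1], ?_⟩
      refine tr_isEmpty ?_ fun p w => not_el_of_tr_eq h2 fun _ _ => not_el_dot_zero
      simp [omegaC, upd, eval_ite_zero, h1, eval_k]
    · have hite : ∀ t r, (ite (tfst (var 0)) (con .zero) t r).eval (upd (fun _ => PCA.k) 0 v) =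
        r.eval (upd (fun _ => PCA.k) 0 v) := fun t r =>
          eval_ite_succ _ (n := n) t r (by simpa [upd] using h1)
      refine .inr ⟨by simp [omegaC, hite], ?_⟩
      rw [tr_exB]
      refine ⟨num n, dot n, ?_, ?_, ?_⟩
      · rw [enum_X K tyNat _ _, InTy, simAt_nat]
        exact ⟨⟨n, rfl, rfl⟩, (interp_nat n).symm⟩
      · simp [omegaC, hite, upd, h1, eval_pred_pap]
      · simpa [omegaC, hite, upd, h1] using h2.isSucc
  · rw [tr_mem_X_nat]
    rw [tr_or, tr_exB] at hv
    obtain ⟨h1, h2⟩ | ⟨h1, p, z, hz, h2, h3⟩ := hv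
    · refine ⟨0, by simp [omegaC, upd, eval_ite_zero, h1], ?_⟩
      refine tr_eq_empty ?_ (fun _ _ => not_tr_mem_of_isEmpty h2) fun _ _ => not_el_dot_zero
      simp [omegaC, upd, eval_ite_zero, h1, eval_k]
    · rw [enum_X K tyNat _ _, InTy, simAt_nat] at hz
      obtain ⟨⟨n, h4, h5⟩, rfl⟩ := hz
      obtain rfl : p = num n := Prod.ext h4 h5
      have h3 : Tr _ (Fml.isSucc y (interp K tyNat (num n))) := h3
      rw [interp_nat] at h3
      exact ⟨n + 1, by simp [omegaC, upd, eval_ite_one, h1, h2, eval_succ_pap],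
        by simpa [omegaC, upd, eval_ite_one, h1, h2] using h3.of_isSucc⟩

/-- Realizer of `F_{σ,i} is a function ∧ dom(F_{σ,i}) = X_σ`. -/
def functionC : CTerm :=
  (lpair (con isFunC ⬝ con reflC) (con hasDomC ⬝ con reflC ⬝ con reflC)).close

theorem tr_function (hi : IsFamily K σ i) :
    Tr (functionC.eval _) ((Fml.isFun (F K σ i)).and (Fml.hasDom (F K σ i) (X K σ))) := by
  have h := isGraph_F hi
  rw [tr_and]
  constructor
  · simpa [functionC] using (tr_refl _).isFun h
  · simpa [functionC] using (tr_refl _).hasDom (tr_refl _) h (enum_X K σ)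

theorem some_pap_val {g p : A × A} (h1 : (ap g.1 p.1).Dom) (h2 : (ap g.2 p.2).Dom) :
    Part.some g ⋄ Part.some p = Part.some (val (ap g.1 p.1), val (ap g.2 p.2)) := by
  rw [pap_prod]
  exact pprod_eq_some.2 ⟨val_mem h1, val_mem h2⟩

theorem val_of_some_pap {g p r : A × A} (h : Part.some g ⋄ Part.some p = Part.some r) :
    ap g.1 p.1 = Part.some r.1 ∧ ap g.2 p.2 = Part.some r.2 := by
  rw [pap_prod, pprod_eq_some] at h
  exact ⟨Part.eq_some_iff.2 h.1, Part.eq_some_iff.2 h.2⟩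

theorem val_some (a : A) : val (Part.some a) = a := val_eq_of_mem (Part.mem_some a)

theorem tr_mem_X_self {τ : A} (hp : InTy K τ p) (h1 : pfst s = Part.some p)
    (h2 : psnd s = reflC.eval _) : Tr s (.mem (interp K τ p.1) (X K τ)) :=
  (enum_X K τ).tr_mem.2 ⟨p, hp, h1, h2 ▸ tr_refl _⟩

/-- Realizer of `X_{Π_σ i} = Π(X_σ, F_{σ,i})`. -/
def prodC : CTerm :=
  let e := tsnd (var 0)
  let t := tsnd (tsnd (var 0)) ⬝ var 1
  (lpair
    (lam 0 (lpair (con isFunC ⬝ e) (lpair (con hasDomC ⬝ e ⬝ con reflC)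
      (lam 1 (lpair (con pairMemC ⬝ tsnd (e ⬝ var 1))
        (con memValC ⬝ var 1 ⬝ lpair (tfst (var 0) ⬝ var 1) (con reflC)))))))
    (lam 0 (lpair (lam 1 (tfst (con ofMemValC ⬝ tsnd t)))
      (con funEqC ⬝ tfst (var 0) ⬝ tfst (tsnd (var 0)) ⬝ con reflC ⬝
        lam 1 (lpair (tfst t) (tsnd (con ofMemValC ⬝ tsnd t))))))).close

/-- A realizer of `f ∈ Π(X, F)` contains a procedure sending `a` to the index of the value of `f` at
`a^σ`. This procedure is the required element of `Π_σ i`, and `f` equals its name because both are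
functions with the same domain and values. -/
theorem tr_prod (hσ : IsType K σ) (hi : IsFamily K σ i) :
    Tr (prodC.eval _) (.isPi (X K (tyPi σ i)) (X K σ) (F K σ i)) := by
  simp only [Fml.isPi, tr_all, tr_iff, tr_imp]
  refine fun f => ⟨⟨by simp [prodC], fun v hv => ?_⟩, by simp [prodC], fun v hv => ?_⟩
  · obtain ⟨g, hg, h1, h2⟩ := (enum_X K _).tr_mem.1 hv
    have hgr := isGraph_interp_pi (SimAt.left hg)
    rw [Fml.memPi, tr_and, tr_and, tr_allB]
    refine ⟨by simpa [prodC, upd] using h2.isFun hgr,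
      by simpa [prodC, upd] using h2.hasDom (tr_refl _) hgr (enum_X K σ), by simp [prodC], ?_⟩
    intro p z hz
    obtain ⟨hp, rfl⟩ := (enum_X K σ p z).1 hz
    rw [tr_ex]
    refine ⟨interp K (val (ap i p.1)) (val (ap g.1 p.1)), ?_⟩
    rw [tr_and]
    refine ⟨by simpa [prodC, upd] using (h2.eq_right (hgr.enum.el hp)).pairMem, ?_⟩
    obtain ⟨h3, h4, h5⟩ := SimAt.pi_elim hg hp
    simp only [prodC, eval_close, eval_lam, clo_pap, eval_lpair, pfst_pairVal, psnd_pairVal,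
      eval_app, eval_var, eval_con]
    refine Tr.memVal (iy := fun p => X K (val (ap i p.1))) (enum_F hi) hp ?_
    refine tr_mem_X_self (p := (val (ap g.1 p.1), val (ap g.2 p.2))) h5 ?_ ?_
    · simp [upd, h1, some_pap_val h3 h4]
    · simp
  · rw [Fml.memPi, tr_and, tr_and, tr_allB] at hv
    obtain ⟨h1, h2, -, h3⟩ := hv
    -- The value of `f` at the argument with index `p` lies in `X_{i p}`, so it has an index `r`
    -- there, computed by the realizer.
    have h4 : ∀ p, InTy K σ p → ∃ y r, InTy K (val (ap i p.1)) r ∧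
        Tr (pfst (psnd (psnd (Part.some v)) ⋄ Part.some p)) (.pairMem (interp K σ p.1) y f) ∧
        pfst (ofMemValC.eval _ ⋄ psnd (psnd (psnd (Part.some v)) ⋄ Part.some p)) = Part.some r ∧
        Tr (psnd (ofMemValC.eval _ ⋄ psnd (psnd (psnd (Part.some v)) ⋄ Part.some p)))
          (.eq y (interp K (val (ap i p.1)) r.1)) := by
      intro p hp
      have h4 := h3 _ _ ((enum_X K σ).el hp)
      simp only [tr_ex, tr_and] at h4
      obtain ⟨y, h5, h6⟩ := h4
      obtain ⟨r, hr, h7, h8⟩ := (enum_X K _).tr_mem.1 (h6.of_memVal (isGraph_F hi) hp)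
      exact ⟨y, r, hr, h5, h7, h8⟩
    simp only [prodC, eval_close, eval_lam, clo_pap, eval_lpair, psnd_pairVal]
    rw [(enum_X K _).tr_mem]
    simp only [pfst_pairVal, psnd_pairVal, eval_lam]
    generalize hg : clo (P := A × A) _ _ _ = g
    have h5 : ∀ p, Part.some g ⋄ Part.some p =
        pfst (ofMemValC.eval _ ⋄ psnd (psnd (psnd (Part.some v)) ⋄ Part.some p)) := by
      intro p
      simp [← hg, upd]
    clear hg
    -- Applying `g` in `A × A` to a related pair `(a, b)` gives an index `r` in the fibre, and its
    -- two components are related by definition of `X`.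
    have hgT : InTy K (tyPi σ i) g := by
      rw [InTy, hσ.simAt_pi hi]
      intro a b hab
      obtain ⟨y, r, hr, -, h6, -⟩ := h4 (a, b) hab
      rw [← h5] at h6
      obtain ⟨h7, h8⟩ := val_of_some_pap h6
      rw [h7, h8]
      exact ⟨_, Part.mem_some _, _, Part.mem_some _, hr⟩
    refine ⟨g, hgT, rfl, ?_⟩
    simp only [eval_app, eval_con, eval_fst, eval_snd, eval_var, eval_lam]
    refine Tr.fun_eq (D' := X K σ) (by simpa [upd] using h1) (by simpa [upd] using h2) (tr_refl _)
      (fun p hp => ?_) (enum_interp_pi (SimAt.left hgT)) (enum_X K σ)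
    obtain ⟨y, r, hr, h6, h7, h8⟩ := h4 p hp
    refine ⟨y, by simpa [upd] using h6, ?_⟩
    rw [← h5] at h7
    rw [(val_of_some_pap h7).1, val_some]
    simpa [upd] using h8

/-- Realizer of `X_{Σ_σ i} = Σ(X_σ, F_{σ,i})`. -/
def sumC : CTerm :=
  let c := tfst (var 0)
  let m := con ofMemValC ⬝ tsnd (tsnd (var 0))
  (lpair
    (lam 0 (lpair (tfst c) (lpair (con isPairC ⬝ tsnd (var 0))
      (con memValC ⬝ tfst c ⬝ lpair (tsnd c) (con reflC)))))
    (lam 0 (lpair (lpair (tfst (var 0)) (tfst m))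
      (con transC ⬝ (con ofIsPairC ⬝ tfst (tsnd (var 0))) ⬝
        (con opairCongrC ⬝ con reflC ⬝ tsnd m))))).close

theorem pfst_some_val {c : A × A} (h1 : (fst c.1).Dom) (h2 : (fst c.2).Dom) :
    pfst (Part.some c) = Part.some (val (fst c.1), val (fst c.2)) := by
  rw [pfst_prod]
  exact pprod_eq_some.2 ⟨val_mem h1, val_mem h2⟩

theorem psnd_some_val {c : A × A} (h1 : (snd c.1).Dom) (h2 : (snd c.2).Dom) :
    psnd (Part.some c) = Part.some (val (snd c.1), val (snd c.2)) := by
  rw [psnd_prod]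
  exact pprod_eq_some.2 ⟨val_mem h1, val_mem h2⟩

theorem fst_of_pfst {c r : A × A} (h : pfst (Part.some c) = Part.some r) :
    fst c.1 = Part.some r.1 ∧ fst c.2 = Part.some r.2 := by
  rw [pfst_prod, pprod_eq_some] at h
  exact ⟨Part.eq_some_iff.2 h.1, Part.eq_some_iff.2 h.2⟩

theorem snd_of_psnd {c r : A × A} (h : psnd (Part.some c) = Part.some r) :
    snd c.1 = Part.some r.1 ∧ snd c.2 = Part.some r.2 := by
  rw [psnd_prod, pprod_eq_some] at h
  exact ⟨Part.eq_some_iff.2 h.1, Part.eq_some_iff.2 h.2⟩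

theorem tr_sum (hσ : IsType K σ) (hi : IsFamily K σ i) :
    Tr (sumC.eval _) (.isSigma (X K (tySigma σ i)) (X K σ) (F K σ i)) := by
  simp only [Fml.isSigma, tr_all, tr_iff, tr_imp]
  refine fun z => ⟨⟨by simp [sumC], fun v hv => ?_⟩, by simp [sumC], fun v hv => ?_⟩
  · obtain ⟨c, hc, h1, h2⟩ := (enum_X K _).tr_mem.1 hv
    rw [interp_sigma (SimAt.left hc)] at h2
    obtain ⟨⟨h3, h4, h5⟩, h6, h7, h8⟩ := SimAt.sigma_elim hc
    have h9 := pfst_some_val h3 h4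
    have h10 := psnd_some_val h6 h7
    have hp : InTy K σ (val (fst c.1), val (fst c.2)) := h5
    rw [Fml.memSigma, tr_exB]
    refine ⟨_, _, (enum_X K σ).el hp, by simp [sumC, upd, h1, h9], ?_⟩
    rw [tr_ex]
    refine ⟨interp K (val (ap i (val (fst c.1)))) (val (snd c.1)), ?_⟩
    rw [tr_and]
    refine ⟨by simpa [sumC, upd] using h2.isPair, ?_⟩
    simp only [sumC, eval_close, eval_lam, clo_pap, eval_lpair, pfst_pairVal, psnd_pairVal,
      eval_app, eval_var, eval_con, eval_fst, upd, if_true, h1, h9]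
    refine Tr.memVal (iy := fun p => X K (val (ap i p.1))) (enum_F hi) hp ?_
    refine tr_mem_X_self (p := (val (snd c.1), val (snd c.2))) h8 ?_ ?_
    · simp [upd, h1, h10]
    · simp
  · rw [Fml.memSigma, tr_exB] at hv
    obtain ⟨p, x, hx, h1, h2⟩ := hv
    obtain ⟨hp, rfl⟩ := (enum_X K σ p x).1 hx
    simp only [tr_ex, tr_and] at h2
    obtain ⟨y, h2, h3⟩ := h2
    obtain ⟨r, hr, h4, h5⟩ := (enum_X K _).tr_mem.1 (h3.of_memVal (isGraph_F hi) hp)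
    simp only [sumC, eval_close, eval_lam, clo_pap, eval_lpair, psnd_pairVal]
    rw [(enum_X K _).tr_mem]
    simp only [pfst_pairVal, psnd_pairVal, eval_lpair]
    -- Equality in a `Σ`-type looks only at projections, so the lazy pair is as good as one formed
    -- with `p`.
    generalize hc : pairVal (P := A × A) _ _ _ = c
    obtain ⟨h6, h6'⟩ := fst_of_pfst (c := c) (r := p) (by simp [← hc, upd, h1])
    obtain ⟨h7, h7'⟩ := snd_of_psnd (c := c) (r := r) (by simp [← hc, upd, h4])
    have hcT : InTy K (tySigma σ i) c := by
      rw [InTy, hσ.simAt_sigma hi]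
      refine ⟨p.1, by simp [h6], p.2, by simp [h6'], hp, ?_⟩
      rw [h7, h7']
      exact ⟨_, Part.mem_some _, _, Part.mem_some _, hr⟩
    refine ⟨c, hcT, rfl, ?_⟩
    rw [interp_sigma (SimAt.left hcT), h6, h7, val_some, val_some]
    simpa [upd] using h2.of_isPair.trans ((tr_refl _).opair_congr h5)

/-- Realizer of `X_{I_σ(a, b)} = I(a^σ, b^σ)`. -/
def idC : CTerm :=
  (lpair (lam 0 (lpair (con .k) (con reflC))) (lam 0 (lpair (con .zero) (con .k)))).close

theorem tr_id (hK : K.HasI) (ha : HasType K σ a) (hb : HasType K σ b) :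
    Tr (idC.eval _) (.isId (X K (tyId σ a b)) (interp K σ a) (interp K σ b)) := by
  simp only [Fml.isId, tr_all, tr_iff, tr_imp]
  refine fun z => ⟨⟨by simp [idC], fun v hv => ?_⟩, by simp [idC], fun v hv => ?_⟩
  · obtain ⟨c, hc, h1, h2⟩ := (enum_X K _).tr_mem.1 hv
    rw [interp_id (SimAt.left hc)] at h2
    rw [InTy, ha.simAt_id hK hb] at hc
    -- An inhabited identity type means `a ∼_σ b`, so the two names coincide and reflexivity
    -- realizes their equality.
    rw [tr_and, ← interp_congr hc.2.2 ha.isType]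
    refine ⟨tr_isEmpty ?_ fun _ _ => not_el_of_tr_eq h2 fun _ _ => not_el_empty, ?_⟩
    · simp [idC, eval_k]
    · simpa [idC] using tr_refl _
  · rw [tr_and] at hv
    -- By injectivity of names a realizer of the equality yields `a ∼_σ b`, so `0` inhabits the
    -- identity type.
    have hab := hv.2.simAt ha hb
    have hc : InTy K (tyId σ a b) (num 0) := by
      rw [InTy, ha.simAt_id hK hb]
      exact ⟨rfl, rfl, hab⟩
    rw [(enum_X K _).tr_mem]
    refine ⟨num 0, hc, by simp [idC], ?_⟩
    rw [interp_id (SimAt.left hc)]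
    refine tr_eq_empty ?_ (fun _ _ => not_tr_mem_of_isEmpty hv.1) fun _ _ => not_el_empty
    simp [idC, eval_k]

end Realizers

end ExtRealizability

namespace ExtRealizability

/-! ### `W`-types and the inductively defined class `W(X, F)` -/

section WTypes

open OTerm VExt

variable {A : Type u} [PCA A] {K : Kind} {σ i a b c : A} {s : Part (A × A)} {x y z w : VExt A}
  {p q : A × A} {u : A → VExt A}

/-- There is a name for the tree of predecessors of each `c` of type `W_σ i`. -/
theorem exists_rank (K : Kind) (σ i : A) : ∃ u : A → VExt A, ∀ c, HasType K (tyW σ i) c →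
    u c = ofRel (SimAt K (val (ap i (val (fst c))))) fun p => u (val (sndAp c p)) := by
  -- The subtree relation is cut down to elements `c` of the type; all other elements are then
  -- accessible for lack of predecessors.
  let r : A → A → Prop := fun e c => HasType K (tyW σ i) c ∧
    ∃ p, HasType K (val (ap i (val (fst c)))) p ∧ e = val (sndAp c p)
  have hr : WellFounded r := by
    refine ⟨fun c => ?_⟩
    by_cases hc : HasType K (tyW σ i) c
    · refine SimAt.w_induction (motive := fun c _ => Acc r c) (fun c d _ ih => ⟨_, ?_⟩) hc
      rintro _ ⟨-, p, hp, rfl⟩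
      exact ih p p hp
    · exact ⟨_, fun e he => absurd he.1 hc⟩
  classical
  refine ⟨hr.fix fun c ih => ofRel (SimAt K (val (ap i (val (fst c))))) fun p =>
    if h : r (val (sndAp c p)) c then ih _ h else empty, fun c hc => ?_⟩
  rw [hr.fix_eq]
  -- The guard of the recursion holds at every `p` that occurs as an index.
  exact ofRel_congr fun p q hpq => dif_pos ⟨hc, p, hpq.left, rfl⟩

theorem psnd_pap (c p : A × A) : psnd (Part.some c) ⋄ Part.some p =
    pprod (sndAp c.1 p.1) (sndAp c.2 p.2) := by
  rw [psnd_prod, sndAp, sndAp, ← pprod_bind]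
  simp only [pap, Part.bind_some]
  rfl

theorem psnd_pap_val (h1 : (sndAp p.1 q.1).Dom) (h2 : (sndAp p.2 q.2).Dom) :
    psnd (Part.some p) ⋄ Part.some q = Part.some (val (sndAp p.1 q.1), val (sndAp p.2 q.2)) := by
  rw [psnd_pap]
  exact pprod_eq_some.2 ⟨val_mem h1, val_mem h2⟩

theorem sndAp_of_psnd_pap {r : A × A} (h : psnd (Part.some p) ⋄ Part.some q = Part.some r) :
    sndAp p.1 q.1 = Part.some r.1 ∧ sndAp p.2 q.2 = Part.some r.2 := by
  rw [psnd_pap, pprod_eq_some] at h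
  exact ⟨Part.eq_some_iff.2 h.1, Part.eq_some_iff.2 h.2⟩

/-- The iteration set `{⟨c, d, ⟨u c, c^δ⟩_A⟩ | c ∼_δ d}` for `δ = W_σ i`. -/
noncomputable def iterSet (K : Kind) (σ i : A) (u : A → VExt A) : VExt A :=
  ofRel (SimAt K (tyW σ i)) fun c => opair (u c) (interp K (tyW σ i) c)

theorem enum_iterSet : Enum (iterSet K σ i u) (InTy K (tyW σ i))
    fun p => opair (u p.1) (interp K (tyW σ i) p.1) := enum_ofRel _ _

/-- The branching function of an element of a `W`-type has values in the iteration set. -/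
def iterRanC : CTerm :=
  let n := con ofPairMemC ⬝ var 2
  let o := tsnd (var 1 ⬝ tfst n)
  (lam 0 (lam 1 (lam 2 (lpair (tfst o) (con pairMemC ⬝ (lpair (tsnd (var 0) ⬝ tfst n)
    (con opairCongrC ⬝ (con symmC ⬝ tsnd o) ⬝ (con opairInjRightC ⬝ tsnd n)))))))).close

/-- A value of the branching function of `c` is the name of the subtree at some index `q`. The tree
`u c` has under the same index `q` the element `u` of that subtree, and these two form an entry of
the iteration set. -/
theorem Tr.iter_ran (hu : ∀ c, HasType K (tyW σ i) c →
      u c = ofRel (SimAt K (val (ap i (val (fst c))))) fun p => u (val (sndAp c p)))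
    {t : VExt A} (hp : InTy K (tyW σ i) p) (h : Tr s (.eq x (u p.1))) {v : A × A}
    (hv : Tr (Part.some v) (.pairMem t w (branch K σ i p.1))) :
    Tr (iterRanC.eval _ ⋄ Part.some p ⋄ s ⋄ Part.some v)
      (.exB x fun v => .pairMem v w (iterSet K σ i u)) := by
  obtain ⟨a, rfl⟩ := h.exists_some
  obtain ⟨q, hq, h1, h2⟩ := (enum_branch K σ i p.1).tr_mem.1 hv.of_pairMem
  obtain ⟨h3, h4, h5⟩ := (SimAt.w_elim hp).2 _ _ hq
  rw [hu _ (SimAt.left hp)] at h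
  obtain ⟨r, x', hx', h6, h7⟩ := tr_mem.1 (h.eq_right ((enum_ofRel _ _).el (p := q) hq))
  rw [tr_exB]
  refine ⟨r, x', hx', by simp [iterRanC, upd, h1, h6], ?_⟩
  have hr : InTy K (tyW σ i) (val (sndAp p.1 q.1), val (sndAp p.2 q.2)) := h5
  simp only [iterRanC, eval_close, eval_lam, clo_pap, eval_lpair, psnd_pairVal, eval_app, eval_con]
  refine Tr.pairMem (enum_iterSet.tr_mem.2 ⟨_, hr, ?_, ?_⟩)
  · simp [upd, h1, psnd_pap_val h3 h4]
  · simpa [upd, h1] using h7.symm.opair_congr h2.opair_inj_right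

/-- Realizer of the statement that the iteration set is one. -/
def iterC : CTerm :=
  let m := con ofPairMemC ⬝ var 1
  let p := tfst (tfst m)
  (lpair (lam 1 (con isPairC ⬝ con reflC))
    (lam 1 (lpair p (lpair (con isPairC ⬝ (con opairInjRightC ⬝ tsnd m))
      (lpair (con isFunC ⬝ con reflC)
        (lpair (lpair (con graphC ⬝ p) (con hasDomC ⬝ con reflC ⬝ con reflC))
          (con iterRanC ⬝ tfst m ⬝ (con opairInjLeftC ⬝ tsnd m)))))))).close

/-- The entry for `c` is justified by the rule with `x = (c₀)^σ` and `f` the branching function of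
`c`. The set `D` is the name of the fibre over `c₀`, and the premises are covered by `Tr.iter_ran`.
-/
theorem tr_iter (hi : IsFamily K σ i) (hu : ∀ c, HasType K (tyW σ i) c →
      u c = ofRel (SimAt K (val (ap i (val (fst c))))) fun p => u (val (sndAp c p))) :
    Tr (iterC.eval _) (.isIterW (iterSet K σ i u) (X K σ) (F K σ i)) := by
  rw [Fml.isIterW, tr_and, Fml.isRel, tr_allB]
  refine ⟨⟨by simp [iterC], fun p z hz => ?_⟩, ?_⟩
  · obtain ⟨-, rfl⟩ := (enum_iterSet p z).1 hz
    simp only [tr_ex]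
    exact ⟨_, _, by simpa [iterC] using (tr_refl _).isPair⟩
  · simp only [tr_all, tr_imp]
    refine fun x y => ⟨by simp [iterC], fun v hv => ?_⟩
    obtain ⟨c, hc, h1, h2⟩ := enum_iterSet.tr_mem.1 hv.of_pairMem
    have hy := h2.opair_inj_right
    rw [interp_w (SimAt.left hc)] at hy
    obtain ⟨⟨h3, h4, h5⟩, -⟩ := SimAt.w_elim hc
    have h6 := pfst_some_val h3 h4
    have hp : InTy K σ (val (fst c.1), val (fst c.2)) := h5
    have hg := isGraph_branch (SimAt.left hc)
    rw [tr_exB]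
    refine ⟨_, _, (enum_X K σ).el hp, by simp [iterC, upd, h1, h6], ?_⟩
    rw [tr_ex]
    refine ⟨branch K σ i c.1, ?_⟩
    simp only [tr_and, tr_ex, tr_all, tr_imp]
    refine ⟨by simpa [iterC, upd] using hy.isPair,
      by simpa [iterC, upd] using (tr_refl _).isFun hg, ⟨X K (val (ap i (val (fst c.1)))), ?_, ?_⟩,
      fun w => ⟨?_, ?_⟩⟩
    · simpa [iterC, upd, h1, h6] using tr_graph (enum_F hi) hp
    · simpa [iterC, upd] using (tr_refl _).hasDom (tr_refl _) hg (enum_X K _)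
    -- Only definedness is at stake here: `iterRanC` converges when given two of its three
    -- arguments.
    · obtain ⟨a, ha⟩ := h2.opair_inj_left.exists_some
      simp [iterC, upd, h1, ha]
      simp [iterRanC]
    · rintro v' ⟨t, hv'⟩
      simpa [iterC, upd, h1] using h2.opair_inj_left.iter_ran hu hc hv'

/-- Realizer of `y ∈ X_{W_σ i} → y ∈ W(X_σ, F_{σ,i})`. -/
def toWC : CTerm :=
  (lam 0 (lpair (con iterC) (con pairMemC ⬝
    lpair (tfst (var 0)) (con opairCongrC ⬝ con reflC ⬝ tsnd (var 0))))).close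

theorem Tr.to_w (hi : IsFamily K σ i) (h : Tr s (.mem y (X K (tyW σ i)))) :
    Tr (toWC.eval _ ⋄ s) (.memW y (X K σ) (F K σ i)) := by
  obtain ⟨a, rfl⟩ := h.exists_some
  obtain ⟨c, hc, h1, h2⟩ := (enum_X K _).tr_mem.1 h
  obtain ⟨u, hu⟩ := exists_rank K σ i
  simp only [Fml.memW, tr_ex, tr_and]
  refine ⟨u c.1, iterSet K σ i u, by simpa [toWC] using tr_iter hi hu, ?_⟩
  simp only [toWC, eval_close, eval_lam, clo_pap, eval_lpair, psnd_pairVal, eval_app, eval_con]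
  refine Tr.pairMem (enum_iterSet.tr_mem.2 ⟨c, hc, ?_, ?_⟩)
  · simpa [upd] using h1
  · simpa [upd] using (tr_refl _).opair_congr h2

/-- The premise of the rule by which the given element of an iteration set is obtained. -/
def ruleT : OTerm := tsnd (tfst (var 0)) ⬝ var 2

/-- The set over which the given element of an iteration set branches. -/
def domT : OTerm := tfst (tsnd (tsnd (tsnd ruleT)))

/-- The branch of the given element of an iteration set at the argument `var 3`. -/
def branchT : OTerm :=
  tfst (tsnd domT) ⬝ (con memRightC ⬝ lpair (var 3) (con reflC) ⬝
    (con symmC ⬝ (con valC ⬝ tfst domT)))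

/-- The recursive call for this branch. -/
def recT : OTerm := var 1 ⬝ tsnd (tsnd (tsnd (tsnd (tsnd ruleT))) ⬝ branchT)

/-- The step of the recursion from an iteration set into a `W`-type. -/
def ofWStep : OTerm :=
  lpair (lpair (tfst ruleT) (lam 3 (tfst recT)))
    (con transC ⬝ (con ofIsPairC ⬝ tfst (tsnd ruleT)) ⬝ (con opairCongrC ⬝ con reflC ⬝
      (con funEqC ⬝ tfst (tsnd (tsnd ruleT)) ⬝ tsnd domT ⬝ (con valC ⬝ tfst domT) ⬝
        lam 3 (lpair branchT (tsnd recT)))))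

/-- Realizer of `y ∈ W(X_σ, F_{σ,i}) → y ∈ X_{W_σ i}`. -/
def ofWC : CTerm := (lam 0 (fixp 1 2 ofWStep ⬝ tsnd (var 0))).close

/-- From a realizer of `⟨u, y⟩ ∈ Z` the rule yields the index of the label and, for each index of
the fibre, some `v ∈ u` with the corresponding value of `f` entered in `Z` at `v`. Recursion at `v`
gives an index for that value; label and recursive calls together form the tree that `y` names. -/
theorem Tr.of_w (hK : K.HasW) (hi : IsFamily K σ i)
    (h : Tr s (.memW y (X K σ) (F K σ i))) : Tr (ofWC.eval _ ⋄ s) (.mem y (X K (tyW σ i))) := by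
  obtain ⟨v, rfl⟩ := h.exists_some
  simp only [Fml.memW, tr_ex, tr_and] at h
  obtain ⟨u, Z, hZ, hb⟩ := h
  obtain ⟨e, he, hrec⟩ := exists_fixp (P := A × A) (upd (fun _ => PCA.k) 0 v) 1 2 ofWStep
  obtain ⟨b, hbv⟩ := hb.exists_some
  have hgoal : ofWC.eval _ ⋄ Part.some v = Part.some e ⋄ Part.some b := by
    simp [ofWC, he, ← hbv, upd]
  rw [hbv] at hb
  rw [hgoal]
  -- The realizer `v` with its information about `Z` stays fixed, while `u`, `y` and the realizer
  -- `b` of `⟨u, y⟩ ∈ Z` vary in the induction.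
  clear hgoal hbv he
  rw [Fml.isIterW, tr_and] at hZ
  replace hZ := hZ.2
  simp only [tr_all, tr_imp] at hZ
  induction u using isElt_wf.induction generalizing y b with
  | _ u ih =>
    have h := (hZ u y).2 b hb
    rw [tr_exB] at h
    obtain ⟨p, x, hx, h1, h2⟩ := h
    obtain ⟨hp, rfl⟩ := (enum_X K σ p x).1 hx
    simp only [tr_ex, tr_and, tr_all, tr_imp] at h2
    obtain ⟨f, h2, h3, ⟨D, h4, h5⟩, h6⟩ := h2
    have hD := h4.eq_val (isGraph_F hi) hp
    rw [hrec, ofWStep]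
    simp only [eval_lpair]
    rw [(enum_X K _).tr_mem]
    simp only [pfst_pairVal, psnd_pairVal, eval_lpair]
    generalize hρ : upd (upd (upd (fun _ => PCA.k) 0 v) 1 e) 2 b = ρ
    have h7 : ruleT.eval ρ = psnd (pfst (Part.some v)) ⋄ Part.some b := by
      simp [ruleT, ← hρ, upd]
    have hρe : ρ 1 = e := by simp [← hρ, upd]
    have h7' : ∀ q, ruleT.eval (upd ρ 3 q) = psnd (pfst (Part.some v)) ⋄ Part.some b := fun q => by
      simp [ruleT, ← hρ, upd]
    have h8 : ∀ q, InTy K (val (ap i p.1)) q → ∃ w r,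
        Tr (branchT.eval (upd ρ 3 q)) (.pairMem (interp K (val (ap i p.1)) q.1) w f) ∧
        InTy K (tyW σ i) r ∧ pfst (recT.eval (upd ρ 3 q)) = Part.some r ∧
        Tr (psnd (recT.eval (upd ρ 3 q))) (.eq w (interp K (tyW σ i) r.1)) := by
      intro q hq
      have hm : Tr (Part.some (pairVal (upd ρ 3 q) (var 3) (con reflC)))
          (.mem (interp K _ q.1) (X K (val (ap i p.1)))) :=
        tr_mem_X_self hq (by simp [upd]) (by simp)
      rw [Fml.hasDom, tr_all] at h5
      -- The domain of `f` is only known to equal the name of the fibre, so membership is first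
      -- transported along `hD`.
      have h9 := (tr_iff.1 (h5 (interp K (val (ap i p.1)) q.1))).1.imp (hm.mem_right hD.symm)
      rw [tr_ex] at h9
      obtain ⟨w, h9⟩ := h9
      replace h9 : Tr (branchT.eval (upd ρ 3 q)) (.pairMem (interp K (val (ap i p.1)) q.1) w f) := by
        simpa [branchT, domT, h7', upd] using h9
      obtain ⟨b', hb'⟩ := h9.exists_some
      have h10 := (h6 w).2 b' ⟨_, hb' ▸ h9⟩
      rw [tr_exB] at h10
      obtain ⟨r, u', hu', h11, h12⟩ := h10
      obtain ⟨b'', hb''⟩ := h12.exists_some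
      rw [hb''] at h12
      -- The recursion descends here, since `u'` is an element of `u`.
      obtain ⟨r, hr, h13, h14⟩ := (enum_X K _).tr_mem.1 (ih u' hu'.isElt b'' h12)
      have h15 : recT.eval (upd ρ 3 q) = Part.some e ⋄ Part.some b'' := by
        simp [recT, h7', hb', hb'', hρe, upd]
      rw [← h15] at h13 h14
      exact ⟨w, r, h9, hr, h13, h14⟩
    generalize hc : pairVal ρ _ (lam 3 _) = c
    obtain ⟨h9, h9'⟩ := fst_of_pfst (c := c) (r := p) (by simp [← hc, h7, h1])
    have h10 : ∀ q r, pfst (recT.eval (upd ρ 3 q)) = Part.some r →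
        sndAp c.1 q.1 = Part.some r.1 ∧ sndAp c.2 q.2 = Part.some r.2 := fun q r hr =>
      sndAp_of_psnd_pap (by simp [← hc, hr])
    -- Related indices of the fibre form an element of `A × A`, and the recursive call sends it to a
    -- related pair of trees; hence `c` satisfies the introduction rule for `W`.
    have hcT : InTy K (tyW σ i) c := by
      refine .w_intro hK hi (by rw [h9]; trivial) (by rw [h9']; trivial) ?_ ?_
      · rw [h9, h9', val_some, val_some]
        exact hp
      · rw [h9, val_some]
        intro a a' ha
        obtain ⟨w, r, -, hr, h11, -⟩ := h8 (a, a') ha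
        obtain ⟨h12, h13⟩ := h10 _ _ h11
        rw [h12, h13, val_some, val_some]
        exact ⟨trivial, trivial, hr⟩
    refine ⟨c, hcT, rfl, ?_⟩
    have hY := enum_X K (val (ap i p.1))
    have hG := enum_branch K σ i c.1
    rw [interp_w (SimAt.left hcT)]
    rw [h9, val_some] at hG ⊢
    simp only [eval_app, eval_con, eval_fst, eval_snd, eval_lam, domT, h7]
    refine h2.of_isPair.trans ((tr_refl _).opair_congr (Tr.fun_eq h3 h5 hD (fun q hq => ?_) hG hY))
    obtain ⟨w, r, h11, hr, h12, h13⟩ := h8 q hq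
    refine ⟨w, by simpa using h11, ?_⟩
    rw [(h10 _ _ h12).1, val_some]
    simpa using h13

/-- Realizer of `X_{W_σ i} = W(X_σ, F_{σ,i})`. -/
def wC : CTerm := (lpair (con toWC) (con ofWC)).close

theorem tr_w (hK : K.HasW) (hi : IsFamily K σ i) :
    Tr (wC.eval _) (.isW (X K (tyW σ i)) (X K σ) (F K σ i)) := by
  simp only [Fml.isW, tr_all, tr_iff, tr_imp]
  refine fun z => ⟨⟨by simp [wC, toWC], fun v hv => ?_⟩, by simp [wC, ofWC], fun v hv => ?_⟩
  · simpa [wC] using hv.to_w hi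
  · simpa [wC] using hv.of_w hK hi

end WTypes

end ExtRealizability

open ExtRealizability in
theorem mainTheorem7 :
    ∃ o func prod sum idt w : CTerm,
      ∀ (A : Type u) [PCA A] (K : Kind),
        o.Forces (Fml.isOmega (X K (tyNat : A))) ∧
        (∀ σ i : A, IsType K σ → IsFamily K σ i →
          func.Forces ((Fml.isFun (F K σ i)).and (Fml.hasDom (F K σ i) (X K σ))) ∧
          prod.Forces (Fml.isPi (X K (tyPi σ i)) (X K σ) (F K σ i)) ∧
          sum.Forces (Fml.isSigma (X K (tySigma σ i)) (X K σ) (F K σ i))) ∧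
        (K.HasI → ∀ σ a b : A, IsType K σ → HasType K σ a → HasType K σ b →
          idt.Forces (Fml.isId (X K (tyId σ a b)) (interp K σ a) (interp K σ b))) ∧
        (K.HasW → ∀ σ i : A, IsType K σ → IsFamily K σ i →
          w.Forces (Fml.isW (X K (tyW σ i)) (X K σ) (F K σ i))) := by
  refine ⟨omegaC, functionC, prodC, sumC, idC, wC, fun A _ K => ⟨forces_of_tr (tr_omega K), ?_, ?_, ?_⟩⟩
  · exact fun σ i hσ hi => ⟨forces_of_tr (tr_function hi), forces_of_tr (tr_prod hσ hi),
      forces_of_tr (tr_sum hσ hi)⟩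
  · exact fun hK σ a b _ ha hb => forces_of_tr (tr_id hK ha hb)
  · exact fun hK σ i _ hi => forces_of_tr (tr_w hK hi)
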